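/- All algebras are associative, not necessarily unital, over $\mathbb{C}$. For an algebra $B$ with non-degenerate product (i.e. $b=0$ as soon as $bB=0$ or $Bb=0$), $M(B)$ denotes its multiplier algebra. Let $(A,\Delta)$ be a regular weak multiplier Hopf algebra (in the sense of Van Daele and Wang), with counit $\varepsilon$ and canonical idempotent $E\in M(A\otimes A)$; write $\Delta(a)=\sum a_{(1)}\otimes a_{(2)}$ and $E=E_{(1)}\otimes E_{(2)}$. For $c\in A$ let $\varepsilon_t(c)=(\varepsilon\otimes\iota)(E(c\otimes 1))$ and $\varepsilon'_s(c)=(\iota\otimes\varepsilon)(E(1\otimes c))$ in $M(A)$. Let $R$ be an algebra with non-degenerate product that is a left $A$-module algebra: $R$ is a left $A$-module with action $\rhd$, the module is unital (the span of all $a\rhd r$ is $R$), and $a\rhd(xy)=\sum(a_{(1)}\rhd x)(a_{(2)}\rhd y)$ for $a\in A$ and $x,y\in R$. Unital actions are extended to multipliers by $m\rhd\sum_i a_i\rhd r_i=\sum_i (ma_i)\rhd r_i$; in particular $M(A\otimes A)$ acts on $R\otimes A$, extending $(b\otimes c)\rhd(r\otimes a)=(b\rhd r)\otimes ca$. Let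 $R\# A$ be the vector space $R\otimes A$ with the product $(r\otimes a)(s\otimes b)=\sum r(a_{(1)}\rhd s)\otimes a_{(2)}b$, where $\sum a_{(1)}\otimes a_{(2)}b=\Delta(a)(1\otimes b)\in A\otimes A$. The smash product $R\#_E A$ is the subspace $E\rhd(R\otimes A)$ of $R\# A$ with the product of $R\# A$. Let $R\otimes_{\varepsilon_t(A)}A$ be the balanced tensor product for the right action $r\cdot\varepsilon_t(c)=\varepsilon'_s(c)\rhd r$ of $\varepsilon_t(A)$ on $R$ and left multiplication on $A$, i.e. the quotient of $R\otimes A$ by the span of all $(\varepsilon'_s(c)\rhd r)\otimes a-r\otimes\varepsilon_t(c)a$ with $r\in R$ and $a,c\in A$. Then the formula $$(r\otimes a)(s\otimes b)=\sum r(a_{(1)}\rhd s)\otimes a_{(2)}b\qquad (r,s\in R,\ a,b\in A)$$ gives a well-defined associative and non-degenerate product on $R\otimes_{\varepsilon_t(A)}A$, and $$r\otimes a\longmapsto E\rhd(r\otimes a)=E_{(1)}\rhd r\otimes E_{(2)}a$$ (so that $r\otimes xa\mapsto E_{(1)}\rhd r\otimes E_{(2)}xa$ for $x\in\varepsilon_t(A)$)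 is a well-defined isomorphism of algebras from $R\otimes_{\varepsilon_t(A)}A$ onto $R\#_E A$. -/

import Mathlib

open scoped TensorProduct

/-- The product of `A` is non-degenerate. -/
def NonDegenerateProduct (A : Type*) [NonUnitalRing A] : Prop :=
  (∀ a : A, (∀ b : A, a * b = 0) → a = 0) ∧ (∀ a : A, (∀ b : A, b * a = 0) → a = 0)

/-- The multiplier algebra `M(A)`: pairs `(l, r)` of a left multiplier `l` (the map `a ↦ m a`) and a
right multiplier `r` (the map `a ↦ a m`) with `r(a) b = a l(b)`. The product is
`(l, r)(l', r') = (l ∘ l', r' ∘ r)`, which is why `r` lives in the opposite algebra. -/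
def MultiplierAlgebra (A : Type*) [NonUnitalRing A] [Module ℂ A] [IsScalarTower ℂ A A]
    [SMulCommClass ℂ A A] : Subalgebra ℂ (Module.End ℂ A × (Module.End ℂ A)ᵐᵒᵖ) where
  carrier := {m | (∀ a b : A, m.1 (a * b) = m.1 a * b) ∧
    (∀ a b : A, m.2.unop (a * b) = a * m.2.unop b) ∧
    (∀ a b : A, m.2.unop a * b = a * m.1 b)}
  mul_mem' := by
    rintro x y ⟨h1, h2, h3⟩ ⟨k1, k2, k3⟩
    refine ⟨fun a b => ?_, fun a b => ?_, fun a b => ?_⟩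
    · simp [h1, k1]
    · simp [h2, k2]
    · simp [h3, k3]
  add_mem' := by
    rintro x y ⟨h1, h2, h3⟩ ⟨k1, k2, k3⟩
    refine ⟨fun a b => ?_, fun a b => ?_, fun a b => ?_⟩
    · simp [h1, k1, add_mul]
    · simp [h2, k2, mul_add]
    · simp [h3, k3, mul_add, add_mul]
  algebraMap_mem' := by
    intro c
    refine ⟨fun a b => ?_, fun a b => ?_, fun a b => ?_⟩ <;>
      simp [Prod.algebraMap_apply, MulOpposite.algebraMap_apply, Module.algebraMap_end_apply,
        smul_mul_assoc, mul_smul_comm]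

namespace MultiplierAlgebra

section

variable {A : Type*} [NonUnitalRing A] [Module ℂ A] [IsScalarTower ℂ A A] [SMulCommClass ℂ A A]
variable {B : Type*} [NonUnitalRing B] [Module ℂ B] [IsScalarTower ℂ B B] [SMulCommClass ℂ B B]

/-- The map `a ↦ m a`. -/
def left (m : MultiplierAlgebra A) : A →ₗ[ℂ] A := m.1.1

/-- The map `a ↦ a m`. -/
def right (m : MultiplierAlgebra A) : A →ₗ[ℂ] A := m.1.2.unop

/-- The canonical map `A → M(A)`; it is injective when the product of `A` is non-degenerate. -/
def incl : A →ₗ[ℂ] MultiplierAlgebra A where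
  toFun a := ⟨(LinearMap.mulLeft ℂ a, MulOpposite.op (LinearMap.mulRight ℂ a)),
    fun x y => by simp [mul_assoc], fun x y => by simp [mul_assoc],
    fun x y => by simp [mul_assoc]⟩
  map_add' a b := by
    apply Subtype.ext
    apply Prod.ext
    · ext x; simp [add_mul]
    · apply MulOpposite.unop_injective; ext x; simp [mul_add]
  map_smul' c a := by
    apply Subtype.ext
    apply Prod.ext
    · ext x; simp [smul_mul_assoc]
    · apply MulOpposite.unop_injective; ext x; simp [mul_smul_comm]

/-- The natural bilinear map `M(A) × M(B) → M(A ⊗ B)`, written `m ⊗ n`. -/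
noncomputable def tensor :
    MultiplierAlgebra A →ₗ[ℂ] MultiplierAlgebra B →ₗ[ℂ] MultiplierAlgebra (A ⊗[ℂ] B) :=
  LinearMap.mk₂ ℂ
    (fun m n => ⟨(TensorProduct.map (left m) (left n),
        MulOpposite.op (TensorProduct.map (right m) (right n))), by
      have hm := m.2
      have hn := n.2
      refine ⟨fun x y => ?_, fun x y => ?_, fun x y => ?_⟩
      · induction x with
        | zero => simp
        | add x₁ x₂ h₁ h₂ => simp only [add_mul, map_add, h₁, h₂]
        | tmul a b =>
          induction y with
          | zero => simp
          | add y₁ y₂ h₁ h₂ => simp only [mul_add, map_add, h₁, h₂]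
          | tmul c d =>
            have e₁ := hm.1 a c
            have e₂ := hn.1 b d
            simp only [Algebra.TensorProduct.tmul_mul_tmul, TensorProduct.map_tmul, left, e₁, e₂]
      · induction x with
        | zero => simp
        | add x₁ x₂ h₁ h₂ => simp only [add_mul, map_add, h₁, h₂]
        | tmul a b =>
          induction y with
          | zero => simp
          | add y₁ y₂ h₁ h₂ => simp only [mul_add, map_add, h₁, h₂]
          | tmul c d =>
            have e₁ := hm.2.1 a c
            have e₂ := hn.2.1 b d
            simp only [Algebra.TensorProduct.tmul_mul_tmul, TensorProduct.map_tmul, right,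
              MulOpposite.unop_op, e₁, e₂]
      · induction x with
        | zero => simp
        | add x₁ x₂ h₁ h₂ => simp only [add_mul, map_add, h₁, h₂]
        | tmul a b =>
          induction y with
          | zero => simp
          | add y₁ y₂ h₁ h₂ => simp only [mul_add, map_add, h₁, h₂]
          | tmul c d =>
            have e₁ := hm.2.2 a c
            have e₂ := hn.2.2 b d
            simp only [Algebra.TensorProduct.tmul_mul_tmul, TensorProduct.map_tmul, left, right,
              MulOpposite.unop_op, e₁, e₂]⟩)
    (fun m m' n => Subtype.ext (Prod.ext (TensorProduct.map_add_left _ _ _)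
      (MulOpposite.unop_injective (TensorProduct.map_add_left _ _ _))))
    (fun c m n => Subtype.ext (Prod.ext (TensorProduct.map_smul_left _ _ _)
      (MulOpposite.unop_injective (TensorProduct.map_smul_left _ _ _))))
    (fun m n n' => Subtype.ext (Prod.ext (TensorProduct.map_add_right _ _ _)
      (MulOpposite.unop_injective (TensorProduct.map_add_right _ _ _))))
    (fun c m n => Subtype.ext (Prod.ext (TensorProduct.map_smul_right _ _ _)
      (MulOpposite.unop_injective (TensorProduct.map_smul_right _ _ _))))

/-- Transport of multipliers along an isomorphism of algebras. -/
def transport (e : A ≃ₗ[ℂ] B) (he : ∀ x y, e (x * y) = e x * e y) (m : MultiplierAlgebra A) :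
    MultiplierAlgebra B :=
  ⟨(e.toLinearMap ∘ₗ left m ∘ₗ e.symm.toLinearMap,
      MulOpposite.op (e.toLinearMap ∘ₗ right m ∘ₗ e.symm.toLinearMap)), by
    have hs : ∀ x y, e.symm (x * y) = e.symm x * e.symm y := fun x y => by
      apply e.injective; simp [he]
    have h1 : ∀ x y, left m (x * y) = left m x * y := m.2.1
    have h2 : ∀ x y, right m (x * y) = x * right m y := m.2.2.1
    have h3 : ∀ x y, right m x * y = x * left m y := m.2.2.2
    refine ⟨fun x y => ?_, fun x y => ?_, fun x y => ?_⟩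
    · simp [hs, h1, he]
    · simp [hs, h2, he]
    · apply e.symm.injective
      simp [hs, h3]⟩

theorem assoc_mul (x y : (A ⊗[ℂ] A) ⊗[ℂ] A) :
    TensorProduct.assoc ℂ A A A (x * y) =
      TensorProduct.assoc ℂ A A A x * TensorProduct.assoc ℂ A A A y := by
  induction x with
  | zero => simp
  | add x₁ x₂ h₁ h₂ => simp only [add_mul, map_add, h₁, h₂]
  | tmul p c =>
    induction p with
    | zero => simp
    | add x₁ x₂ h₁ h₂ => simp only [TensorProduct.add_tmul, add_mul, map_add, h₁, h₂]
    | tmul a b =>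
      induction y with
      | zero => simp
      | add x₁ x₂ h₁ h₂ => simp only [mul_add, map_add, h₁, h₂]
      | tmul q d =>
        induction q with
        | zero => simp
        | add x₁ x₂ h₁ h₂ => simp only [TensorProduct.add_tmul, mul_add, map_add, h₁, h₂]
        | tmul a' b' => simp [Algebra.TensorProduct.tmul_mul_tmul]

theorem comm_mul (x y : A ⊗[ℂ] A) :
    TensorProduct.comm ℂ A A (x * y) = TensorProduct.comm ℂ A A x * TensorProduct.comm ℂ A A y := by
  induction x with
  | zero => simp
  | add x₁ x₂ h₁ h₂ => simp only [add_mul, map_add, h₁, h₂]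
  | tmul a b =>
    induction y with
    | zero => simp
    | add x₁ x₂ h₁ h₂ => simp only [mul_add, map_add, h₁, h₂]
    | tmul c d => simp [Algebra.TensorProduct.tmul_mul_tmul]

/-- The flip on `M(A ⊗ A)`. -/
def flip (m : MultiplierAlgebra (A ⊗[ℂ] A)) : MultiplierAlgebra (A ⊗[ℂ] A) :=
  transport (TensorProduct.comm ℂ A A) comm_mul m

/-- `m ⊗ 1` in `M(A ⊗ A ⊗ A)`, for `m` in `M(A ⊗ A)`. -/
noncomputable def inLegs₁₂ (m : MultiplierAlgebra (A ⊗[ℂ] A)) :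
    MultiplierAlgebra (A ⊗[ℂ] (A ⊗[ℂ] A)) :=
  transport (A := (A ⊗[ℂ] A) ⊗[ℂ] A) (B := A ⊗[ℂ] (A ⊗[ℂ] A))
    (TensorProduct.assoc ℂ A A A) assoc_mul
    (tensor m (1 : MultiplierAlgebra A))

/-- `1 ⊗ m` in `M(A ⊗ A ⊗ A)`, for `m` in `M(A ⊗ A)`. -/
noncomputable def inLegs₂₃ (m : MultiplierAlgebra (A ⊗[ℂ] A)) :
    MultiplierAlgebra (A ⊗[ℂ] (A ⊗[ℂ] A)) :=
  tensor (1 : MultiplierAlgebra A) m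

/-- `ι ⊗ Δ : A ⊗ A → M(A ⊗ A ⊗ A)`. -/
noncomputable def idTensor (Δ : A →ₙₐ[ℂ] MultiplierAlgebra (A ⊗[ℂ] A)) :
    A ⊗[ℂ] A →ₗ[ℂ] MultiplierAlgebra (A ⊗[ℂ] (A ⊗[ℂ] A)) :=
  TensorProduct.lift (tensor.compl₁₂ incl (Δ : A →ₗ[ℂ] MultiplierAlgebra (A ⊗[ℂ] A)))

/-- `F = (ι ⊗ Δ)(m)`, where `ι ⊗ Δ` is extended to the homomorphism `M(A ⊗ A) → M(A ⊗ A ⊗ A)`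
that maps `1` to `1 ⊗ E`. When `Δ(A)(A ⊗ A) = E(A ⊗ A)` and `(A ⊗ A)Δ(A) = (A ⊗ A)E`, at most one
`F` has these properties. -/
def IsIdTensorExtension (Δ : A →ₙₐ[ℂ] MultiplierAlgebra (A ⊗[ℂ] A))
    (E m : MultiplierAlgebra (A ⊗[ℂ] A)) (F : MultiplierAlgebra (A ⊗[ℂ] (A ⊗[ℂ] A))) : Prop :=
  inLegs₂₃ E * F = F ∧ F * inLegs₂₃ E = F ∧
  ∀ p : A ⊗[ℂ] A, F * idTensor Δ p = idTensor Δ (left m p) ∧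
    idTensor Δ p * F = idTensor Δ (right m p)

end

end MultiplierAlgebra

open MultiplierAlgebra in
/-- A weak multiplier Hopf algebra structure on the algebra `A`. The canonical maps `T₁`, `T₂`, the
counit `ε` and the canonical idempotent `E` are all uniquely determined by `Δ`. -/
structure WeakMultiplierHopfAlgebra (A : Type*) [NonUnitalRing A] [Module ℂ A]
    [IsScalarTower ℂ A A] [SMulCommClass ℂ A A] where
  nondegenerate : NonDegenerateProduct A
  /-- `A² = A`. -/
  idempotent : Function.Surjective (LinearMap.mul' ℂ A)
  /-- The coproduct, a homomorphism of algebras. -/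
  Δ : A →ₙₐ[ℂ] MultiplierAlgebra (A ⊗[ℂ] A)
  T₁ : A ⊗[ℂ] A →ₗ[ℂ] A ⊗[ℂ] A
  T₂ : A ⊗[ℂ] A →ₗ[ℂ] A ⊗[ℂ] A
  /-- `Δ(a)(1 ⊗ b)` is in `A ⊗ A`, and is `T₁(a ⊗ b)`. -/
  T₁_spec : ∀ a b : A, incl (T₁ (a ⊗ₜ b)) = Δ a * tensor 1 (incl b)
  /-- `(a ⊗ 1)Δ(b)` is in `A ⊗ A`, and is `T₂(a ⊗ b)`. -/
  T₂_spec : ∀ a b : A, incl (T₂ (a ⊗ₜ b)) = tensor (incl a) 1 * Δ b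
  /-- `(c ⊗ 1 ⊗ 1)(Δ ⊗ ι)(Δ(a)(1 ⊗ b)) = (ι ⊗ Δ)((c ⊗ 1)Δ(a))(1 ⊗ 1 ⊗ b)`. -/
  coassoc : ∀ a b c : A,
    TensorProduct.assoc ℂ A A A
        (T₂.rTensor A ((TensorProduct.assoc ℂ A A A).symm (c ⊗ₜ[ℂ] T₁ (a ⊗ₜ b)))) =
      T₁.lTensor A (TensorProduct.assoc ℂ A A A (T₂ (c ⊗ₜ a) ⊗ₜ[ℂ] b))
  /-- The coproduct is full: the left leg. -/
  full_left : ∀ V : Submodule ℂ A,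
    LinearMap.range T₁ ≤ LinearMap.range (V.subtype.rTensor A) → V = ⊤
  /-- The coproduct is full: the right leg. -/
  full_right : ∀ W : Submodule ℂ A,
    LinearMap.range T₂ ≤ LinearMap.range (W.subtype.lTensor A) → W = ⊤
  /-- The counit. -/
  ε : A →ₗ[ℂ] ℂ
  counit_left : ∀ a b : A, TensorProduct.lid ℂ A (ε.rTensor A (T₁ (a ⊗ₜ b))) = a * b
  counit_right : ∀ a b : A, TensorProduct.rid ℂ A (ε.lTensor A (T₂ (a ⊗ₜ b))) = a * b
  /-- The canonical idempotent. -/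
  E : MultiplierAlgebra (A ⊗[ℂ] A)
  E_idempotent : E * E = E
  /-- `E(A ⊗ A) = T₁(A ⊗ A)`. -/
  range_T₁ : LinearMap.range (left E) = LinearMap.range T₁
  /-- `(A ⊗ A)E = T₂(A ⊗ A)`. -/
  range_T₂ : LinearMap.range (right E) = LinearMap.range T₂
  /-- `(ι ⊗ Δ)E = (E ⊗ 1)(1 ⊗ E)`. -/
  idTensor_E : IsIdTensorExtension Δ E E (inLegs₁₂ E * inLegs₂₃ E)
  /-- `(E ⊗ 1)(1 ⊗ E) = (1 ⊗ E)(E ⊗ 1)`. -/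
  E_comm : inLegs₁₂ E * inLegs₂₃ E = inLegs₂₃ E * inLegs₁₂ E
  /-- `Ker T₁ = (1 - G₁)(A ⊗ A)`, where
  `(G₁ ⊗ ι)(Δ₁₃(a)(1 ⊗ b ⊗ c)) = Δ₁₃(a)(1 ⊗ E)(1 ⊗ b ⊗ c)`. Here `D₁₃(a ⊗ b ⊗ c)` is
  `Δ₁₃(a)(1 ⊗ b ⊗ c)`, that is, `T₁(a ⊗ c)` with `b` inserted in the middle. -/
  ker_T₁ : ∃ G₁ : A ⊗[ℂ] A →ₗ[ℂ] A ⊗[ℂ] A,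
    let D₁₃ : A ⊗[ℂ] (A ⊗[ℂ] A) →ₗ[ℂ] A ⊗[ℂ] (A ⊗[ℂ] A) :=
      (TensorProduct.leftComm ℂ A A A).toLinearMap ∘ₗ T₁.lTensor A ∘ₗ
        (TensorProduct.leftComm ℂ A A A).toLinearMap
    (∀ a b c : A,
      TensorProduct.assoc ℂ A A A
          (G₁.rTensor A ((TensorProduct.assoc ℂ A A A).symm (D₁₃ (a ⊗ₜ (b ⊗ₜ c))))) =
        D₁₃ (a ⊗ₜ left E (b ⊗ₜ c))) ∧
    LinearMap.ker T₁ = LinearMap.range (LinearMap.id - G₁)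
  /-- `Ker T₂ = (1 - G₂)(A ⊗ A)`, where
  `(ι ⊗ G₂)((a ⊗ b ⊗ 1)Δ₁₃(c)) = (a ⊗ b ⊗ 1)(E ⊗ 1)Δ₁₃(c)`. Here `D₁₃(a ⊗ b ⊗ c)` is
  `(a ⊗ b ⊗ 1)Δ₁₃(c)`, that is, `T₂(a ⊗ c)` with `b` inserted in the middle. -/
  ker_T₂ : ∃ G₂ : A ⊗[ℂ] A →ₗ[ℂ] A ⊗[ℂ] A,
    let D₁₃ : (A ⊗[ℂ] A) ⊗[ℂ] A →ₗ[ℂ] (A ⊗[ℂ] A) ⊗[ℂ] A :=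
      (TensorProduct.rightComm ℂ A A A).toLinearMap ∘ₗ T₂.rTensor A ∘ₗ
        (TensorProduct.rightComm ℂ A A A).toLinearMap
    (∀ a b c : A,
      (TensorProduct.assoc ℂ A A A).symm
          (G₂.lTensor A (TensorProduct.assoc ℂ A A A (D₁₃ ((a ⊗ₜ b) ⊗ₜ c)))) =
        D₁₃ (right E (a ⊗ₜ b) ⊗ₜ c)) ∧
    LinearMap.ker T₂ = LinearMap.range (LinearMap.id - G₂)

section ExtendedAction

variable {A : Type*} [AddCommGroup A] [Module ℂ A]
variable {V : Type*} [AddCommGroup V] [Module ℂ V] {W : Type*} [AddCommGroup W] [Module ℂ W]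

/-- A bilinear action of `A` on `V` is unital if `A V = V` (the span of all `a v` is `V`). -/
def IsUnitalAction (act : A →ₗ[ℂ] V →ₗ[ℂ] V) : Prop :=
  Function.Surjective (TensorProduct.lift act)

/-- The extension of a unital action of `A` to (left) multipliers: write `v = ∑ aᵢ vᵢ`
and put `m v = ∑ (m aᵢ) vᵢ`. The result does not depend on how `v` is written if `A` has local
units. A multiplier enters through its map `a ↦ m a`. -/
noncomputable def extendedAction (act : A →ₗ[ℂ] V →ₗ[ℂ] V) (h : IsUnitalAction act)
    (m : A →ₗ[ℂ] A) (v : V) : V :=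
  TensorProduct.lift act (m.rTensor V (Function.surjInv h v))

/-- The componentwise action `(a ⊗ b)(v ⊗ w) = a v ⊗ b w` of `A ⊗ A` on `V ⊗ W` is unital. -/
theorem IsUnitalAction.tensor {act : A →ₗ[ℂ] V →ₗ[ℂ] V} {act' : A →ₗ[ℂ] W →ₗ[ℂ] W}
    (h : IsUnitalAction act) (h' : IsUnitalAction act') :
    IsUnitalAction (TensorProduct.map₂ act act') := by
  intro t
  induction t with
  | zero => exact ⟨0, map_zero _⟩
  | add x y hx hy =>
    obtain ⟨p, rfl⟩ := hx
    obtain ⟨q, rfl⟩ := hy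
    exact ⟨p + q, map_add _ _ _⟩
  | tmul v w =>
    obtain ⟨p, rfl⟩ := h v
    obtain ⟨q, rfl⟩ := h' w
    refine ⟨TensorProduct.tensorTensorTensorComm ℂ A V A W (p ⊗ₜ q), ?_⟩
    induction p with
    | zero => simp
    | add x y hx hy => simp only [TensorProduct.add_tmul, map_add, hx, hy]
    | tmul a v =>
      induction q with
      | zero => simp
      | add x y hx hy => simp only [TensorProduct.tmul_add, map_add, hx, hy]
      | tmul b w => simp

end ExtendedAction

namespace WeakMultiplierHopfAlgebra

variable {A : Type*} [NonUnitalRing A] [Module ℂ A] [IsScalarTower ℂ A A] [SMulCommClass ℂ A A]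

open MultiplierAlgebra in
/-- `(A, Δ)` is regular: `Δ(a)(b ⊗ 1)` and `(1 ⊗ a)Δ(b)` are in `A ⊗ A`, and `(A, Δ^cop)` is a weak
multiplier Hopf algebra as well. -/
def IsRegular (H : WeakMultiplierHopfAlgebra A) : Prop :=
  (∀ a b : A, H.Δ a * tensor (incl b) 1 ∈ LinearMap.range (incl (A := A ⊗[ℂ] A))) ∧
  (∀ a b : A, tensor 1 (incl a) * H.Δ b ∈ LinearMap.range (incl (A := A ⊗[ℂ] A))) ∧
  ∃ H' : WeakMultiplierHopfAlgebra A, ∀ a : A, H'.Δ a = flip (H.Δ a)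

/-- `ε_t(a) = (ε ⊗ ι)(E(a ⊗ 1))`, as the map `b ↦ ε_t(a) b = (ε ⊗ ι)(E(a ⊗ b))` on `A`. -/
noncomputable def targetMap (H : WeakMultiplierHopfAlgebra A) (a : A) : A →ₗ[ℂ] A :=
  (TensorProduct.lid ℂ A).toLinearMap ∘ₗ H.ε.rTensor A ∘ₗ
    MultiplierAlgebra.left H.E ∘ₗ TensorProduct.mk ℂ A A a

/-- `ε'_s(a) = (ι ⊗ ε)(E(1 ⊗ a))`, as the map `b ↦ ε'_s(a) b = (ι ⊗ ε)(E(b ⊗ a))` on `A`. -/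
noncomputable def sourceMap' (H : WeakMultiplierHopfAlgebra A) (a : A) : A →ₗ[ℂ] A :=
  (TensorProduct.rid ℂ A).toLinearMap ∘ₗ H.ε.lTensor A ∘ₗ
    MultiplierAlgebra.left H.E ∘ₗ (TensorProduct.mk ℂ A A).flip a

/-- The structure of a left `A`-module algebra on the algebra `R`. -/
structure ModuleAlgebra (H : WeakMultiplierHopfAlgebra A) (R : Type*) [NonUnitalRing R]
    [Module ℂ R] [IsScalarTower ℂ R R] [SMulCommClass ℂ R R] where
  /-- The action `act a r = a ▷ r`. -/
  act : A →ₗ[ℂ] R →ₗ[ℂ] R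
  mul_act : ∀ (a b : A) (r : R), act (a * b) r = act a (act b r)
  unital : IsUnitalAction act
  /-- `a ▷ (x y) = ∑ (a₍₁₎ ▷ x)(a₍₂₎ ▷ y)`, that is, `a ▷ (x y) = m(Δ(a) ▷ (x ⊗ y))`. -/
  act_mul : ∀ (a : A) (x y : R), act a (x * y) = LinearMap.mul' ℂ R
    (extendedAction (TensorProduct.map₂ act act) (unital.tensor unital)
      (MultiplierAlgebra.left (H.Δ a)) (x ⊗ₜ y))

namespace ModuleAlgebra

variable {H : WeakMultiplierHopfAlgebra A} {R : Type*} [NonUnitalRing R]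
  [Module ℂ R] [IsScalarTower ℂ R R] [SMulCommClass ℂ R R]

/-- The product `(r ⊗ a)(s ⊗ b) = ∑ r(a₍₁₎ ▷ s) ⊗ a₍₂₎ b` on `R ⊗ A`; this algebra is `R # A`.
The formula on pure tensors is `sharpMul_tmul`. -/
noncomputable def sharpMul (M : H.ModuleAlgebra R) :
    R ⊗[ℂ] A →ₗ[ℂ] R ⊗[ℂ] A →ₗ[ℂ] R ⊗[ℂ] A :=
  TensorProduct.curry
    ((LinearMap.mul' ℂ R ∘ₗ
        (TensorProduct.lift M.act.flip).lTensor R ∘ₗ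
        (TensorProduct.assoc ℂ R R A).toLinearMap).rTensor A ∘ₗ
      (TensorProduct.assoc ℂ (R ⊗[ℂ] R) A A).symm.toLinearMap ∘ₗ
      H.T₁.lTensor (R ⊗[ℂ] R) ∘ₗ
      (TensorProduct.tensorTensorTensorComm ℂ R A R A).toLinearMap)

/-- With `Δ(a)(1 ⊗ b) = ∑ p ⊗ q`, the product `(r ⊗ a)(s ⊗ b)` is `∑ r(p ▷ s) ⊗ q`. -/
theorem sharpMul_tmul (M : H.ModuleAlgebra R) (r s : R) (a b : A) :
    M.sharpMul (r ⊗ₜ a) (s ⊗ₜ b) =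
      (LinearMap.mulLeft ℂ r ∘ₗ M.act.flip s).rTensor A (H.T₁ (a ⊗ₜ b)) := by
  simp only [sharpMul, TensorProduct.curry_apply, LinearMap.comp_apply, LinearEquiv.coe_coe,
    TensorProduct.tensorTensorTensorComm_tmul, LinearMap.lTensor_tmul]
  induction H.T₁ (a ⊗ₜ b) with
  | zero => simp
  | add x y hx hy => simp only [TensorProduct.tmul_add, map_add, hx, hy]
  | tmul p q => simp

/-- `E ▷ t` for `t` in `R ⊗ A`, so that `E ▷ (r ⊗ a) = E₍₁₎ ▷ r ⊗ E₍₂₎ a`: the action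
`(b ⊗ c)(r ⊗ a) = b ▷ r ⊗ c a` of `A ⊗ A` on `R ⊗ A` is extended to `M(A ⊗ A)`. -/
noncomputable def actE (M : H.ModuleAlgebra R) (t : R ⊗[ℂ] A) : R ⊗[ℂ] A :=
  extendedAction (TensorProduct.map₂ M.act (LinearMap.mul ℂ A))
    (M.unital.tensor (act' := LinearMap.mul ℂ A) H.idempotent) (MultiplierAlgebra.left H.E) t

/-- The underlying space of the smash product `R #_E A = E ▷ (R # A)`; its product is the one of
`R # A`. -/
noncomputable def smash (M : H.ModuleAlgebra R) : Submodule ℂ (R ⊗[ℂ] A) :=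
  Submodule.span ℂ (Set.range M.actE)

/-- The right action of `ε_t(A)` on `R`: `r · ε_t(c) = S⁻¹(ε_t(c)) ▷ r = ε'_s(c) ▷ r`. -/
noncomputable def targetAct (M : H.ModuleAlgebra R) (r : R) (c : A) : R :=
  extendedAction M.act M.unital (H.sourceMap' c) r

/-- The subspace of `R ⊗ A` spanned by all `r · x ⊗ a - r ⊗ x a`, with `x` in `ε_t(A)`. -/
noncomputable def balancing (M : H.ModuleAlgebra R) : Submodule ℂ (R ⊗[ℂ] A) :=
  Submodule.span ℂ
    {t | ∃ (r : R) (c a : A), t = M.targetAct r c ⊗ₜ a - r ⊗ₜ H.targetMap c a}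

/-- The space `R ⊗_t A`, the tensor product of `R` and `A` over the algebra `ε_t(A)`. -/
abbrev TensorOverTarget (M : H.ModuleAlgebra R) : Type _ := (R ⊗[ℂ] A) ⧸ M.balancing

end ModuleAlgebra

end WeakMultiplierHopfAlgebra

/-!
The multiplier `E` acts on `R ⊗ A` as an idempotent with range `R #_E A`, and its kernel is the
balancing subspace: it kills that subspace because `E(ε'_s(c) ⊗ 1) = E(1 ⊗ ε_t(c))`, while
`E(x ⊗ wy) = ∑ ε'_s(w₍₁₎)x ⊗ w₍₂₎y` and `∑ ε_t(w₍₁₎)w₍₂₎y = wy` show that `t - E ▷ t` is always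
balancing. The product of `R # A` absorbs `E` on either side and takes values fixed by `E`, so it
descends to the quotient and `E ▷ ·` is multiplicative.

That multipliers act on `R` at all rests on `R` having no nonzero element annihilated by `A`, which
follows from left local units in `A`. These exist because a functional vanishing on `A a` vanishes
at `a`, by the antipode identities.

For the non-degeneracy, if `(R # A) t = 0`, then `Δ(a) ▷ t = 0` for all `a`, hence `E ▷ t = 0` as
`(A ⊗ A)E` is spanned by the `(d ⊗ 1)Δ(a)`. If `t (R # A) = 0` with `t = ∑ r ⊗ a`, then
`∑ r(a₍₁₎ ▷ z) ⊗ a₍₂₎ = 0` for all `z`, and the antipode recovers `E ▷ t` from these through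
`∑ r(a₍₁₎S(a₍₂₎)b ▷ s) ⊗ a₍₃₎y = (E ▷ t)((b ▷ s) ⊗ y)`.
-/

open LinearMap (mulLeft mulRight)

section TensorProduct

variable {R M N P Q V W : Type*} [CommSemiring R] [AddCommMonoid M] [Module R M]
  [AddCommMonoid N] [Module R N] [AddCommMonoid P] [Module R P] [AddCommMonoid Q] [Module R Q]
  [AddCommMonoid V] [Module R V] [AddCommMonoid W] [Module R W]

theorem apply_eq_of_tmul (f g : M ⊗[R] N →ₗ[R] P) (h : ∀ x y, f (x ⊗ₜ y) = g (x ⊗ₜ y))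
    (z : M ⊗[R] N) : f z = g z :=
  LinearMap.congr_fun (TensorProduct.ext' h) z

theorem apply_eq_of_tmul₃ (f g : (M ⊗[R] N) ⊗[R] P →ₗ[R] Q)
    (h : ∀ x y z, f (x ⊗ₜ y ⊗ₜ z) = g (x ⊗ₜ y ⊗ₜ z)) (t : (M ⊗[R] N) ⊗[R] P) : f t = g t :=
  LinearMap.congr_fun (TensorProduct.ext_threefold h) t

theorem rTensor_lTensor_comm (f : M →ₗ[R] N) (g : P →ₗ[R] Q) (z : M ⊗[R] P) :
    f.rTensor Q (g.lTensor M z) = g.lTensor N (f.rTensor P z) :=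
  apply_eq_of_tmul (f.rTensor Q ∘ₗ g.lTensor M) (g.lTensor N ∘ₗ f.rTensor P) (fun _ _ => rfl) z

theorem map_eq_rTensor_lTensor (f : M →ₗ[R] N) (g : P →ₗ[R] Q) (z : M ⊗[R] P) :
    TensorProduct.map f g z = f.rTensor Q (g.lTensor M z) :=
  (LinearMap.congr_fun (LinearMap.rTensor_comp_lTensor _ f g) z).symm

theorem map_eq_lTensor_rTensor (f : M →ₗ[R] N) (g : P →ₗ[R] Q) (z : M ⊗[R] P) :
    TensorProduct.map f g z = g.lTensor N (f.rTensor P z) :=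
  (LinearMap.congr_fun (LinearMap.lTensor_comp_rTensor _ f g) z).symm

theorem comm_rTensor (f : M →ₗ[R] N) (z : M ⊗[R] P) :
    TensorProduct.comm R N P (f.rTensor P z) = f.lTensor P (TensorProduct.comm R M P z) :=
  (TensorProduct.map_comm LinearMap.id f z).symm

theorem comm_lTensor (f : M →ₗ[R] N) (z : P ⊗[R] M) :
    TensorProduct.comm R P N (f.lTensor P z) = f.rTensor P (TensorProduct.comm R P M z) :=
  (TensorProduct.map_comm f LinearMap.id z).symm

theorem map_rTensor_assoc (f : P →ₗ[R] N) (g : Q →ₗ[R] V) (z : (P ⊗[R] Q) ⊗[R] M) :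
    TensorProduct.map f (g.rTensor M) (TensorProduct.assoc R P Q M z) =
      TensorProduct.assoc R N V M ((TensorProduct.map f g).rTensor M z) :=
  TensorProduct.map_map_assoc f g LinearMap.id z

theorem lTensor_rTensor_assoc (g : Q →ₗ[R] V) (z : (P ⊗[R] Q) ⊗[R] M) :
    (g.rTensor M).lTensor P (TensorProduct.assoc R P Q M z) =
      TensorProduct.assoc R P V M ((g.lTensor P).rTensor M z) :=
  map_rTensor_assoc LinearMap.id g z

theorem rTensor_assoc (f : P →ₗ[R] N) (z : (P ⊗[R] Q) ⊗[R] M) :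
    f.rTensor (Q ⊗[R] M) (TensorProduct.assoc R P Q M z) =
      TensorProduct.assoc R N Q M ((f.rTensor Q).rTensor M z) :=
  apply_eq_of_tmul₃ (f.rTensor (Q ⊗[R] M) ∘ₗ (TensorProduct.assoc R P Q M).toLinearMap)
    ((TensorProduct.assoc R N Q M).toLinearMap ∘ₗ (f.rTensor Q).rTensor M) (fun _ _ _ => rfl) z

theorem lTensor_lTensor_assoc (g : M →ₗ[R] V) (z : (P ⊗[R] Q) ⊗[R] M) :
    (g.lTensor Q).lTensor P (TensorProduct.assoc R P Q M z) =
      TensorProduct.assoc R P Q V (g.lTensor (P ⊗[R] Q) z) :=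
  apply_eq_of_tmul₃ ((g.lTensor Q).lTensor P ∘ₗ (TensorProduct.assoc R P Q M).toLinearMap)
    ((TensorProduct.assoc R P Q V).toLinearMap ∘ₗ g.lTensor (P ⊗[R] Q)) (fun _ _ _ => rfl) z

theorem rTensor_assoc_symm (f : P →ₗ[R] N) (z : P ⊗[R] (Q ⊗[R] M)) :
    (f.rTensor Q).rTensor M ((TensorProduct.assoc R P Q M).symm z) =
      (TensorProduct.assoc R N Q M).symm (f.rTensor (Q ⊗[R] M) z) := by
  rw [LinearEquiv.eq_symm_apply, ← rTensor_assoc, LinearEquiv.apply_symm_apply]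

theorem lTensor_assoc_symm (g : M →ₗ[R] V) (z : P ⊗[R] (Q ⊗[R] M)) :
    g.lTensor (P ⊗[R] Q) ((TensorProduct.assoc R P Q M).symm z) =
      (TensorProduct.assoc R P Q V).symm ((g.lTensor Q).lTensor P z) := by
  rw [LinearEquiv.eq_symm_apply, ← lTensor_lTensor_assoc, LinearEquiv.apply_symm_apply]

theorem rTensor_lTensor_assoc_symm (g : Q →ₗ[R] V) (z : P ⊗[R] (Q ⊗[R] M)) :
    (g.lTensor P).rTensor M ((TensorProduct.assoc R P Q M).symm z) =
      (TensorProduct.assoc R P V M).symm ((g.rTensor M).lTensor P z) := by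
  rw [LinearEquiv.eq_symm_apply, ← lTensor_rTensor_assoc, LinearEquiv.apply_symm_apply]

/-- The slice map `φ ⊗ ι : M ⊗ P → P` of a functional `φ` on the left leg. -/
noncomputable def sliceLeft (φ : M →ₗ[R] R) : M ⊗[R] P →ₗ[R] P :=
  (TensorProduct.lid R P).toLinearMap ∘ₗ φ.rTensor P

/-- The slice map `ι ⊗ φ : P ⊗ M → P` of a functional `φ` on the right leg. -/
noncomputable def sliceRight (φ : M →ₗ[R] R) : P ⊗[R] M →ₗ[R] P :=
  (TensorProduct.rid R P).toLinearMap ∘ₗ φ.lTensor P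

@[simp]
theorem sliceLeft_tmul (φ : M →ₗ[R] R) (m : M) (p : P) : sliceLeft φ (m ⊗ₜ[R] p) = φ m • p :=
  rfl

@[simp]
theorem sliceRight_tmul (φ : M →ₗ[R] R) (m : M) (p : P) : sliceRight φ (p ⊗ₜ[R] m) = φ m • p :=
  rfl

theorem sliceLeft_lTensor (φ : M →ₗ[R] R) (f : P →ₗ[R] Q) (z : M ⊗[R] P) :
    sliceLeft φ (f.lTensor M z) = f (sliceLeft φ z) :=
  apply_eq_of_tmul (sliceLeft φ ∘ₗ f.lTensor M) (f ∘ₗ sliceLeft φ) (fun x y => by simp) z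

theorem sliceRight_rTensor (φ : M →ₗ[R] R) (f : P →ₗ[R] Q) (z : P ⊗[R] M) :
    sliceRight φ (f.rTensor M z) = f (sliceRight φ z) :=
  apply_eq_of_tmul (sliceRight φ ∘ₗ f.rTensor M) (f ∘ₗ sliceRight φ) (fun x y => by simp) z

theorem sliceRight_lTensor (φ : N →ₗ[R] R) (f : M →ₗ[R] N) (z : P ⊗[R] M) :
    sliceRight φ (f.lTensor P z) = sliceRight (φ ∘ₗ f) z :=
  apply_eq_of_tmul (sliceRight φ ∘ₗ f.lTensor P) (sliceRight (φ ∘ₗ f)) (fun _ _ => rfl) z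

theorem sliceLeft_rTensor (φ : N →ₗ[R] R) (f : M →ₗ[R] N) (z : M ⊗[R] P) :
    sliceLeft φ (f.rTensor P z) = sliceLeft (φ ∘ₗ f) z :=
  apply_eq_of_tmul (sliceLeft φ ∘ₗ f.rTensor P) (sliceLeft (φ ∘ₗ f)) (fun _ _ => rfl) z

theorem sliceLeft_comm (φ : M →ₗ[R] R) (z : P ⊗[R] M) :
    sliceLeft φ (TensorProduct.comm R P M z) = sliceRight φ z :=
  apply_eq_of_tmul (sliceLeft φ ∘ₗ (TensorProduct.comm R P M).toLinearMap) (sliceRight φ)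
    (fun _ _ => rfl) z

theorem sliceRight_comm (φ : M →ₗ[R] R) (z : M ⊗[R] P) :
    sliceRight φ (TensorProduct.comm R M P z) = sliceLeft φ z :=
  apply_eq_of_tmul (sliceRight φ ∘ₗ (TensorProduct.comm R M P).toLinearMap) (sliceLeft φ)
    (fun _ _ => rfl) z

theorem apply_sliceLeft (φ : M →ₗ[R] R) (ψ : P →ₗ[R] R) (z : M ⊗[R] P) :
    ψ (sliceLeft φ z) = φ (sliceRight ψ z) :=
  apply_eq_of_tmul (ψ ∘ₗ sliceLeft φ) (φ ∘ₗ sliceRight ψ) (fun x y => by simp [mul_comm]) z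

theorem lTensor_sliceLeft_assoc (φ : Q →ₗ[R] R) (z : (P ⊗[R] Q) ⊗[R] M) :
    (sliceLeft φ).lTensor P (TensorProduct.assoc R P Q M z) = (sliceRight φ).rTensor M z :=
  apply_eq_of_tmul₃ ((sliceLeft φ).lTensor P ∘ₗ (TensorProduct.assoc R P Q M).toLinearMap)
    ((sliceRight φ).rTensor M) (fun x y m => by simp [TensorProduct.smul_tmul']) z

theorem lTensor_sliceRight_assoc (φ : M →ₗ[R] R) (z : (P ⊗[R] Q) ⊗[R] M) :
    (sliceRight φ).lTensor P (TensorProduct.assoc R P Q M z) = sliceRight φ z :=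
  apply_eq_of_tmul₃ ((sliceRight φ).lTensor P ∘ₗ (TensorProduct.assoc R P Q M).toLinearMap)
    (sliceRight φ) (fun x y m => by simp) z

/-- The reversal `u ⊗ (v ⊗ w) ↦ (w ⊗ v) ⊗ u` of the three legs, which turns identities for the
opposite of a coproduct into identities for the coproduct. -/
noncomputable def reverseLegs : M ⊗[R] (N ⊗[R] P) →ₗ[R] (P ⊗[R] N) ⊗[R] M :=
  (TensorProduct.comm R N P).toLinearMap.rTensor M ∘ₗ
    (TensorProduct.comm R M (N ⊗[R] P)).toLinearMap

theorem assoc_reverseLegs_assoc (z : M ⊗[R] N) (x : P) :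
    TensorProduct.assoc R P N M (reverseLegs (TensorProduct.assoc R M N P (z ⊗ₜ x))) =
      x ⊗ₜ TensorProduct.comm R M N z :=
  apply_eq_of_tmul ((TensorProduct.assoc R P N M).toLinearMap ∘ₗ reverseLegs ∘ₗ
    (TensorProduct.assoc R M N P).toLinearMap ∘ₗ (TensorProduct.mk R (M ⊗[R] N) P).flip x)
    (TensorProduct.mk R P (N ⊗[R] M) x ∘ₗ (TensorProduct.comm R M N).toLinearMap)
    (fun _ _ => rfl) z

theorem reverseLegs_lTensor_comm (f : M →ₗ[R] N ⊗[R] P) (z : M ⊗[R] Q) :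
    reverseLegs (f.lTensor Q (TensorProduct.comm R M Q z)) =
      ((TensorProduct.comm R N P).toLinearMap ∘ₗ f).rTensor Q z :=
  apply_eq_of_tmul (reverseLegs ∘ₗ f.lTensor Q ∘ₗ (TensorProduct.comm R M Q).toLinearMap)
    (((TensorProduct.comm R N P).toLinearMap ∘ₗ f).rTensor Q) (fun _ _ => rfl) z

end TensorProduct

section JointlyInjective

variable {ι R M N V : Type*} [CommSemiring R] [AddCommMonoid M] [Module R M]
  [AddCommMonoid N] [Module R N] [AddCommMonoid V] [Module R V] [Module.Free R V]

theorem eq_of_forall_rTensor_eq (f : ι → M →ₗ[R] N) (hf : ∀ x y, (∀ i, f i x = f i y) → x = y)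
    {z w : M ⊗[R] V} (h : ∀ i, (f i).rTensor V z = (f i).rTensor V w) : z = w := by
  classical
  let b := Module.Free.chooseBasis R V
  have coord_rTensor : ∀ i k (t : M ⊗[R] V),
      TensorProduct.equivFinsuppOfBasisRight b ((f i).rTensor V t) k =
        f i (TensorProduct.equivFinsuppOfBasisRight b t k) := fun i k =>
    apply_eq_of_tmul
      (Finsupp.lapply k ∘ₗ (TensorProduct.equivFinsuppOfBasisRight b).toLinearMap ∘ₗ
        (f i).rTensor V)
      (f i ∘ₗ Finsupp.lapply k ∘ₗ (TensorProduct.equivFinsuppOfBasisRight b).toLinearMap)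
      fun x y => by simp
  apply (TensorProduct.equivFinsuppOfBasisRight b).injective
  ext k
  exact hf _ _ fun i => by rw [← coord_rTensor, h, coord_rTensor]

theorem eq_of_forall_lTensor_eq (f : ι → M →ₗ[R] N) (hf : ∀ x y, (∀ i, f i x = f i y) → x = y)
    {z w : V ⊗[R] M} (h : ∀ i, (f i).lTensor V z = (f i).lTensor V w) : z = w :=
  (TensorProduct.comm R V M).injective <| eq_of_forall_rTensor_eq f hf fun i => by
    rw [← comm_lTensor, h, comm_lTensor]

theorem rTensor_eq_zero_of_flip {P : Type*} [AddCommMonoid P] [Module R P]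
    (f : P →ₗ[R] M →ₗ[R] N) {z : P ⊗[R] V} (h : ∀ m, (f.flip m).rTensor V z = 0) :
    f.rTensor V z = 0 := by
  refine eq_of_forall_rTensor_eq (fun m => (LinearMap.id : (M →ₗ[R] N) →ₗ[R] _).flip m)
    (fun _ _ => LinearMap.ext) fun m => ?_
  rw [← LinearMap.rTensor_comp_apply, map_zero, ← h m]
  rfl

theorem lTensor_eq_zero_of_flip {P : Type*} [AddCommMonoid P] [Module R P]
    (f : P →ₗ[R] M →ₗ[R] N) {z : V ⊗[R] P} (h : ∀ m, (f.flip m).lTensor V z = 0) :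
    f.lTensor V z = 0 := by
  refine eq_of_forall_lTensor_eq (fun m => (LinearMap.id : (M →ₗ[R] N) →ₗ[R] _).flip m)
    (fun _ _ => LinearMap.ext) fun m => ?_
  rw [← LinearMap.lTensor_comp_apply, map_zero, ← h m]
  rfl

theorem eq_of_forall_sliceRight_eq {R M P : Type*} [CommRing R] [AddCommGroup M] [Module R M]
    [Module.Projective R M] [AddCommMonoid P] [Module R P] [Module.Free R P]
    {z w : P ⊗[R] M} (h : ∀ ω : M →ₗ[R] R, sliceRight ω z = sliceRight ω w) : z = w :=
  eq_of_forall_lTensor_eq (fun ω : Module.Dual R M => ω)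
    (fun x y hxy => sub_eq_zero.1 <| (Module.forall_dual_apply_eq_zero_iff R _).1 fun ω => by
      rw [map_sub, hxy, sub_self])
    fun ω => (TensorProduct.rid R P).injective (h ω)

end JointlyInjective

section TensorMul

variable {R A B : Type*} [CommSemiring R] [NonUnitalNonAssocSemiring A] [Module R A]
  [IsScalarTower R A A] [SMulCommClass R A A] [NonUnitalNonAssocSemiring B] [Module R B]
  [IsScalarTower R B B] [SMulCommClass R B B]

theorem mul_tmul_eq_map (z : A ⊗[R] B) (x : A) (y : B) :
    z * (x ⊗ₜ y) = TensorProduct.map (mulRight R x) (mulRight R y) z :=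
  apply_eq_of_tmul (mulRight R (x ⊗ₜ y)) (TensorProduct.map (mulRight R x) (mulRight R y))
    (fun u v => by simp [Algebra.TensorProduct.tmul_mul_tmul]) z

theorem tmul_mul_eq_map (z : A ⊗[R] B) (x : A) (y : B) :
    (x ⊗ₜ y) * z = TensorProduct.map (mulLeft R x) (mulLeft R y) z :=
  apply_eq_of_tmul (mulLeft R (x ⊗ₜ y)) (TensorProduct.map (mulLeft R x) (mulLeft R y))
    (fun u v => by simp [Algebra.TensorProduct.tmul_mul_tmul]) z

end TensorMul

section TensorMulAssoc

variable {R A B : Type*} [CommSemiring R] [NonUnitalSemiring A] [Module R A]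
  [IsScalarTower R A A] [SMulCommClass R A A] [NonUnitalSemiring B] [Module R B]
  [IsScalarTower R B B] [SMulCommClass R B B]

theorem lTensor_mulRight_mul (b : B) (z w : A ⊗[R] B) :
    (mulRight R b).lTensor A z * w = z * (mulLeft R b).lTensor A w :=
  apply_eq_of_tmul (mulRight R w ∘ₗ (mulRight R b).lTensor A)
    (mulRight R ((mulLeft R b).lTensor A w))
    (fun x y => apply_eq_of_tmul (mulLeft R (x ⊗ₜ (y * b)))
      (mulLeft R (x ⊗ₜ y) ∘ₗ (mulLeft R b).lTensor A)
      (fun u v => by simp [Algebra.TensorProduct.tmul_mul_tmul, mul_assoc]) w) z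

theorem rTensor_mulRight_mul (a : A) (z w : A ⊗[R] B) :
    (mulRight R a).rTensor B z * w = z * (mulLeft R a).rTensor B w :=
  apply_eq_of_tmul (mulRight R w ∘ₗ (mulRight R a).rTensor B)
    (mulRight R ((mulLeft R a).rTensor B w))
    (fun x y => apply_eq_of_tmul (mulLeft R ((x * a) ⊗ₜ y))
      (mulLeft R (x ⊗ₜ y) ∘ₗ (mulLeft R a).rTensor B)
      (fun u v => by simp [Algebra.TensorProduct.tmul_mul_tmul, mul_assoc]) w) z

theorem rTensor_mulLeft_mul (a : A) (z w : A ⊗[R] B) :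
    (mulLeft R a).rTensor B (z * w) = (mulLeft R a).rTensor B z * w :=
  apply_eq_of_tmul ((mulLeft R a).rTensor B ∘ₗ mulRight R w)
    (mulRight R w ∘ₗ (mulLeft R a).rTensor B)
    (fun x y => apply_eq_of_tmul ((mulLeft R a).rTensor B ∘ₗ mulLeft R (x ⊗ₜ y))
      (mulLeft R ((a * x) ⊗ₜ y))
      (fun u v => by simp [Algebra.TensorProduct.tmul_mul_tmul, mul_assoc]) w) z

end TensorMulAssoc

namespace NonDegenerateProduct

section

variable {A : Type*} [NonUnitalRing A]

theorem eq_of_mul_right (hA : NonDegenerateProduct A) {a b : A} (h : ∀ c, a * c = b * c) :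
    a = b :=
  sub_eq_zero.1 <| hA.1 _ fun c => by rw [sub_mul, h, sub_self]

theorem eq_of_mul_left (hA : NonDegenerateProduct A) {a b : A} (h : ∀ c, c * a = c * b) :
    a = b :=
  sub_eq_zero.1 <| hA.2 _ fun c => by rw [mul_sub, h, sub_self]

end

section

variable {A V R : Type*} [CommSemiring R] [NonUnitalRing A] [Module R A] [AddCommMonoid V]
  [Module R V] [Module.Free R V]

theorem eq_of_rTensor_mulLeft [SMulCommClass R A A] (hA : NonDegenerateProduct A)
    {z w : A ⊗[R] V} (h : ∀ c, (mulLeft R c).rTensor V z = (mulLeft R c).rTensor V w) : z = w :=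
  eq_of_forall_rTensor_eq (fun c : A => mulLeft R c) (fun _ _ => hA.eq_of_mul_left) h

theorem eq_of_rTensor_mulRight [IsScalarTower R A A] (hA : NonDegenerateProduct A)
    {z w : A ⊗[R] V} (h : ∀ c, (mulRight R c).rTensor V z = (mulRight R c).rTensor V w) : z = w :=
  eq_of_forall_rTensor_eq (fun c : A => mulRight R c) (fun _ _ => hA.eq_of_mul_right) h

theorem eq_of_lTensor_mulLeft [SMulCommClass R A A] (hA : NonDegenerateProduct A)
    {z w : V ⊗[R] A} (h : ∀ c, (mulLeft R c).lTensor V z = (mulLeft R c).lTensor V w) : z = w :=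
  eq_of_forall_lTensor_eq (fun c : A => mulLeft R c) (fun _ _ => hA.eq_of_mul_left) h

theorem eq_of_lTensor_mulRight [IsScalarTower R A A] (hA : NonDegenerateProduct A)
    {z w : V ⊗[R] A} (h : ∀ c, (mulRight R c).lTensor V z = (mulRight R c).lTensor V w) : z = w :=
  eq_of_forall_lTensor_eq (fun c : A => mulRight R c) (fun _ _ => hA.eq_of_mul_right) h

theorem eq_of_map_mulRight_rTensor_mulRight {B : Type*} [NonUnitalRing B] [Module R B]
    [IsScalarTower R A A] [IsScalarTower R B B] [Module.Free R A] [Module.Free R B]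
    (hA : NonDegenerateProduct A) (hB : NonDegenerateProduct B) {z w : A ⊗[R] (B ⊗[R] V)}
    (h : ∀ a b, TensorProduct.map (mulRight R a) ((mulRight R b).rTensor V) z =
      TensorProduct.map (mulRight R a) ((mulRight R b).rTensor V) w) : z = w := by
  refine hA.eq_of_rTensor_mulRight fun a => ?_
  refine eq_of_forall_lTensor_eq (fun b : B => (mulRight R b).rTensor V)
    (fun _ _ => hB.eq_of_rTensor_mulRight) fun b => ?_
  rw [← map_eq_lTensor_rTensor, ← map_eq_lTensor_rTensor, h]

end

variable {A B R : Type*} [CommSemiring R] [NonUnitalRing A] [Module R A] [IsScalarTower R A A]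
  [SMulCommClass R A A] [NonUnitalRing B] [Module R B] [IsScalarTower R B B]
  [SMulCommClass R B B]

theorem tensor [Module.Free R A] [Module.Free R B] (hA : NonDegenerateProduct A)
    (hB : NonDegenerateProduct B) : NonDegenerateProduct (A ⊗[R] B) := by
  constructor
  · intro z hz
    refine hA.eq_of_rTensor_mulRight fun x => hB.eq_of_lTensor_mulRight fun y => ?_
    rw [map_zero, map_zero, ← hz (x ⊗ₜ y), mul_tmul_eq_map, map_eq_lTensor_rTensor]
  · intro z hz
    refine hA.eq_of_rTensor_mulLeft fun x => hB.eq_of_lTensor_mulLeft fun y => ?_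
    rw [map_zero, map_zero, ← hz (x ⊗ₜ y), tmul_mul_eq_map, map_eq_lTensor_rTensor]

end NonDegenerateProduct

namespace MultiplierAlgebra

section

variable {A : Type*} [NonUnitalRing A] [Module ℂ A] [IsScalarTower ℂ A A] [SMulCommClass ℂ A A]

theorem left_mul_apply (m : MultiplierAlgebra A) (a b : A) : left m (a * b) = left m a * b :=
  m.2.1 a b

theorem right_mul_apply (m : MultiplierAlgebra A) (a b : A) : right m (a * b) = a * right m b :=
  m.2.2.1 a b

theorem right_mul_eq_mul_left (m : MultiplierAlgebra A) (a b : A) : right m a * b = a * left m b :=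
  m.2.2.2 a b

theorem left_mul (m n : MultiplierAlgebra A) (a : A) : left (m * n) a = left m (left n a) :=
  rfl

theorem right_mul (m n : MultiplierAlgebra A) (a : A) : right (m * n) a = right n (right m a) :=
  rfl

theorem ext_left_right {m n : MultiplierAlgebra A} (hl : left m = left n)
    (hr : right m = right n) : m = n :=
  Subtype.ext (Prod.ext hl (MulOpposite.unop_injective hr))

theorem right_left_comm (hA : NonDegenerateProduct A) (m n : MultiplierAlgebra A) (a : A) :
    right n (left m a) = left m (right n a) :=
  hA.eq_of_mul_right fun b => by
    rw [right_mul_eq_mul_left, ← left_mul_apply, ← left_mul_apply, right_mul_eq_mul_left]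

theorem left_flip (m : MultiplierAlgebra (A ⊗[ℂ] A)) (z : A ⊗[ℂ] A) :
    left (flip m) z = TensorProduct.comm ℂ A A (left m ((TensorProduct.comm ℂ A A).symm z)) :=
  rfl

theorem right_flip (m : MultiplierAlgebra (A ⊗[ℂ] A)) (z : A ⊗[ℂ] A) :
    right (flip m) z = TensorProduct.comm ℂ A A (right m ((TensorProduct.comm ℂ A A).symm z)) :=
  rfl

theorem flip_flip (m : MultiplierAlgebra (A ⊗[ℂ] A)) : flip (flip m) = m :=
  ext_left_right (LinearMap.ext fun z => by simp [left_flip])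
    (LinearMap.ext fun z => by simp [right_flip])

theorem left_inLegs₁₂ (m : MultiplierAlgebra (A ⊗[ℂ] A)) (x : A) (z : A ⊗[ℂ] A) :
    left (inLegs₁₂ m) (x ⊗ₜ z) = TensorProduct.assoc ℂ A A A
      ((left m ∘ₗ TensorProduct.mk ℂ A A x).rTensor A z):= by
  induction z with
  | zero => simp only [TensorProduct.tmul_zero, map_zero]
  | add z w hz hw => simp only [TensorProduct.tmul_add, map_add, hz, hw]
  | tmul y z => rfl

theorem right_inLegs₁₂ (m : MultiplierAlgebra (A ⊗[ℂ] A)) (x : A) (z : A ⊗[ℂ] A) :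
    right (inLegs₁₂ m) (x ⊗ₜ z) = TensorProduct.assoc ℂ A A A
      ((right m ∘ₗ TensorProduct.mk ℂ A A x).rTensor A z):= by
  induction z with
  | zero => simp only [TensorProduct.tmul_zero, map_zero]
  | add z w hz hw => simp only [TensorProduct.tmul_add, map_add, hz, hw]
  | tmul y z => rfl

theorem left_inLegs₂₃ (m : MultiplierAlgebra (A ⊗[ℂ] A)) (z : A ⊗[ℂ] (A ⊗[ℂ] A)) :
    left (inLegs₂₃ m) z = (left m).lTensor A z :=
  rfl

theorem right_inLegs₂₃ (m : MultiplierAlgebra (A ⊗[ℂ] A)) (z : A ⊗[ℂ] (A ⊗[ℂ] A)) :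
    right (inLegs₂₃ m) z = (right m).lTensor A z :=
  rfl

end

variable {A B : Type*} [NonUnitalRing A] [Module ℂ A] [IsScalarTower ℂ A A] [SMulCommClass ℂ A A]
  [NonUnitalRing B] [Module ℂ B] [IsScalarTower ℂ B B] [SMulCommClass ℂ B B]

theorem left_lTensor_mulRight (hA : NonDegenerateProduct A) (hB : NonDegenerateProduct B)
    (m : MultiplierAlgebra (A ⊗[ℂ] B)) (z : A ⊗[ℂ] B) (b : B) :
    left m ((mulRight ℂ b).lTensor A z) = (mulRight ℂ b).lTensor A (left m z) :=
  (hA.tensor hB).eq_of_mul_right fun w => by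
    rw [← left_mul_apply, lTensor_mulRight_mul, left_mul_apply, lTensor_mulRight_mul]

theorem left_rTensor_mulRight (hA : NonDegenerateProduct A) (hB : NonDegenerateProduct B)
    (m : MultiplierAlgebra (A ⊗[ℂ] B)) (z : A ⊗[ℂ] B) (a : A) :
    left m ((mulRight ℂ a).rTensor B z) = (mulRight ℂ a).rTensor B (left m z) :=
  (hA.tensor hB).eq_of_mul_right fun w => by
    rw [← left_mul_apply, rTensor_mulRight_mul, left_mul_apply, rTensor_mulRight_mul]

theorem right_lTensor_mulLeft (hA : NonDegenerateProduct A) (hB : NonDegenerateProduct B)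
    (m : MultiplierAlgebra (A ⊗[ℂ] B)) (z : A ⊗[ℂ] B) (b : B) :
    right m ((mulLeft ℂ b).lTensor A z) = (mulLeft ℂ b).lTensor A (right m z) :=
  (hA.tensor hB).eq_of_mul_left fun w => by
    rw [← right_mul_apply, ← lTensor_mulRight_mul, right_mul_apply, ← lTensor_mulRight_mul]

theorem right_rTensor_mulLeft (hA : NonDegenerateProduct A) (hB : NonDegenerateProduct B)
    (m : MultiplierAlgebra (A ⊗[ℂ] B)) (z : A ⊗[ℂ] B) (a : A) :
    right m ((mulLeft ℂ a).rTensor B z) = (mulLeft ℂ a).rTensor B (right m z) :=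
  (hA.tensor hB).eq_of_mul_left fun w => by
    rw [← right_mul_apply, ← rTensor_mulRight_mul, right_mul_apply, ← rTensor_mulRight_mul]

end MultiplierAlgebra

namespace WeakMultiplierHopfAlgebra

open MultiplierAlgebra

variable {A : Type*} [NonUnitalRing A] [Module ℂ A] [IsScalarTower ℂ A A] [SMulCommClass ℂ A A]
  {V : Type*} [AddCommGroup V] [Module ℂ V] (H : WeakMultiplierHopfAlgebra A)

theorem ext_mul (H : WeakMultiplierHopfAlgebra A) {f g : A →ₗ[ℂ] V}
    (h : ∀ x y, f (x * y) = g (x * y)) : f = g := by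
  ext a
  obtain ⟨t, rfl⟩ := H.idempotent a
  exact apply_eq_of_tmul (f ∘ₗ LinearMap.mul' ℂ A) (g ∘ₗ LinearMap.mul' ℂ A) h t

theorem nondegenerate_tensor (H : WeakMultiplierHopfAlgebra A) :
    NonDegenerateProduct (A ⊗[ℂ] A) :=
  H.nondegenerate.tensor H.nondegenerate

theorem T₁_mul (a b : A) (z : A ⊗[ℂ] A) :
    H.T₁ (a ⊗ₜ b) * z = left (H.Δ a) ((mulLeft ℂ b).lTensor A z) :=
  congrArg (fun m => left m z) (H.T₁_spec a b)

theorem mul_T₂ (a b : A) (z : A ⊗[ℂ] A) :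
    z * H.T₂ (a ⊗ₜ b) = right (H.Δ b) ((mulRight ℂ a).rTensor A z) :=
  congrArg (fun m => right m z) (H.T₂_spec a b)

theorem T₁_tmul_mul (a b c : A) :
    H.T₁ (a ⊗ₜ (b * c)) = (mulRight ℂ c).lTensor A (H.T₁ (a ⊗ₜ b)) :=
  H.nondegenerate_tensor.eq_of_mul_right fun w => by
    rw [lTensor_mulRight_mul, T₁_mul, T₁_mul, ← LinearMap.lTensor_comp_apply,
      LinearMap.mulLeft_mul]

theorem T₂_mul_tmul (a b c : A) :
    H.T₂ ((c * a) ⊗ₜ b) = (mulLeft ℂ c).rTensor A (H.T₂ (a ⊗ₜ b)) :=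
  H.nondegenerate_tensor.eq_of_mul_left fun w => by
    rw [← rTensor_mulRight_mul, mul_T₂, mul_T₂, ← LinearMap.rTensor_comp_apply,
      LinearMap.mulRight_mul]

theorem left_Δ_tmul (a x y : A) :
    left (H.Δ a) (x ⊗ₜ y) = (mulRight ℂ x).rTensor A (H.T₁ (a ⊗ₜ y)) := by
  have : left (H.Δ a) ∘ₗ TensorProduct.mk ℂ A A x =
      (mulRight ℂ x).rTensor A ∘ₗ H.T₁ ∘ₗ TensorProduct.mk ℂ A A a := H.ext_mul fun b y => by
    simp only [LinearMap.comp_apply, TensorProduct.mk_apply]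
    rw [T₁_tmul_mul, ← map_eq_rTensor_lTensor, ← mul_tmul_eq_map, T₁_mul, LinearMap.lTensor_tmul,
      LinearMap.mulLeft_apply]
  exact LinearMap.congr_fun this y

theorem right_Δ_tmul (b x y : A) :
    right (H.Δ b) (x ⊗ₜ y) = (mulLeft ℂ y).lTensor A (H.T₂ (x ⊗ₜ b)) := by
  have : right (H.Δ b) ∘ₗ (TensorProduct.mk ℂ A A).flip y =
      (mulLeft ℂ y).lTensor A ∘ₗ H.T₂ ∘ₗ (TensorProduct.mk ℂ A A).flip b :=
    H.ext_mul fun x a => by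
      simp only [LinearMap.comp_apply, LinearMap.flip_apply, TensorProduct.mk_apply]
      rw [T₂_mul_tmul, ← map_eq_lTensor_rTensor, ← tmul_mul_eq_map, mul_T₂,
        LinearMap.rTensor_tmul, LinearMap.mulRight_apply]
  exact LinearMap.congr_fun this x

theorem T₂_mul (d a : A) (w : A ⊗[ℂ] A) :
    H.T₂ (d ⊗ₜ a) * w = (mulLeft ℂ d).rTensor A (left (H.Δ a) w) :=
  H.nondegenerate_tensor.eq_of_mul_left fun z => by
    rw [← mul_assoc, mul_T₂, right_mul_eq_mul_left, rTensor_mulRight_mul]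

theorem rTensor_mulLeft_T₁ (d a b : A) :
    (mulLeft ℂ d).rTensor A (H.T₁ (a ⊗ₜ b)) = (mulRight ℂ b).lTensor A (H.T₂ (d ⊗ₜ a)) :=
  H.nondegenerate_tensor.eq_of_mul_right fun w => by
    rw [lTensor_mulRight_mul, T₂_mul, ← T₁_mul, rTensor_mulLeft_mul]

theorem left_Δ_mul (a b : A) (z : A ⊗[ℂ] A) :
    left (H.Δ (a * b)) z = left (H.Δ a) (left (H.Δ b) z) := by
  rw [map_mul, left_mul]

theorem T₁_mul_tmul (a b c : A) : H.T₁ ((a * b) ⊗ₜ c) = left (H.Δ a) (H.T₁ (b ⊗ₜ c)) :=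
  H.nondegenerate.eq_of_rTensor_mulRight fun x => by
    rw [← left_Δ_tmul, left_Δ_mul, left_Δ_tmul,
      left_rTensor_mulRight H.nondegenerate H.nondegenerate]

theorem left_E_left_E (z : A ⊗[ℂ] A) : left H.E (left H.E z) = left H.E z := by
  rw [← left_mul, H.E_idempotent]

theorem right_E_right_E (z : A ⊗[ℂ] A) : right H.E (right H.E z) = right H.E z := by
  rw [← right_mul, H.E_idempotent]

theorem left_E_T₁ (z : A ⊗[ℂ] A) : left H.E (H.T₁ z) = H.T₁ z := by
  obtain ⟨w, hw⟩ : H.T₁ z ∈ LinearMap.range (left H.E) := H.range_T₁ ▸ ⟨z, rfl⟩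
  rw [← hw, left_E_left_E]

theorem right_E_T₂ (z : A ⊗[ℂ] A) : right H.E (H.T₂ z) = H.T₂ z := by
  obtain ⟨w, hw⟩ : H.T₂ z ∈ LinearMap.range (right H.E) := H.range_T₂ ▸ ⟨z, rfl⟩
  rw [← hw, right_E_right_E]

theorem left_E_left_Δ (a : A) (z : A ⊗[ℂ] A) :
    left H.E (left (H.Δ a) z) = left (H.Δ a) z :=
  apply_eq_of_tmul (left H.E ∘ₗ left (H.Δ a)) (left (H.Δ a)) (fun x y => by
    rw [LinearMap.comp_apply, left_Δ_tmul,
      left_rTensor_mulRight H.nondegenerate H.nondegenerate, left_E_T₁]) z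

theorem right_E_right_Δ (a : A) (z : A ⊗[ℂ] A) :
    right H.E (right (H.Δ a) z) = right (H.Δ a) z :=
  apply_eq_of_tmul (right H.E ∘ₗ right (H.Δ a)) (right (H.Δ a)) (fun x y => by
    rw [LinearMap.comp_apply, right_Δ_tmul,
      right_lTensor_mulLeft H.nondegenerate H.nondegenerate, right_E_T₂]) z

theorem left_Δ_left_E (a : A) (z : A ⊗[ℂ] A) :
    left (H.Δ a) (left H.E z) = left (H.Δ a) z :=
  H.nondegenerate_tensor.eq_of_mul_left fun w => by
    rw [← right_mul_eq_mul_left, ← right_mul_eq_mul_left, right_E_right_Δ, right_mul_eq_mul_left]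

/-- `(A ⊗ A)E` is spanned by the `(d ⊗ 1)Δ(a)`, so `E` is determined by the `Δ(a)`. -/
theorem left_E_eq_of_left_Δ_eq {z w : A ⊗[ℂ] A}
    (h : ∀ a, left (H.Δ a) z = left (H.Δ a) w) : left H.E z = left H.E w := by
  refine H.nondegenerate_tensor.eq_of_mul_left fun v => ?_
  rw [← right_mul_eq_mul_left, ← right_mul_eq_mul_left]
  obtain ⟨u, hu⟩ : right H.E v ∈ LinearMap.range H.T₂ := H.range_T₂ ▸ ⟨v, rfl⟩
  rw [← hu]
  exact apply_eq_of_tmul (mulRight ℂ z ∘ₗ H.T₂) (mulRight ℂ w ∘ₗ H.T₂)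
    (fun d a => by simp only [LinearMap.comp_apply, LinearMap.mulRight_apply, T₂_mul, h]) u

theorem sliceLeft_ε_T₁ (a b : A) : sliceLeft H.ε (H.T₁ (a ⊗ₜ b)) = a * b :=
  H.counit_left a b

theorem sliceRight_ε_T₂ (a b : A) : sliceRight H.ε (H.T₂ (a ⊗ₜ b)) = a * b :=
  H.counit_right a b

theorem eq_zero_of_rTensor_T₁_eq_zero (f : A →ₗ[ℂ] V)
    (h : ∀ a b, f.rTensor A (H.T₁ (a ⊗ₜ b)) = 0) : f = 0 := by
  refine LinearMap.ker_eq_top.1 (H.full_left (LinearMap.ker f) ?_)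
  rintro _ ⟨z, rfl⟩
  exact (Module.Flat.rTensor_exact A (LinearMap.exact_subtype_ker_map f) _).1
    (apply_eq_of_tmul (f.rTensor A ∘ₗ H.T₁) 0 h z)

theorem eq_zero_of_lTensor_T₂_eq_zero (f : A →ₗ[ℂ] V)
    (h : ∀ a b, f.lTensor A (H.T₂ (a ⊗ₜ b)) = 0) : f = 0 := by
  refine LinearMap.ker_eq_top.1 (H.full_right (LinearMap.ker f) ?_)
  rintro _ ⟨z, rfl⟩
  exact (Module.Flat.lTensor_exact A (LinearMap.exact_subtype_ker_map f) _).1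
    (apply_eq_of_tmul (f.lTensor A ∘ₗ H.T₂) 0 h z)

/-- The map `a ↦ Δ(a)(1 ⊗ b)`. -/
noncomputable def comulMul₂ (b : A) : A →ₗ[ℂ] A ⊗[ℂ] A :=
  H.T₁ ∘ₗ (TensorProduct.mk ℂ A A).flip b

/-- The map `a ↦ (c ⊗ 1)Δ(a)`. -/
noncomputable def mulComul₁ (c : A) : A →ₗ[ℂ] A ⊗[ℂ] A :=
  H.T₂ ∘ₗ TensorProduct.mk ℂ A A c

/-- The map `a ↦ Δ^cop(a)(x ⊗ 1)`. When `H` carries the opposite of a coproduct `Δ'`, this is the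
map `a ↦ Δ'(a)(x ⊗ 1)`. -/
noncomputable def copComulMul₁ (x : A) : A →ₗ[ℂ] A ⊗[ℂ] A :=
  (TensorProduct.comm ℂ A A).toLinearMap ∘ₗ H.comulMul₂ x

/-- The bilinear map `(w, a) ↦ Δ(a)w`, for `w` in `A ⊗ A`. -/
noncomputable def comulMul : A ⊗[ℂ] A →ₗ[ℂ] A →ₗ[ℂ] A ⊗[ℂ] A :=
  LinearMap.flip
    { toFun := fun a => left (H.Δ a)
      map_add' := fun a b => by rw [map_add]; rfl
      map_smul' := fun c a => by rw [map_smul]; rfl }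

theorem comulMul₂_apply (a b : A) : H.comulMul₂ b a = H.T₁ (a ⊗ₜ b) :=
  rfl

theorem mulComul₁_apply (a c : A) : H.mulComul₁ c a = H.T₂ (c ⊗ₜ a) :=
  rfl

theorem copComulMul₁_apply (a x : A) :
    H.copComulMul₁ x a = TensorProduct.comm ℂ A A (H.T₁ (a ⊗ₜ x)) :=
  rfl

theorem comulMul_apply (w : A ⊗[ℂ] A) (a : A) : H.comulMul w a = left (H.Δ a) w :=
  rfl

theorem comulMul_tmul (x y : A) :
    H.comulMul (x ⊗ₜ y) = (mulRight ℂ x).rTensor A ∘ₗ H.comulMul₂ y :=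
  LinearMap.ext fun a => H.left_Δ_tmul a x y

theorem eq_zero_of_forall_sliceRight (f : A →ₗ[ℂ] V)
    (h : ∀ (ω : A →ₗ[ℂ] ℂ) (a c : A), f (sliceRight ω (H.comulMul₂ c a)) = 0) : f = 0 :=
  H.eq_zero_of_rTensor_T₁_eq_zero f fun a b => eq_of_forall_sliceRight_eq fun ω => by
    rw [sliceRight_rTensor, map_zero]
    exact h ω a b

/-- A map `X : A → V ⊗ A` is colinear if `(X ⊗ ι)(Δ(a)(1 ⊗ b)) = (ι ⊗ Δ)(X(a))(1 ⊗ 1 ⊗ b)`: it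
commutes with the coaction of `A` on itself by the coproduct. -/
def IsColinear (X : A →ₗ[ℂ] V ⊗[ℂ] A) : Prop :=
  ∀ a b : A, TensorProduct.assoc ℂ V A A (X.rTensor A (H.comulMul₂ b a)) =
    (H.comulMul₂ b).lTensor V (X a)

theorem isColinear_mulComul₁ (c : A) : H.IsColinear (H.mulComul₁ c) := by
  intro a b
  have h := H.coassoc a b c
  have h_T₂ : ∀ z : A ⊗[ℂ] A, H.T₂.rTensor A ((TensorProduct.assoc ℂ A A A).symm (c ⊗ₜ[ℂ] z)) =
      (H.mulComul₁ c).rTensor A z :=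
    apply_eq_of_tmul (H.T₂.rTensor A ∘ₗ
      (TensorProduct.assoc ℂ A A A).symm.toLinearMap ∘ₗ TensorProduct.mk ℂ A (A ⊗[ℂ] A) c)
      ((H.mulComul₁ c).rTensor A) fun _ _ => rfl
  have h_T₁ : ∀ z : A ⊗[ℂ] A, H.T₁.lTensor A (TensorProduct.assoc ℂ A A A (z ⊗ₜ[ℂ] b)) =
      (H.comulMul₂ b).lTensor A z :=
    apply_eq_of_tmul (H.T₁.lTensor A ∘ₗ
      (TensorProduct.assoc ℂ A A A).toLinearMap ∘ₗ (TensorProduct.mk ℂ (A ⊗[ℂ] A) A).flip b)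
      ((H.comulMul₂ b).lTensor A) fun _ _ => rfl
  rwa [h_T₂, h_T₁] at h

variable {H} in
theorem IsColinear.apply_sliceRight {X : A →ₗ[ℂ] V ⊗[ℂ] A} (hX : H.IsColinear X)
    (φ : A →ₗ[ℂ] ℂ) (a b : A) :
    X (sliceRight φ (H.comulMul₂ b a)) = (sliceRight φ ∘ₗ H.comulMul₂ b).lTensor V (X a) := by
  rw [← sliceRight_rTensor, ← lTensor_sliceRight_assoc, hX, LinearMap.lTensor_comp_apply]

/-- The map `b ⊗ c ↦ (ι ⊗ ω)(Δ(a)(1 ⊗ c)) ⊗ b`. By fullness of the coproduct, the ranges of these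
maps span `A ⊗ A`. -/
noncomputable def insertSlice (ω : A →ₗ[ℂ] ℂ) (a : A) : A ⊗[ℂ] A →ₗ[ℂ] A ⊗[ℂ] A :=
  (TensorProduct.comm ℂ A A).toLinearMap ∘ₗ
    (sliceRight ω ∘ₗ H.T₁ ∘ₗ TensorProduct.mk ℂ A A a).lTensor A

theorem insertSlice_tmul (ω : A →ₗ[ℂ] ℂ) (a b c : A) :
    H.insertSlice ω a (b ⊗ₜ c) = sliceRight ω (H.comulMul₂ c a) ⊗ₜ b :=
  rfl

theorem ext_insertSlice {f g : A ⊗[ℂ] A →ₗ[ℂ] V}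
    (h : ∀ (ω : A →ₗ[ℂ] ℂ) (a : A) (z : A ⊗[ℂ] A),
      f (H.insertSlice ω a z) = g (H.insertSlice ω a z)) : f = g := by
  refine TensorProduct.ext' fun x b => ?_
  have h_zero := H.eq_zero_of_forall_sliceRight ((f - g) ∘ₗ (TensorProduct.mk ℂ A A).flip b)
    fun ω a c => sub_eq_zero.2 (h ω a (b ⊗ₜ c))
  exact sub_eq_zero.1 (LinearMap.congr_fun h_zero x)

/-- `(ι ⊗ ι ⊗ ω)(Δ₁₃(a)(1 ⊗ b ⊗ c)) = (ι ⊗ ω)(Δ(a)(1 ⊗ c)) ⊗ b`. -/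
theorem lTensor_sliceRight_leftComm_T₁ (ω : A →ₗ[ℂ] ℂ) (a : A) (z : A ⊗[ℂ] A) :
    (sliceRight ω).lTensor A (TensorProduct.leftComm ℂ A A A (H.T₁.lTensor A
      (TensorProduct.leftComm ℂ A A A (a ⊗ₜ[ℂ] z)))) = H.insertSlice ω a z := by
  have h_leftComm : ∀ (b : A) (w : A ⊗[ℂ] A), (sliceRight ω).lTensor A
      (TensorProduct.leftComm ℂ A A A (b ⊗ₜ[ℂ] w)) = sliceRight ω w ⊗ₜ b := fun b =>
    apply_eq_of_tmul ((sliceRight ω).lTensor A ∘ₗ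
      (TensorProduct.leftComm ℂ A A A).toLinearMap ∘ₗ TensorProduct.mk ℂ A (A ⊗[ℂ] A) b)
      ((TensorProduct.mk ℂ A A).flip b ∘ₗ sliceRight ω)
      fun x y => by simp [TensorProduct.smul_tmul']
  exact apply_eq_of_tmul ((sliceRight ω).lTensor A ∘ₗ
    (TensorProduct.leftComm ℂ A A A).toLinearMap ∘ₗ H.T₁.lTensor A ∘ₗ
    (TensorProduct.leftComm ℂ A A A).toLinearMap ∘ₗ TensorProduct.mk ℂ A (A ⊗[ℂ] A) a)
    (H.insertSlice ω a) (fun b c => h_leftComm b (H.T₁ (a ⊗ₜ c))) z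

/-- The projection `G₁` of Van Daele and Wang, which has the kernel of `T₁`. -/
noncomputable def kerProj : A ⊗[ℂ] A →ₗ[ℂ] A ⊗[ℂ] A :=
  H.ker_T₁.choose

theorem kerProj_insertSlice (ω : A →ₗ[ℂ] ℂ) (a : A) (z : A ⊗[ℂ] A) :
    H.kerProj (H.insertSlice ω a z) = H.insertSlice ω a (left H.E z) :=
  apply_eq_of_tmul (H.kerProj ∘ₗ H.insertSlice ω a) (H.insertSlice ω a ∘ₗ left H.E)
    (fun b c => by
      have h := congrArg ((sliceRight ω).lTensor A) (H.ker_T₁.choose_spec.1 a b c)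
      simp only [LinearMap.comp_apply, LinearEquiv.coe_coe] at h
      rw [lTensor_sliceRight_leftComm_T₁, lTensor_sliceRight_assoc, sliceRight_rTensor,
        ← lTensor_sliceRight_assoc, LinearEquiv.apply_symm_apply,
        lTensor_sliceRight_leftComm_T₁] at h
      exact h) z

theorem kerProj_kerProj (z : A ⊗[ℂ] A) : H.kerProj (H.kerProj z) = H.kerProj z := by
  have h_comp : H.kerProj ∘ₗ H.kerProj = H.kerProj := H.ext_insertSlice fun ω a z => by
    rw [LinearMap.comp_apply, kerProj_insertSlice, kerProj_insertSlice, left_E_left_E]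
  exact LinearMap.congr_fun h_comp z

theorem ker_T₁_eq_range : LinearMap.ker H.T₁ = LinearMap.range (LinearMap.id - H.kerProj) :=
  H.ker_T₁.choose_spec.2

theorem kerProj_eq_zero {z : A ⊗[ℂ] A} (hz : H.T₁ z = 0) : H.kerProj z = 0 := by
  obtain ⟨w, rfl⟩ : z ∈ LinearMap.range (LinearMap.id - H.kerProj) := H.ker_T₁_eq_range ▸ hz
  rw [LinearMap.sub_apply, LinearMap.id_apply, map_sub, kerProj_kerProj, sub_self]

theorem T₁_kerProj (z : A ⊗[ℂ] A) : H.T₁ (H.kerProj z) = H.T₁ z := by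
  have : z - H.kerProj z ∈ LinearMap.ker H.T₁ := H.ker_T₁_eq_range ▸ ⟨z, rfl⟩
  rw [LinearMap.mem_ker, map_sub, sub_eq_zero] at this
  exact this.symm

theorem left_idTensor (p : A ⊗[ℂ] A) (u : A) (z : A ⊗[ℂ] A) :
    left (idTensor H.Δ p) (u ⊗ₜ z) = TensorProduct.map (mulRight ℂ u) (H.comulMul z) p := by
  induction p with
  | zero => rw [map_zero, map_zero]; rfl
  | add x y hx hy => rw [map_add, map_add, ← hx, ← hy]; rfl
  | tmul x w => rfl

theorem right_idTensor_tmul (x w u : A) (z : A ⊗[ℂ] A) :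
    right (idTensor H.Δ (x ⊗ₜ w)) (u ⊗ₜ[ℂ] z) = (u * x) ⊗ₜ right (H.Δ w) z :=
  rfl

theorem right_idTensor (p : A ⊗[ℂ] A) (u s t : A) :
    right (idTensor H.Δ p) (u ⊗ₜ[ℂ] (s ⊗ₜ[ℂ] t)) =
      TensorProduct.map (mulLeft ℂ u) ((mulLeft ℂ t).lTensor A ∘ₗ H.mulComul₁ s) p := by
  induction p with
  | zero => rw [map_zero, map_zero]; rfl
  | add x y hx hy => rw [map_add, map_add, ← hx, ← hy]; rfl
  | tmul x w => rw [right_idTensor_tmul, right_Δ_tmul]; rfl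

theorem isColinear_left_E (x : A) : H.IsColinear (left H.E ∘ₗ TensorProduct.mk ℂ A A x) := by
  intro w t
  refine H.nondegenerate.eq_of_map_mulRight_rTensor_mulRight H.nondegenerate fun u s => ?_
  have h := congrArg (fun m => left m (u ⊗ₜ[ℂ] (s ⊗ₜ[ℂ] t))) (H.idTensor_E.2.2 (x ⊗ₜ w)).1
  simp only [left_mul, left_idTensor, TensorProduct.map_tmul, left_inLegs₂₃,
    LinearMap.mulRight_apply, LinearMap.lTensor_tmul, comulMul_apply, left_E_left_Δ] at h
  rw [left_inLegs₁₂, left_Δ_tmul, comulMul_tmul] at h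
  have h_mul : TensorProduct.map (mulRight ℂ u) (mulRight ℂ s) ∘ₗ left H.E ∘ₗ
      TensorProduct.mk ℂ A A x = (left H.E ∘ₗ TensorProduct.mk ℂ A A (x * u)) ∘ₗ mulRight ℂ s := by
    ext y
    simp only [LinearMap.comp_apply, TensorProduct.mk_apply]
    rw [← mul_tmul_eq_map, ← left_mul_apply, mul_tmul_eq_map]
    rfl
  rw [map_rTensor_assoc, ← LinearMap.rTensor_comp_apply, h_mul, LinearMap.rTensor_comp_apply,
    comulMul₂_apply, h, LinearMap.comp_apply, TensorProduct.mk_apply, ← LinearMap.map_comp_lTensor,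
    LinearMap.comp_apply]

theorem assoc_rTensor_right_E_mulComul₁ (x s w : A) : TensorProduct.assoc ℂ A A A
    ((right H.E ∘ₗ TensorProduct.mk ℂ A A x).rTensor A (H.mulComul₁ s w)) =
      (H.mulComul₁ s).lTensor A (right H.E (x ⊗ₜ w)) := by
  have hA := H.nondegenerate
  refine hA.eq_of_rTensor_mulLeft fun u => ?_
  refine eq_of_forall_lTensor_eq (fun t : A => (mulLeft ℂ t).lTensor A)
    (fun _ _ => hA.eq_of_lTensor_mulLeft) fun t => ?_
  have h := congrArg (fun m => right m (u ⊗ₜ[ℂ] (s ⊗ₜ[ℂ] t))) (H.idTensor_E.2.2 (x ⊗ₜ w)).2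
  simp only [right_mul, H.E_comm, right_idTensor_tmul, right_inLegs₂₃, LinearMap.lTensor_tmul,
    right_E_right_Δ] at h
  rw [right_inLegs₁₂, right_Δ_tmul, right_idTensor] at h
  have h_mul : (mulLeft ℂ u).rTensor A ∘ₗ right H.E ∘ₗ TensorProduct.mk ℂ A A x =
      right H.E ∘ₗ TensorProduct.mk ℂ A A (u * x) :=
    LinearMap.ext fun y => (right_rTensor_mulLeft hA hA H.E (x ⊗ₜ y) u).symm
  rw [rTensor_assoc, ← LinearMap.rTensor_comp_apply, h_mul, lTensor_lTensor_assoc,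
    ← rTensor_lTensor_comm, mulComul₁_apply, h, map_eq_rTensor_lTensor,
    LinearMap.lTensor_comp_apply, rTensor_lTensor_comm]

theorem isColinear_right_E (x : A) : H.IsColinear (right H.E ∘ₗ TensorProduct.mk ℂ A A x) := by
  intro w t
  have hA := H.nondegenerate
  refine eq_of_forall_lTensor_eq (fun s : A => (mulLeft ℂ s).rTensor A)
    (fun _ _ => hA.eq_of_rTensor_mulLeft) fun s => ?_
  have h_mul : (mulLeft ℂ s).lTensor A ∘ₗ right H.E ∘ₗ TensorProduct.mk ℂ A A x =
      (right H.E ∘ₗ TensorProduct.mk ℂ A A x) ∘ₗ mulLeft ℂ s :=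
    LinearMap.ext fun y => (right_lTensor_mulLeft hA hA H.E (x ⊗ₜ y) s).symm
  have h_comul : (mulLeft ℂ s).rTensor A ∘ₗ H.comulMul₂ t =
      (mulRight ℂ t).lTensor A ∘ₗ H.mulComul₁ s :=
    LinearMap.ext fun a => H.rTensor_mulLeft_T₁ s a t
  rw [lTensor_rTensor_assoc, ← LinearMap.rTensor_comp_apply, h_mul,
    LinearMap.rTensor_comp_apply, comulMul₂_apply, rTensor_mulLeft_T₁, rTensor_lTensor_comm,
    ← lTensor_lTensor_assoc, ← mulComul₁_apply, assoc_rTensor_right_E_mulComul₁,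
    ← LinearMap.lTensor_comp_apply, ← LinearMap.lTensor_comp_apply, h_comul]
  rfl

/-- A map `X : A → V ⊗ A` commutes with `E` if `(X ⊗ ι)(E z) = (1 ⊗ E)(X ⊗ ι)(z)`. -/
def CommutesWithE (X : A →ₗ[ℂ] V ⊗[ℂ] A) : Prop :=
  ∀ z : A ⊗[ℂ] A, TensorProduct.assoc ℂ V A A (X.rTensor A (left H.E z)) =
    (left H.E).lTensor V (TensorProduct.assoc ℂ V A A (X.rTensor A z))

theorem commutesWithE_right_E (x : A) :
    H.CommutesWithE (right H.E ∘ₗ TensorProduct.mk ℂ A A x) := by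
  intro z
  rw [← right_inLegs₁₂, ← right_inLegs₁₂, ← left_inLegs₂₃,
    ← right_left_comm (H.nondegenerate.tensor H.nondegenerate_tensor)]
  rfl

end WeakMultiplierHopfAlgebra

namespace WeakMultiplierHopfAlgebra

open MultiplierAlgebra

variable {A : Type*} [NonUnitalRing A] [Module ℂ A] [IsScalarTower ℂ A A] [SMulCommClass ℂ A A]
  {H H' : WeakMultiplierHopfAlgebra A}

/-- `H'` is a weak multiplier Hopf algebra with the opposite coproduct `Δ^cop` of `H`. -/
def IsCoopposite (H H' : WeakMultiplierHopfAlgebra A) : Prop :=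
  ∀ a, H'.Δ a = flip (H.Δ a)

namespace IsCoopposite

theorem symm (h : H.IsCoopposite H') : H'.IsCoopposite H := fun a => by
  rw [h, MultiplierAlgebra.flip_flip]

theorem left_Δ_tmul (h : H.IsCoopposite H') (a x y : A) :
    left (H.Δ a) (x ⊗ₜ y) = (mulRight ℂ y).lTensor A (H'.copComulMul₁ x a) := by
  rw [h.symm, left_flip, TensorProduct.comm_symm_tmul, H'.left_Δ_tmul, comm_rTensor,
    copComulMul₁_apply]

theorem rTensor_mulLeft_copComulMul₁ (h : H.IsCoopposite H') (d x a : A) :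
    (mulLeft ℂ d).rTensor A (H'.copComulMul₁ x a) =
      (mulRight ℂ x).rTensor A (H.mulComul₁ d a) := by
  refine H.nondegenerate.eq_of_lTensor_mulRight fun y => ?_
  rw [← rTensor_lTensor_comm, ← h.left_Δ_tmul, ← T₂_mul, mul_tmul_eq_map, map_eq_lTensor_rTensor,
    mulComul₁_apply]

theorem copComulMul₁_mul (h : H.IsCoopposite H') (x a b : A) :
    H'.copComulMul₁ x (a * b) = left (H.Δ a) (H'.copComulMul₁ x b) := by
  refine H.nondegenerate.eq_of_lTensor_mulRight fun y => ?_
  rw [← h.left_Δ_tmul, left_Δ_mul, h.left_Δ_tmul,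
    left_lTensor_mulRight H.nondegenerate H.nondegenerate]

theorem left_E_copComulMul₁ (h : H.IsCoopposite H') (x a : A) :
    left H.E (H'.copComulMul₁ x a) = H'.copComulMul₁ x a := by
  refine H.nondegenerate.eq_of_lTensor_mulRight fun y => ?_
  rw [← left_lTensor_mulRight H.nondegenerate H.nondegenerate, ← h.left_Δ_tmul, left_E_left_Δ]

theorem sliceRight_ε_copComulMul₁ (h : H.IsCoopposite H') (x a : A) :
    sliceRight H.ε (H'.copComulMul₁ x a) = a * x := by
  refine H.nondegenerate.eq_of_mul_left fun c => ?_
  rw [← LinearMap.mulLeft_apply (R := ℂ), ← sliceRight_rTensor, h.rTensor_mulLeft_copComulMul₁,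
    sliceRight_rTensor, mulComul₁_apply, sliceRight_ε_T₂, LinearMap.mulRight_apply, mul_assoc]

theorem left_flip_E_left_E (h : H.IsCoopposite H') (z : A ⊗[ℂ] A) :
    left (flip H.E) (left H'.E z) = left H'.E z := by
  obtain ⟨w, hw⟩ : left H'.E z ∈ LinearMap.range H'.T₁ := H'.range_T₁ ▸ ⟨z, rfl⟩
  rw [← hw]
  refine apply_eq_of_tmul (left (flip H.E) ∘ₗ H'.T₁) H'.T₁ (fun a x => ?_) w
  rw [LinearMap.comp_apply, left_flip, ← LinearEquiv.eq_symm_apply]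
  exact h.left_E_copComulMul₁ x a

theorem right_E_right_flip_E (h : H.IsCoopposite H') (z : A ⊗[ℂ] A) :
    right H'.E (right (flip H.E) z) = right (flip H.E) z := by
  have hA := H.nondegenerate
  rw [right_flip]
  obtain ⟨w, hw⟩ : right H.E ((TensorProduct.comm ℂ A A).symm z) ∈ LinearMap.range H.T₂ :=
    H.range_T₂ ▸ ⟨_, rfl⟩
  rw [← hw]
  refine apply_eq_of_tmul (right H'.E ∘ₗ (TensorProduct.comm ℂ A A).toLinearMap ∘ₗ H.T₂)
    ((TensorProduct.comm ℂ A A).toLinearMap ∘ₗ H.T₂)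
    (fun d a => hA.eq_of_rTensor_mulLeft fun y => ?_) w
  have h_flip : TensorProduct.comm ℂ A A (right (H.Δ a) (d ⊗ₜ y)) = right (H'.Δ a) (y ⊗ₜ d) := by
    rw [h, right_flip, TensorProduct.comm_symm_tmul]
  simp only [LinearMap.comp_apply, LinearEquiv.coe_coe]
  rw [← right_rTensor_mulLeft hA hA, ← comm_lTensor, ← right_Δ_tmul, h_flip, right_E_right_Δ]

theorem E_eq (h : H.IsCoopposite H') : H'.E = flip H.E := by
  have hl : left H'.E = left (flip H.E) := LinearMap.ext fun z =>
    H.nondegenerate_tensor.eq_of_mul_left fun w => by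
      rw [← right_mul_eq_mul_left (flip H.E), ← h.right_E_right_flip_E, right_mul_eq_mul_left,
        right_mul_eq_mul_left, h.left_flip_E_left_E]
  exact ext_left_right hl (LinearMap.ext fun z => H.nondegenerate_tensor.eq_of_mul_right fun w => by
    rw [right_mul_eq_mul_left, right_mul_eq_mul_left, hl])

theorem left_E_tmul (h : H.IsCoopposite H') (x y : A) :
    left H'.E (x ⊗ₜ y) = TensorProduct.comm ℂ A A (left H.E (y ⊗ₜ x)) := by
  rw [h.E_eq, left_flip, TensorProduct.comm_symm_tmul]

theorem ε_eq (h : H.IsCoopposite H') : H'.ε = H.ε := by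
  refine sub_eq_zero.1 (H'.eq_zero_of_rTensor_T₁_eq_zero _ fun a b => ?_)
  apply (TensorProduct.lid ℂ A).injective
  have h_slice : sliceLeft H'.ε (H'.T₁ (a ⊗ₜ b)) = sliceLeft H.ε (H'.T₁ (a ⊗ₜ b)) := by
    rw [sliceLeft_ε_T₁, ← h.sliceRight_ε_copComulMul₁, copComulMul₁_apply, sliceRight_comm]
  rw [LinearMap.rTensor_sub, LinearMap.sub_apply, map_sub, map_zero, sub_eq_zero]
  exact h_slice

theorem isColinear_copComulMul₁ (h : H.IsCoopposite H') (x : A) :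
    H.IsColinear (H'.copComulMul₁ x) := by
  intro a b
  refine H.nondegenerate.eq_of_rTensor_mulLeft fun d => ?_
  have h_comp : (mulLeft ℂ d).rTensor A ∘ₗ H'.copComulMul₁ x =
      (mulRight ℂ x).rTensor A ∘ₗ H.mulComul₁ d :=
    LinearMap.ext (h.rTensor_mulLeft_copComulMul₁ d x)
  rw [rTensor_assoc, ← LinearMap.rTensor_comp_apply, h_comp, LinearMap.rTensor_comp_apply,
    ← rTensor_assoc, isColinear_mulComul₁, rTensor_lTensor_comm, rTensor_lTensor_comm,
    h.rTensor_mulLeft_copComulMul₁]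

end IsCoopposite

/-- `(d ⊗ 1)Δ(∑ p₍₁₎u ε(p₍₂₎v)) = ∑ dp₍₁₎ ⊗ p₍₂₎u ε(p₍₃₎v)`, extended linearly to
`w = ∑ u ⊗ v`. -/
theorem rTensor_mulLeft_T₁_insertSlice (H : WeakMultiplierHopfAlgebra A) (φ : A →ₗ[ℂ] ℂ)
    (d p : A) (w : A ⊗[ℂ] A) :
    (mulLeft ℂ d).rTensor A (H.T₁ (H.insertSlice φ p w)) =
      (sliceRight φ ∘ₗ H.comulMul w).lTensor A (H.mulComul₁ d p) := by
  induction w with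
  | zero => simp only [map_zero, LinearMap.comp_zero, LinearMap.lTensor_zero, LinearMap.zero_apply]
  | add w₁ w₂ h₁ h₂ =>
    simp only [map_add, LinearMap.comp_add, LinearMap.lTensor_add, LinearMap.add_apply, h₁, h₂]
  | tmul u v =>
    have h_slice : mulRight ℂ u ∘ₗ sliceRight φ ∘ₗ H.comulMul₂ v =
        sliceRight φ ∘ₗ H.comulMul (u ⊗ₜ v) := LinearMap.ext fun a => by
      simp only [LinearMap.comp_apply, comulMul_tmul, sliceRight_rTensor]
    rw [insertSlice_tmul, rTensor_mulLeft_T₁, ← mulComul₁_apply,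
      (H.isColinear_mulComul₁ d).apply_sliceRight, ← LinearMap.lTensor_comp_apply, h_slice]

theorem IsCoopposite.T₁_insertSlice (h : H.IsCoopposite H') (p q x : A) :
    H.T₁ (H.insertSlice H.ε p (H'.copComulMul₁ x q)) = H.T₁ (p ⊗ₜ (q * x)) := by
  refine H.nondegenerate.eq_of_rTensor_mulLeft fun d => ?_
  have h_slice : sliceRight H.ε ∘ₗ H.comulMul (H'.copComulMul₁ x q) = mulRight ℂ (q * x) :=
    LinearMap.ext fun a => by
      rw [LinearMap.comp_apply, comulMul_apply, ← h.copComulMul₁_mul, h.sliceRight_ε_copComulMul₁,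
        mul_assoc, LinearMap.mulRight_apply]
  rw [rTensor_mulLeft_T₁_insertSlice, h_slice, rTensor_mulLeft_T₁, mulComul₁_apply]

namespace IsCoopposite

theorem assoc_reverseLegs_rTensor_left_E (h : H.IsCoopposite H') (x : A) (d : A ⊗[ℂ] A) :
    TensorProduct.assoc ℂ A A A (reverseLegs (TensorProduct.assoc ℂ A A A
      ((left H'.E ∘ₗ TensorProduct.mk ℂ A A x).rTensor A d))) =
    (left H.E).lTensor A (TensorProduct.assoc ℂ A A A (TensorProduct.comm ℂ A A d ⊗ₜ x)) :=
  apply_eq_of_tmul ((TensorProduct.assoc ℂ A A A).toLinearMap ∘ₗ reverseLegs ∘ₗ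
    (TensorProduct.assoc ℂ A A A).toLinearMap ∘ₗ
    (left H'.E ∘ₗ TensorProduct.mk ℂ A A x).rTensor A)
    ((left H.E).lTensor A ∘ₗ (TensorProduct.assoc ℂ A A A).toLinearMap ∘ₗ
      (TensorProduct.mk ℂ (A ⊗[ℂ] A) A).flip x ∘ₗ (TensorProduct.comm ℂ A A).toLinearMap)
    (fun p q => by
      simp only [LinearMap.comp_apply, LinearEquiv.coe_coe, LinearMap.rTensor_tmul,
        TensorProduct.mk_apply, LinearMap.flip_apply, TensorProduct.comm_tmul,
        TensorProduct.assoc_tmul, LinearMap.lTensor_tmul, assoc_reverseLegs_assoc,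
        h.symm.left_E_tmul]) d

theorem commutesWithE_copComulMul₁ (h : H.IsCoopposite H') (y : A) :
    H.CommutesWithE (H'.copComulMul₁ y) :=
  apply_eq_of_tmul ((TensorProduct.assoc ℂ A A A).toLinearMap ∘ₗ
    (H'.copComulMul₁ y).rTensor A ∘ₗ left H.E) ((left H.E).lTensor A ∘ₗ
    (TensorProduct.assoc ℂ A A A).toLinearMap ∘ₗ (H'.copComulMul₁ y).rTensor A) fun w x => by
  have h_rev := congrArg (fun t => TensorProduct.assoc ℂ A A A (reverseLegs t))
    (H'.isColinear_left_E x w y)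
  simp only [h.assoc_reverseLegs_rTensor_left_E, LinearMap.comp_apply, TensorProduct.mk_apply,
    h.left_E_tmul, reverseLegs_lTensor_comm] at h_rev
  exact h_rev.symm

theorem commutesWithE_mulComul₁ (h : H.IsCoopposite H') (c : A) :
    H.CommutesWithE (H.mulComul₁ c) := by
  intro z
  refine H.nondegenerate.eq_of_rTensor_mulRight fun y => ?_
  have h_comp : (mulRight ℂ y).rTensor A ∘ₗ H.mulComul₁ c =
      (mulLeft ℂ c).rTensor A ∘ₗ H'.copComulMul₁ y :=
    LinearMap.ext fun a => (h.rTensor_mulLeft_copComulMul₁ c y a).symm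
  rw [rTensor_assoc, ← LinearMap.rTensor_comp_apply, h_comp, LinearMap.rTensor_comp_apply,
    ← rTensor_assoc, h.commutesWithE_copComulMul₁, rTensor_lTensor_comm, rTensor_lTensor_comm,
    rTensor_assoc, rTensor_assoc, ← LinearMap.rTensor_comp_apply,
    ← LinearMap.rTensor_comp_apply, h_comp]

end IsCoopposite

section

variable (H)

theorem lTensor_mulRight_insertSlice (ω : A →ₗ[ℂ] ℂ) (a x : A) (z : A ⊗[ℂ] A) :
    (mulRight ℂ x).lTensor A (H.insertSlice ω a z) =
      H.insertSlice ω a ((mulRight ℂ x).rTensor A z) :=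
  apply_eq_of_tmul ((mulRight ℂ x).lTensor A ∘ₗ H.insertSlice ω a)
    (H.insertSlice ω a ∘ₗ (mulRight ℂ x).rTensor A) (fun _ _ => rfl) z

theorem sliceLeft_ε_insertSlice (ω : A →ₗ[ℂ] ℂ) (a : A) (z : A ⊗[ℂ] A) :
    sliceLeft H.ε (H.insertSlice ω a z) = sliceRight (ω ∘ₗ mulLeft ℂ a) z :=
  apply_eq_of_tmul (sliceLeft H.ε ∘ₗ H.insertSlice ω a) (sliceRight (ω ∘ₗ mulLeft ℂ a))
    (fun b c => by
      rw [LinearMap.comp_apply, insertSlice_tmul, sliceLeft_tmul, sliceRight_tmul,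
        ← apply_sliceLeft, comulMul₂_apply, sliceLeft_ε_T₁, LinearMap.comp_apply,
        LinearMap.mulLeft_apply]) z

theorem kerProj_lTensor_mulRight (x : A) (z : A ⊗[ℂ] A) :
    H.kerProj ((mulRight ℂ x).lTensor A z) = (mulRight ℂ x).lTensor A (H.kerProj z) := by
  have h_comp : H.kerProj ∘ₗ (mulRight ℂ x).lTensor A = (mulRight ℂ x).lTensor A ∘ₗ H.kerProj :=
    H.ext_insertSlice fun ω a w => by
      rw [LinearMap.comp_apply, LinearMap.comp_apply, lTensor_mulRight_insertSlice,
        kerProj_insertSlice, kerProj_insertSlice, lTensor_mulRight_insertSlice,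
        left_rTensor_mulRight H.nondegenerate H.nondegenerate]
  exact LinearMap.congr_fun h_comp z

/-- The source map `ε_s`, as the bilinear map `(p, q) ↦ ε_s(p) q = (ε ⊗ ι)(G₁(p ⊗ q))`. -/
noncomputable def sourceMap : A →ₗ[ℂ] A →ₗ[ℂ] A :=
  TensorProduct.curry (sliceLeft H.ε ∘ₗ H.kerProj)

/-- The target map `ε_t`, as the bilinear map `(a, b) ↦ ε_t(a) b`. -/
noncomputable def targetMapₗ : A →ₗ[ℂ] A →ₗ[ℂ] A :=
  TensorProduct.curry (sliceLeft H.ε ∘ₗ left H.E)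

/-- The map `ε'_s`, as the bilinear map `(a, b) ↦ ε'_s(a) b`. -/
noncomputable def sourceMapₗ' : A →ₗ[ℂ] A →ₗ[ℂ] A :=
  (TensorProduct.curry (sliceRight H.ε ∘ₗ left H.E)).flip

theorem sourceMap_apply (p q : A) : H.sourceMap p q = sliceLeft H.ε (H.kerProj (p ⊗ₜ q)) :=
  rfl

theorem targetMap_apply (a b : A) : H.targetMap a b = sliceLeft H.ε (left H.E (a ⊗ₜ b)) :=
  rfl

theorem sourceMap'_apply (a b : A) : H.sourceMap' a b = sliceRight H.ε (left H.E (b ⊗ₜ a)) :=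
  rfl

theorem sourceMap_mul (p q x : A) : H.sourceMap p (q * x) = H.sourceMap p q * x := by
  have h := H.kerProj_lTensor_mulRight x (p ⊗ₜ q)
  rw [LinearMap.lTensor_tmul, LinearMap.mulRight_apply] at h
  rw [sourceMap_apply, h, sliceLeft_lTensor, sourceMap_apply, LinearMap.mulRight_apply]

theorem targetMap_mul (a b x : A) : H.targetMap a (b * x) = H.targetMap a b * x := by
  have h := left_lTensor_mulRight H.nondegenerate H.nondegenerate H.E (a ⊗ₜ b) x
  rw [LinearMap.lTensor_tmul, LinearMap.mulRight_apply] at h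
  rw [targetMap_apply, h, sliceLeft_lTensor, targetMap_apply, LinearMap.mulRight_apply]

theorem rTensor_sourceMap_comulMul₂ (a b c : A) :
    (H.sourceMap.flip b).rTensor A (H.comulMul₂ c a) =
      (mulLeft ℂ a).lTensor A (left H.E (b ⊗ₜ c)) := by
  refine eq_of_forall_sliceRight_eq fun ω => ?_
  rw [sliceRight_rTensor, LinearMap.flip_apply, sourceMap_apply, ← insertSlice_tmul,
    kerProj_insertSlice, sliceLeft_ε_insertSlice, sliceRight_lTensor]

theorem left_E_tmul_mul (x w y : A) :
    left H.E (x ⊗ₜ (w * y)) = (H.sourceMapₗ'.flip x).rTensor A (H.comulMul₂ y w) := by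
  have h := congrArg ((sliceLeft H.ε).lTensor A) (H.isColinear_left_E x w y)
  have h_counit : sliceLeft H.ε ∘ₗ H.comulMul₂ y = mulRight ℂ y :=
    LinearMap.ext fun a => H.sliceLeft_ε_T₁ a y
  rw [lTensor_sliceLeft_assoc, ← LinearMap.rTensor_comp_apply, ← LinearMap.lTensor_comp_apply,
    h_counit, LinearMap.comp_apply, TensorProduct.mk_apply,
    ← left_lTensor_mulRight H.nondegenerate H.nondegenerate, LinearMap.lTensor_tmul] at h
  exact h.symm

theorem lift_targetMapₗ_comulMul₂ (w y : A) :
    TensorProduct.lift H.targetMapₗ (H.comulMul₂ y w) = w * y := by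
  have h_lift : TensorProduct.lift H.targetMapₗ = sliceLeft H.ε ∘ₗ left H.E :=
    TensorProduct.ext' fun _ _ => rfl
  rw [h_lift, LinearMap.comp_apply, comulMul₂_apply, left_E_T₁, sliceLeft_ε_T₁]

/-- `∑ (1 ⊗ ε_s(a₍₁₎))d ⊗ a₍₂₎e = (1 ⊗ 1 ⊗ a)(1 ⊗ E)(d ⊗ e)`. -/
theorem assoc_rTensor_lTensor_sourceMap (a e : A) (d : A ⊗[ℂ] A) : TensorProduct.assoc ℂ A A A
    (((LinearMap.lTensorHom A ∘ₗ H.sourceMap).flip d).rTensor A (H.comulMul₂ e a)) =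
      ((mulLeft ℂ a).lTensor A ∘ₗ left H.E).lTensor A
        (TensorProduct.assoc ℂ A A A (d ⊗ₜ[ℂ] e)) := by
  induction d with
  | zero => simp only [map_zero, LinearMap.rTensor_zero, LinearMap.zero_apply,
      TensorProduct.zero_tmul]
  | add x y hx hy =>
    rw [map_add, LinearMap.rTensor_add, LinearMap.add_apply, map_add, hx, hy,
      TensorProduct.add_tmul, map_add, map_add]
  | tmul g k =>
    rw [TensorProduct.assoc_tmul, LinearMap.lTensor_tmul, LinearMap.comp_apply,
      ← rTensor_sourceMap_comulMul₂]
    exact apply_eq_of_tmul ((TensorProduct.assoc ℂ A A A).toLinearMap ∘ₗ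
      ((LinearMap.lTensorHom A ∘ₗ H.sourceMap).flip (g ⊗ₜ k)).rTensor A)
      (TensorProduct.mk ℂ A (A ⊗[ℂ] A) g ∘ₗ (H.sourceMap.flip k).rTensor A) (fun _ _ => rfl) _

end

namespace IsCoopposite

/-- `G₁(p ⊗ qx) = ∑ p₍₁₎ ⊗ q₍₁₎x ε(p₍₂₎q₍₂₎)`. -/
theorem kerProj_tmul_mul (h : H.IsCoopposite H') (p q x : A) :
    H.kerProj (p ⊗ₜ (q * x)) = H.insertSlice H.ε p (H'.copComulMul₁ x q) := by
  have h_fix := H.kerProj_insertSlice H.ε p (H'.copComulMul₁ x q)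
  rw [h.left_E_copComulMul₁] at h_fix
  rw [← h_fix, ← sub_eq_zero, ← map_sub]
  apply kerProj_eq_zero
  rw [map_sub, h.T₁_insertSlice, sub_self]

theorem mul_sourceMap (h : H.IsCoopposite H') (c p q : A) :
    c * H.sourceMap p q = sliceRight (H.ε ∘ₗ mulLeft ℂ p) (H.mulComul₁ c q) := by
  refine H.nondegenerate.eq_of_mul_right fun x => ?_
  rw [mul_assoc, ← sourceMap_mul, sourceMap_apply, h.kerProj_tmul_mul, sliceLeft_ε_insertSlice,
    ← LinearMap.mulLeft_apply (R := ℂ), ← sliceRight_rTensor, h.rTensor_mulLeft_copComulMul₁,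
    sliceRight_rTensor, LinearMap.mulRight_apply]

theorem mulComul₁_sourceMap (h : H.IsCoopposite H') (c p b : A) :
    H.mulComul₁ c (H.sourceMap p b) = (H.sourceMap p).lTensor A (H.mulComul₁ c b) := by
  let F : A →ₗ[ℂ] A ⊗[ℂ] A := H.mulComul₁ c ∘ₗ H.sourceMap.flip b
  let F' : A →ₗ[ℂ] A ⊗[ℂ] A := (LinearMap.lTensorHom A ∘ₗ H.sourceMap).flip (H.mulComul₁ c b)
  suffices hF : F - F' = 0 from LinearMap.congr_fun (sub_eq_zero.1 hF) p
  refine H.eq_zero_of_rTensor_T₁_eq_zero _ fun a e => ?_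
  rw [LinearMap.rTensor_sub, LinearMap.sub_apply, sub_eq_zero]
  apply (TensorProduct.assoc ℂ A A A).injective
  rw [← comulMul₂_apply, assoc_rTensor_lTensor_sourceMap, LinearMap.lTensor_comp_apply,
    LinearMap.rTensor_comp_apply, rTensor_sourceMap_comulMul₂, rTensor_lTensor_comm,
    ← lTensor_lTensor_assoc, h.commutesWithE_mulComul₁, LinearMap.rTensor_tmul]

theorem ε_sourceMap (h : H.IsCoopposite H') (p q : A) :
    H.ε (H.sourceMap p q) = H.ε (p * q) := by
  have h_sub : H.ε ∘ₗ H.sourceMap p - H.ε ∘ₗ mulLeft ℂ p = 0 :=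
    H.eq_zero_of_lTensor_T₂_eq_zero _ fun c b => (TensorProduct.rid ℂ A).injective <| by
      have h_slice := h.mul_sourceMap c p b
      rw [← H.sliceRight_ε_T₂, ← mulComul₁_apply, h.mulComul₁_sourceMap,
        sliceRight_lTensor] at h_slice
      rw [LinearMap.lTensor_sub, LinearMap.sub_apply, map_sub, map_zero, sub_eq_zero]
      exact h_slice
  exact LinearMap.congr_fun (sub_eq_zero.1 h_sub) q

theorem mul_targetMap (h : H.IsCoopposite H') (a b c : A) :
    a * H.targetMap b c = sliceLeft (H.ε ∘ₗ mulRight ℂ b) (H.comulMul₂ c a) := by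
  have h_ε : H.ε ∘ₗ H.sourceMap.flip b = H.ε ∘ₗ mulRight ℂ b :=
    LinearMap.ext fun p => h.ε_sourceMap p b
  rw [← h_ε, ← sliceLeft_rTensor, rTensor_sourceMap_comulMul₂, sliceLeft_lTensor, targetMap_apply,
    LinearMap.mulLeft_apply]

theorem mul_sourceMap' (h : H.IsCoopposite H') (a b c : A) :
    a * H.sourceMap' b c = sliceRight (H.ε ∘ₗ mulRight ℂ b) (H'.copComulMul₁ c a) := by
  have h_target := h.symm.mul_targetMap a b c
  rw [targetMap_apply, h.left_E_tmul, h.ε_eq, sliceLeft_comm] at h_target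
  rw [sourceMap'_apply, h_target, copComulMul₁_apply, sliceRight_comm, comulMul₂_apply]

theorem rTensor_mulRight_comulMul₂ (h : H.IsCoopposite H') (a x y : A) :
    (mulRight ℂ x).rTensor A (H.comulMul₂ y a) =
      (mulRight ℂ y).lTensor A (H'.copComulMul₁ x a) := by
  rw [← h.left_Δ_tmul, H.left_Δ_tmul, comulMul₂_apply]

theorem mul_sourceMap'_eq_mul (h : H.IsCoopposite H') (a b c : A) :
    a * H.sourceMap' b c = sliceRight H.ε (H.comulMul₂ b a) * c := by
  rw [h.mul_sourceMap', ← sliceRight_lTensor, ← h.rTensor_mulRight_comulMul₂, sliceRight_rTensor,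
    LinearMap.mulRight_apply]

theorem mul_targetMap_eq_mul (h : H.IsCoopposite H') (a b c : A) :
    a * H.targetMap b c = sliceLeft H.ε (H'.copComulMul₁ b a) * c := by
  rw [h.mul_targetMap, ← sliceLeft_rTensor, h.rTensor_mulRight_comulMul₂, sliceLeft_lTensor,
    LinearMap.mulRight_apply]

/-- `E(ε'_s(c) ⊗ 1) = E(1 ⊗ ε_t(c))`, because
`Δ(a)(ε'_s(c) ⊗ 1) = ∑ a₍₁₎ ε(a₍₂₎c) ⊗ a₍₃₎ = Δ(a)(1 ⊗ ε_t(c))`. -/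
theorem left_E_sourceMap'_tmul (h : H.IsCoopposite H') (c x y : A) :
    left H.E (H.sourceMap' c x ⊗ₜ y) = left H.E (x ⊗ₜ H.targetMap c y) := by
  refine H.left_E_eq_of_left_Δ_eq fun a => ?_
  let φ := H.ε ∘ₗ mulRight ℂ c
  have h_source : mulRight ℂ (H.sourceMap' c x) = sliceRight φ ∘ₗ H'.copComulMul₁ x :=
    LinearMap.ext fun p => h.mul_sourceMap' p c x
  have h_target : mulRight ℂ (H.targetMap c y) = sliceLeft φ ∘ₗ H.comulMul₂ y :=
    LinearMap.ext fun p => h.mul_targetMap p c y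
  rw [H.left_Δ_tmul, h_source, h.left_Δ_tmul, h_target, LinearMap.lTensor_comp_apply,
    ← h.isColinear_copComulMul₁, lTensor_sliceLeft_assoc, ← LinearMap.rTensor_comp_apply,
    comulMul₂_apply]

theorem targetMap_eq_zero (h : H.IsCoopposite H') {c : A} (hc : H.sourceMap' c = 0) :
    H.targetMap c = 0 := by
  refine LinearMap.ext fun y => H.nondegenerate.2 _ fun a => ?_
  rw [← H.sliceLeft_ε_T₁]
  suffices h_T₁ : H.T₁ (a ⊗ₜ H.targetMap c y) = 0 by rw [h_T₁, map_zero]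
  refine H.nondegenerate.eq_of_rTensor_mulRight fun x => ?_
  rw [← H.left_Δ_tmul, ← left_Δ_left_E, ← h.left_E_sourceMap'_tmul, hc]
  simp only [LinearMap.zero_apply, TensorProduct.zero_tmul, map_zero]

end IsCoopposite

end WeakMultiplierHopfAlgebra

section

variable {K U V W : Type*} [Field K] [AddCommGroup U] [Module K U] [AddCommGroup V] [Module K V]
  [AddCommGroup W] [Module K W]

theorem exists_comp_comp_eq_of_ker_le_ker (f : U →ₗ[K] V) (g : U →ₗ[K] W)
    (h : LinearMap.ker f ≤ LinearMap.ker g) : ∃ s : V →ₗ[K] U, g ∘ₗ s ∘ₗ f = g := by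
  obtain ⟨r, hr⟩ := f.rangeRestrict.exists_rightInverse_of_surjective f.range_rangeRestrict
  obtain ⟨s, hs⟩ := LinearMap.exists_extend r
  refine ⟨s, LinearMap.ext fun u => ?_⟩
  have h_section : f (s (f u)) = f u := by
    have h_extend : s (f u) = r (f.rangeRestrict u) := LinearMap.congr_fun hs (f.rangeRestrict u)
    rw [h_extend]
    exact congrArg Subtype.val (LinearMap.congr_fun hr (f.rangeRestrict u))
  refine sub_eq_zero.1 ?_
  rw [LinearMap.comp_apply, LinearMap.comp_apply, ← map_sub]
  exact h (LinearMap.mem_ker.2 (by rw [map_sub, h_section, sub_self]))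

end

namespace WeakMultiplierHopfAlgebra

open MultiplierAlgebra

variable {A : Type*} [NonUnitalRing A] [Module ℂ A] [IsScalarTower ℂ A A] [SMulCommClass ℂ A A]
variable {V : Type*} [AddCommGroup V] [Module ℂ V]

section

variable (H : WeakMultiplierHopfAlgebra A)

theorem exists_comp_T₁_eq_kerProj : ∃ L : A ⊗[ℂ] A →ₗ[ℂ] A ⊗[ℂ] A, L ∘ₗ H.T₁ = H.kerProj := by
  obtain ⟨s, hs⟩ := exists_comp_comp_eq_of_ker_le_ker H.T₁ H.kerProj fun _ => H.kerProj_eq_zero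
  exact ⟨H.kerProj ∘ₗ s, hs⟩

/-- The generalized inverse `R₁` of `T₁`, for which `T₁ R₁` is the action of `E` and `R₁ T₁ = G₁`.
In terms of the antipode `S`, it is given by `R₁(c ⊗ a) = ∑ c₍₁₎ ⊗ S(c₍₂₎)a`. -/
noncomputable def R₁ : A ⊗[ℂ] A →ₗ[ℂ] A ⊗[ℂ] A :=
  H.exists_comp_T₁_eq_kerProj.choose ∘ₗ left H.E

theorem exists_T₁_eq_R₁_eq (z : A ⊗[ℂ] A) : ∃ w, H.T₁ w = left H.E z ∧ H.R₁ z = H.kerProj w := by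
  obtain ⟨w, hw⟩ : left H.E z ∈ LinearMap.range H.T₁ := H.range_T₁ ▸ ⟨z, rfl⟩
  refine ⟨w, hw, ?_⟩
  rw [R₁, LinearMap.comp_apply, ← hw]
  exact LinearMap.congr_fun H.exists_comp_T₁_eq_kerProj.choose_spec w

theorem T₁_R₁ (z : A ⊗[ℂ] A) : H.T₁ (H.R₁ z) = left H.E z := by
  obtain ⟨w, h_T₁, h_R₁⟩ := H.exists_T₁_eq_R₁_eq z
  rw [h_R₁, T₁_kerProj, h_T₁]

theorem kerProj_R₁ (z : A ⊗[ℂ] A) : H.kerProj (H.R₁ z) = H.R₁ z := by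
  obtain ⟨w, -, h_R₁⟩ := H.exists_T₁_eq_R₁_eq z
  rw [h_R₁, kerProj_kerProj]

/-- The antipode `S`, as the bilinear map `(c, a) ↦ S(c)a = (ε ⊗ ι)(R₁(c ⊗ a))`. -/
noncomputable def antipode : A →ₗ[ℂ] A →ₗ[ℂ] A :=
  TensorProduct.curry (sliceLeft H.ε ∘ₗ H.R₁)

theorem antipode_apply (c a : A) : H.antipode c a = sliceLeft H.ε (H.R₁ (c ⊗ₜ a)) :=
  rfl

theorem mul'_R₁ (z : A ⊗[ℂ] A) : LinearMap.mul' ℂ A (H.R₁ z) = sliceLeft H.ε (left H.E z) := by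
  rw [← T₁_R₁]
  exact apply_eq_of_tmul (LinearMap.mul' ℂ A) (sliceLeft H.ε ∘ₗ H.T₁)
    (fun x y => (H.sliceLeft_ε_T₁ x y).symm) _

theorem mul_sourceMap_eq_mul (b p q : A) :
    b * H.sourceMap p q = sliceRight H.ε (right H.E (b ⊗ₜ p)) * q := by
  let X := right H.E ∘ₗ TensorProduct.mk ℂ A A b
  suffices h : mulLeft ℂ b ∘ₗ H.sourceMap.flip q - mulRight ℂ q ∘ₗ sliceRight H.ε ∘ₗ X = 0 from
    LinearMap.congr_fun (sub_eq_zero.1 h) p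
  refine H.eq_zero_of_rTensor_T₁_eq_zero _ fun a c => ?_
  have h_counit : sliceLeft H.ε ∘ₗ H.comulMul₂ c = mulRight ℂ c :=
    LinearMap.ext fun a => H.sliceLeft_ε_T₁ a c
  rw [LinearMap.rTensor_sub, LinearMap.sub_apply, sub_eq_zero, ← comulMul₂_apply,
    LinearMap.rTensor_comp_apply, LinearMap.rTensor_comp_apply, LinearMap.rTensor_comp_apply,
    rTensor_sourceMap_comulMul₂, ← lTensor_sliceLeft_assoc, H.isColinear_right_E b,
    ← LinearMap.lTensor_comp_apply, h_counit, ← map_eq_rTensor_lTensor,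
    ← map_eq_rTensor_lTensor, ← mul_tmul_eq_map, ← tmul_mul_eq_map, LinearMap.comp_apply,
    TensorProduct.mk_apply, right_mul_eq_mul_left]

/-- The map `(w, a) ↦ insertSlice ω a w`. -/
noncomputable def insertSliceFlip (ω : A →ₗ[ℂ] ℂ) : A ⊗[ℂ] A →ₗ[ℂ] A →ₗ[ℂ] A ⊗[ℂ] A :=
  (LinearMap.lTensorHom A ∘ₗ TensorProduct.curry (sliceRight ω ∘ₗ H.T₁)).flip.compr₂
    (TensorProduct.comm ℂ A A).toLinearMap

/-- With `T₁(p ⊗ q) = ∑ p₍₁₎ ⊗ p₍₂₎q`, both sides are `∑ d p₍₁₎ ω(p₍₂₎q)`; the point is that the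
right hand side depends only on the functionals `ω(· q)`. -/
theorem mul_sliceRight_T₁ (ω : A →ₗ[ℂ] ℂ) (d : A) (z : A ⊗[ℂ] A) :
    d * sliceRight ω (H.T₁ z) = TensorProduct.rid ℂ A ((contractRight ℂ A).lTensor A
      (TensorProduct.assoc ℂ A A (Module.Dual ℂ A) ((H.mulComul₁ d).rTensor (Module.Dual ℂ A)
        (((LinearMap.mul ℂ A).flip.compr₂ ω).lTensor A z)))) := by
  let contract : (A ⊗[ℂ] A) ⊗[ℂ] Module.Dual ℂ A →ₗ[ℂ] A := (TensorProduct.rid ℂ A).toLinearMap ∘ₗ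
    (contractRight ℂ A).lTensor A ∘ₗ (TensorProduct.assoc ℂ A A (Module.Dual ℂ A)).toLinearMap
  have h_contract : ∀ (φ : Module.Dual ℂ A) (w : A ⊗[ℂ] A),
      contract (w ⊗ₜ φ) = sliceRight φ w := fun φ =>
    apply_eq_of_tmul (contract ∘ₗ (TensorProduct.mk ℂ (A ⊗[ℂ] A) _).flip φ) (sliceRight φ)
      fun _ _ => rfl
  refine apply_eq_of_tmul (mulLeft ℂ d ∘ₗ sliceRight ω ∘ₗ H.T₁) (contract ∘ₗ
    (H.mulComul₁ d).rTensor (Module.Dual ℂ A) ∘ₗ ((LinearMap.mul ℂ A).flip.compr₂ ω).lTensor A)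
    (fun p q => ?_) z
  have h_slice := h_contract ((LinearMap.mul ℂ A).flip.compr₂ ω q) (H.mulComul₁ d p)
  refine Eq.trans ?_ h_slice.symm
  rw [LinearMap.comp_apply, LinearMap.comp_apply, ← sliceRight_rTensor, rTensor_mulLeft_T₁,
    sliceRight_lTensor, mulComul₁_apply]
  rfl

end

namespace IsColinear

variable {H H' : WeakMultiplierHopfAlgebra A} {X : A →ₗ[ℂ] V ⊗[ℂ] A}

theorem assoc_rTensor_T₁ (hX : H.IsColinear X) (z : A ⊗[ℂ] A) :
    TensorProduct.assoc ℂ V A A (X.rTensor A (H.T₁ z)) =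
      H.T₁.lTensor V (TensorProduct.assoc ℂ V A A (X.rTensor A z)) :=
  apply_eq_of_tmul ((TensorProduct.assoc ℂ V A A).toLinearMap ∘ₗ X.rTensor A ∘ₗ H.T₁)
    (H.T₁.lTensor V ∘ₗ (TensorProduct.assoc ℂ V A A).toLinearMap ∘ₗ X.rTensor A)
    (fun a b => (hX a b).trans <|
      apply_eq_of_tmul ((H.comulMul₂ b).lTensor V) (H.T₁.lTensor V ∘ₗ
        (TensorProduct.assoc ℂ V A A).toLinearMap ∘ₗ (TensorProduct.mk ℂ (V ⊗[ℂ] A) A).flip b)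
        (fun _ _ => rfl) (X a)) z

theorem assoc_rTensor_insertSlice (hX : H.IsColinear X) (ω : A →ₗ[ℂ] ℂ) (p : A) (w : A ⊗[ℂ] A) :
    TensorProduct.assoc ℂ V A A (X.rTensor A (H.insertSlice ω p w)) =
      (H.insertSliceFlip ω w).lTensor V (X p) :=
  apply_eq_of_tmul
    ((TensorProduct.assoc ℂ V A A).toLinearMap ∘ₗ X.rTensor A ∘ₗ H.insertSlice ω p)
    ((LinearMap.lTensorHom V ∘ₗ H.insertSliceFlip ω).flip (X p))
    (fun u v => by
      rw [LinearMap.comp_apply, LinearMap.comp_apply, insertSlice_tmul, LinearMap.rTensor_tmul,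
        hX.apply_sliceRight]
      exact apply_eq_of_tmul ((TensorProduct.assoc ℂ V A A).toLinearMap ∘ₗ
        (TensorProduct.mk ℂ (V ⊗[ℂ] A) A).flip u ∘ₗ (sliceRight ω ∘ₗ H.comulMul₂ v).lTensor V)
        ((H.insertSliceFlip ω (u ⊗ₜ v)).lTensor V) (fun _ _ => rfl) (X p)) w

theorem assoc_rTensor_kerProj (h : H.IsCoopposite H') (hX : H.IsColinear X) (z : A ⊗[ℂ] A) :
    TensorProduct.assoc ℂ V A A (X.rTensor A (H.kerProj z)) =
      H.kerProj.lTensor V (TensorProduct.assoc ℂ V A A (X.rTensor A z)) := by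
  let F := (TensorProduct.assoc ℂ V A A).toLinearMap ∘ₗ X.rTensor A ∘ₗ H.kerProj
  let F' := H.kerProj.lTensor V ∘ₗ (TensorProduct.assoc ℂ V A A).toLinearMap ∘ₗ X.rTensor A
  refine apply_eq_of_tmul F F' (fun p b => ?_) z
  have h_mul : ∀ q x, F (p ⊗ₜ (q * x)) = F' (p ⊗ₜ (q * x)) := fun q x => by
    change TensorProduct.assoc ℂ V A A (X.rTensor A (H.kerProj (p ⊗ₜ (q * x)))) = _
    rw [h.kerProj_tmul_mul, hX.assoc_rTensor_insertSlice]
    exact apply_eq_of_tmul ((H.insertSliceFlip H.ε (H'.copComulMul₁ x q)).lTensor V)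
      (H.kerProj.lTensor V ∘ₗ (TensorProduct.assoc ℂ V A A).toLinearMap ∘ₗ
        (TensorProduct.mk ℂ (V ⊗[ℂ] A) A).flip (q * x))
      (fun v c => congrArg (v ⊗ₜ[ℂ] ·) (h.kerProj_tmul_mul c q x).symm) (X p)
  exact LinearMap.congr_fun
    (H.ext_mul (f := F ∘ₗ TensorProduct.mk ℂ A A p) (g := F' ∘ₗ TensorProduct.mk ℂ A A p) h_mul) b

theorem assoc_rTensor_R₁ (h : H.IsCoopposite H') (hX : H.IsColinear X) (hE : H.CommutesWithE X)
    (z : A ⊗[ℂ] A) : TensorProduct.assoc ℂ V A A (X.rTensor A (H.R₁ z)) =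
      H.R₁.lTensor V (TensorProduct.assoc ℂ V A A (X.rTensor A z)) := by
  rw [← kerProj_R₁, hX.assoc_rTensor_kerProj h, ← H.exists_comp_T₁_eq_kerProj.choose_spec,
    LinearMap.lTensor_comp_apply, ← hX.assoc_rTensor_T₁, T₁_R₁, hE, R₁,
    LinearMap.lTensor_comp_apply]

/-- With `X(c) = ∑ v ⊗ c'`, this reads `∑ (ι ⊗ ε)X(c₍₁₎) ⊗ S(c₍₂₎)a = ∑ v ⊗ S(c')a`. -/
theorem rTensor_sliceRight_R₁ (h : H.IsCoopposite H') (hX : H.IsColinear X)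
    (hE : H.CommutesWithE X) (c a : A) :
    (sliceRight H.ε ∘ₗ X).rTensor A (H.R₁ (c ⊗ₜ a)) = (H.antipode.flip a).lTensor V (X c) := by
  rw [LinearMap.rTensor_comp_apply, ← lTensor_sliceLeft_assoc, hX.assoc_rTensor_R₁ h hE,
    LinearMap.rTensor_tmul]
  exact apply_eq_of_tmul ((sliceLeft H.ε).lTensor V ∘ₗ H.R₁.lTensor V ∘ₗ
    (TensorProduct.assoc ℂ V A A).toLinearMap ∘ₗ (TensorProduct.mk ℂ (V ⊗[ℂ] A) A).flip a)
    ((H.antipode.flip a).lTensor V) (fun _ _ => rfl) (X c)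

end IsColinear

namespace IsCoopposite

variable {H H' : WeakMultiplierHopfAlgebra A}

theorem rTensor_mulRight_R₁ (h : H.IsCoopposite H') (c a d : A) :
    (mulRight ℂ d).rTensor A (H.R₁ (c ⊗ₜ a)) =
      (H.antipode.flip a).lTensor A (H'.copComulMul₁ d c) := by
  have h_counit : sliceRight H.ε ∘ₗ H'.copComulMul₁ d = mulRight ℂ d :=
    LinearMap.ext (h.sliceRight_ε_copComulMul₁ d)
  rw [← (h.isColinear_copComulMul₁ d).rTensor_sliceRight_R₁ h (h.commutesWithE_copComulMul₁ d),
    h_counit]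

/-- `b S(v)a = ∑ b E₍₁₎ S(v E₍₂₎)a`. -/
theorem mul_antipode (h : H.IsCoopposite H') (b v a : A) :
    b * H.antipode v a =
      LinearMap.mul' ℂ A ((H.antipode.flip a).lTensor A (right H.E (b ⊗ₜ v))) := by
  have h_slice := (H.isColinear_right_E b).rTensor_sliceRight_R₁ h (H.commutesWithE_right_E b) v a
  rw [LinearMap.comp_apply, TensorProduct.mk_apply] at h_slice
  rw [← h_slice, antipode_apply, ← kerProj_R₁]
  refine (apply_eq_of_tmul (mulLeft ℂ b ∘ₗ sliceLeft H.ε ∘ₗ H.kerProj) (LinearMap.mul' ℂ A ∘ₗ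
    (sliceRight H.ε ∘ₗ right H.E ∘ₗ TensorProduct.mk ℂ A A b).rTensor A)
    (fun p q => H.mul_sourceMap_eq_mul b p q) (H.R₁ (v ⊗ₜ a))).trans ?_
  rw [kerProj_R₁, LinearMap.comp_apply]

theorem mul'_lTensor_antipode_mulComul₁ (h : H.IsCoopposite H') (x y a : A) :
    LinearMap.mul' ℂ A ((H.antipode.flip a).lTensor A (H.mulComul₁ x y)) =
      x * H.targetMap y a := by
  have h_counit : sliceRight H.ε ∘ₗ H.mulComul₁ x = mulLeft ℂ x :=
    LinearMap.ext fun p => H.sliceRight_ε_T₂ x p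
  rw [← (H.isColinear_mulComul₁ x).rTensor_sliceRight_R₁ h (h.commutesWithE_mulComul₁ x),
    h_counit, targetMap_apply, ← mul'_R₁]
  exact apply_eq_of_tmul (LinearMap.mul' ℂ A ∘ₗ (mulLeft ℂ x).rTensor A)
    (mulLeft ℂ x ∘ₗ LinearMap.mul' ℂ A) (fun p q => mul_assoc x p q) _

/-- The left multiplier `S(v)` is a right multiplier as well, with `b S(v)` in `A`. -/
theorem exists_forall_mul_antipode_eq_mul (h : H.IsCoopposite H') (b v : A) :
    ∃ s : A, ∀ a, b * H.antipode v a = s * a := by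
  obtain ⟨u, hu⟩ : right H.E (b ⊗ₜ v) ∈ LinearMap.range H.T₂ := H.range_T₂ ▸ ⟨_, rfl⟩
  suffices h_T₂ : ∃ s : A, ∀ a,
      LinearMap.mul' ℂ A ((H.antipode.flip a).lTensor A (H.T₂ u)) = s * a by
    obtain ⟨s, hs⟩ := h_T₂
    exact ⟨s, fun a => by rw [h.mul_antipode, ← hu, hs]⟩
  clear hu
  induction u with
  | zero => exact ⟨0, fun a => by simp only [map_zero, zero_mul]⟩
  | add x y hx hy =>
    obtain ⟨s, hs⟩ := hx
    obtain ⟨t, ht⟩ := hy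
    exact ⟨s + t, fun a => by rw [map_add, map_add, map_add, hs, ht, add_mul]⟩
  | tmul x y =>
    exact ⟨sliceLeft H.ε (H'.copComulMul₁ y x), fun a => by
      rw [← h.mul_targetMap_eq_mul, ← mulComul₁_apply, h.mul'_lTensor_antipode_mulComul₁]⟩

/-- `ω(b S(c₍₂₎)a) = 0` for all `b` because `b S(c₍₂₎)` is in `A`. -/
theorem lTensor_mul_compr₂_R₁_eq_zero (h : H.IsCoopposite H') {ω : A →ₗ[ℂ] ℂ} {a : A}
    (hω : ∀ b, ω (b * a) = 0) (c : A) :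
    ((LinearMap.mul ℂ A).flip.compr₂ ω).lTensor A (H.R₁ (c ⊗ₜ a)) = 0 := by
  refine lTensor_eq_zero_of_flip _ fun b => ?_
  refine H.nondegenerate.eq_of_rTensor_mulRight fun d => ?_
  have h_antipode : ((LinearMap.mul ℂ A).flip.compr₂ ω).flip b ∘ₗ H.antipode.flip a = 0 :=
    LinearMap.ext fun v => by
      obtain ⟨s, hs⟩ := h.exists_forall_mul_antipode_eq_mul b v
      exact (congrArg ω (hs a)).trans (hω s)
  rw [rTensor_lTensor_comm, h.rTensor_mulRight_R₁, ← LinearMap.lTensor_comp_apply, map_zero,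
    h_antipode, LinearMap.lTensor_zero, LinearMap.zero_apply]

theorem sliceRight_left_E_eq_zero (h : H.IsCoopposite H') {ω : A →ₗ[ℂ] ℂ} {a : A}
    (hω : ∀ b, ω (b * a) = 0) (c : A) : sliceRight ω (left H.E (c ⊗ₜ a)) = 0 := by
  refine H.nondegenerate.2 _ fun d => ?_
  rw [← T₁_R₁, mul_sliceRight_T₁, h.lTensor_mul_compr₂_R₁_eq_zero hω]
  simp only [map_zero]

/-- Write `a = ∑ wy`. Then `∑ ε'_s(w₍₁₎)x ⊗ ω(ε_t(·)w₍₂₎y) = (ι ⊗ ω(ε_t(·) -))(E(x ⊗ a)) = 0`, and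
since `ε_t` factors through `ε'_s`, also `ω(a) = ∑ ω(ε_t(w₍₁₎)w₍₂₎y) = 0`. -/
theorem apply_eq_zero_of_forall_apply_mul_eq_zero (h : H.IsCoopposite H') {ω : A →ₗ[ℂ] ℂ} {a : A}
    (hω : ∀ b, ω (b * a) = 0) : ω a = 0 := by
  obtain ⟨t, ht⟩ := H.idempotent a
  obtain ⟨g, hg⟩ := exists_comp_comp_eq_of_ker_le_ker H.sourceMapₗ' H.targetMapₗ
    fun _ hc => h.targetMap_eq_zero hc
  let Φ : A →ₗ[ℂ] A →ₗ[ℂ] ℂ := H.targetMapₗ.flip.compr₂ ω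
  have h_source : ∀ x, (H.sourceMapₗ'.flip x).rTensor A (H.T₁ t) = left H.E (x ⊗ₜ a) := fun x => by
    rw [← ht]
    exact apply_eq_of_tmul ((H.sourceMapₗ'.flip x).rTensor A ∘ₗ H.T₁)
      (left H.E ∘ₗ TensorProduct.mk ℂ A A x ∘ₗ LinearMap.mul' ℂ A)
      (fun w y => (H.left_E_tmul_mul x w y).symm) t
  have h_zero : H.sourceMapₗ'.rTensor (A →ₗ[ℂ] ℂ) (Φ.lTensor A (H.T₁ t)) = 0 := by
    refine rTensor_eq_zero_of_flip _ fun x => ?_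
    rw [rTensor_lTensor_comm, h_source]
    refine lTensor_eq_zero_of_flip Φ fun u => (TensorProduct.rid ℂ A).injective ?_
    rw [map_zero]
    refine h.sliceRight_left_E_eq_zero (ω := ω ∘ₗ H.targetMap u) (fun b => ?_) x
    rw [LinearMap.comp_apply, targetMap_mul, hω]
  have h_target : TensorProduct.lift H.targetMapₗ (H.T₁ t) = a := by
    rw [← ht]
    exact apply_eq_of_tmul (TensorProduct.lift H.targetMapₗ ∘ₗ H.T₁) (LinearMap.mul' ℂ A)
      H.lift_targetMapₗ_comulMul₂ t
  have h_eval := apply_eq_of_tmul (ω ∘ₗ TensorProduct.lift H.targetMapₗ)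
    (contractRight ℂ A ∘ₗ g.rTensor _ ∘ₗ H.sourceMapₗ'.rTensor _ ∘ₗ Φ.lTensor A)
    (fun p q => (congrArg (ω <| · q) (LinearMap.congr_fun hg p)).symm) (H.T₁ t)
  rwa [LinearMap.comp_apply, h_target, LinearMap.comp_apply, LinearMap.comp_apply,
    LinearMap.comp_apply, h_zero, map_zero, map_zero] at h_eval

theorem exists_mul_eq_self (h : H.IsCoopposite H') (a : A) : ∃ e : A, e * a = a := by
  by_contra h_notMem
  obtain ⟨ω, hω, h_ker⟩ := Submodule.exists_le_ker_of_notMem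
    (show a ∉ LinearMap.range (mulRight ℂ a) from h_notMem)
  exact hω (h.apply_eq_zero_of_forall_apply_mul_eq_zero fun b => h_ker ⟨b, rfl⟩)

theorem exists_forall_mul_eq_self (h : H.IsCoopposite H') (s : Finset A) :
    ∃ e : A, ∀ a ∈ s, e * a = a := by
  classical
  induction s using Finset.induction_on with
  | empty => exact ⟨0, fun a ha => absurd ha (Finset.notMem_empty a)⟩
  | insert b s _ ih =>
    obtain ⟨e, he⟩ := ih
    obtain ⟨f, hf⟩ := h.exists_mul_eq_self (b - e * b)
    refine ⟨f + e - f * e, Finset.forall_mem_insert _ _ _ |>.2 ⟨?_, fun a ha => ?_⟩⟩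
    · rw [sub_mul, add_mul, mul_assoc, add_sub_right_comm, ← mul_sub, hf, sub_add_cancel]
    · rw [sub_mul, add_mul, mul_assoc, he a ha, add_sub_cancel_left]

end IsCoopposite

end WeakMultiplierHopfAlgebra

section

variable {R B C V V' W W' : Type*} [CommRing R] [AddCommGroup V] [Module R V] [AddCommGroup V']
  [Module R V'] [AddCommGroup W] [Module R W] [AddCommGroup W'] [Module R W']

theorem separatingRight_map₂ [AddCommGroup B] [Module R B] [AddCommGroup C] [Module R C]
    [Module.Free R V'] [Module.Free R W] {f : B →ₗ[R] V →ₗ[R] V'} {g : C →ₗ[R] W →ₗ[R] W'}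
    (hf : f.SeparatingRight) (hg : g.SeparatingRight) :
    (TensorProduct.map₂ f g).SeparatingRight := fun t ht =>
  eq_of_forall_rTensor_eq (fun b => f b)
    (fun x y hxy => sub_eq_zero.1 <| hf _ fun b => by rw [map_sub, hxy, sub_self]) fun b =>
    eq_of_forall_lTensor_eq (fun c => g c)
      (fun x y hxy => sub_eq_zero.1 <| hg _ fun c => by rw [map_sub, hxy, sub_self]) fun c => by
        rw [map_zero, map_zero, ← map_eq_lTensor_rTensor]
        exact ht (b ⊗ₜ c)

theorem map₂_apply_tmul [AddCommGroup B] [Module R B] [AddCommGroup C] [Module R C]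
    (f : B →ₗ[R] V →ₗ[R] V') (g : C →ₗ[R] W →ₗ[R] W') (z : B ⊗[R] C) (v : V) (w : W) :
    TensorProduct.map₂ f g z (v ⊗ₜ w) = TensorProduct.map (f.flip v) (g.flip w) z :=
  apply_eq_of_tmul ((TensorProduct.map₂ f g).flip (v ⊗ₜ w))
    (TensorProduct.map (f.flip v) (g.flip w)) (fun _ _ => rfl) z

theorem map₂_mul [NonUnitalRing B] [Module R B] [IsScalarTower R B B] [SMulCommClass R B B]
    [NonUnitalRing C] [Module R C] [IsScalarTower R C C] [SMulCommClass R C C]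
    {f : B →ₗ[R] V →ₗ[R] V} {g : C →ₗ[R] W →ₗ[R] W} (hf : ∀ a b v, f (a * b) v = f a (f b v))
    (hg : ∀ a b w, g (a * b) w = g a (g b w)) (x y : B ⊗[R] C) (t : V ⊗[R] W) :
    TensorProduct.map₂ f g (x * y) t =
      TensorProduct.map₂ f g x (TensorProduct.map₂ f g y t) := by
  let α := TensorProduct.map₂ f g
  refine apply_eq_of_tmul (α (x * y)) (α x ∘ₗ α y) (fun v w => ?_) t
  refine apply_eq_of_tmul (α.flip (v ⊗ₜ w) ∘ₗ mulLeft R x) (α x ∘ₗ α.flip (v ⊗ₜ w))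
    (fun c d => ?_) y
  refine apply_eq_of_tmul (α.flip (v ⊗ₜ w) ∘ₗ mulRight R (c ⊗ₜ d))
    (α.flip (α (c ⊗ₜ d) (v ⊗ₜ w))) (fun a b => ?_) x
  rw [LinearMap.comp_apply, LinearMap.mulRight_apply, Algebra.TensorProduct.tmul_mul_tmul]
  change f (a * c) v ⊗ₜ[R] g (b * d) w = f a (f c v) ⊗ₜ[R] g b (g d w)
  rw [hf, hg]

end

namespace IsUnitalAction

variable {B V : Type*} [NonUnitalRing B] [Module ℂ B] [AddCommGroup V] [Module ℂ V]
  {act : B →ₗ[ℂ] V →ₗ[ℂ] V}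

theorem separatingRight (hu : IsUnitalAction act) (h_mul : ∀ a b v, act (a * b) v = act a (act b v))
    (h_units : ∀ s : Finset B, ∃ e : B, ∀ b ∈ s, e * b = b) : act.SeparatingRight := by
  classical
  intro v hv
  obtain ⟨t, rfl⟩ := hu v
  obtain ⟨S, rfl⟩ := TensorProduct.exists_finset t
  obtain ⟨e, he⟩ := h_units (S.image Prod.fst)
  rw [← hv e, map_sum, map_sum]
  refine Finset.sum_congr rfl fun i hi => ?_
  rw [TensorProduct.lift.tmul, ← h_mul, he _ (Finset.mem_image_of_mem _ hi)]

theorem ext {W : Type*} [AddCommGroup W] [Module ℂ W] (hu : IsUnitalAction act)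
    {f g : V →ₗ[ℂ] W} (h : ∀ b v, f (act b v) = g (act b v)) : f = g := by
  ext v
  obtain ⟨t, rfl⟩ := hu v
  exact apply_eq_of_tmul (f ∘ₗ TensorProduct.lift act) (g ∘ₗ TensorProduct.lift act) h t

theorem act_extendedAction (hu : IsUnitalAction act)
    (h_mul : ∀ a b v, act (a * b) v = act a (act b v)) {m : B →ₗ[ℂ] B} {n : B → B}
    (hm : ∀ b a, b * m a = n b * a) (b : B) (v : V) :
    act b (extendedAction act hu m v) = act (n b) v := by
  have h_lift : ∀ t, act b (TensorProduct.lift act (m.rTensor V t)) =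
      act (n b) (TensorProduct.lift act t) :=
    apply_eq_of_tmul (act b ∘ₗ TensorProduct.lift act ∘ₗ m.rTensor V)
      (act (n b) ∘ₗ TensorProduct.lift act) fun a w =>
        (h_mul _ _ _).symm.trans <| (congrArg (act · w) (hm b a)).trans (h_mul _ _ _)
  rw [extendedAction, h_lift, Function.surjInv_eq hu]

/-- The right companion `n` of `m` makes the extended action independent of how `v = a w` is
written. -/
theorem extendedAction_act (hu : IsUnitalAction act) (h_sep : act.SeparatingRight)
    (h_mul : ∀ a b v, act (a * b) v = act a (act b v)) {m : B →ₗ[ℂ] B} {n : B → B}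
    (hm : ∀ b a, b * m a = n b * a) (a : B) (v : V) :
    extendedAction act hu m (act a v) = act (m a) v :=
  sub_eq_zero.1 <| h_sep _ fun b => by
    rw [map_sub, hu.act_extendedAction h_mul hm, ← h_mul, ← h_mul, hm, sub_self]

end IsUnitalAction

namespace WeakMultiplierHopfAlgebra

open MultiplierAlgebra

namespace ModuleAlgebra

variable {A : Type*} [NonUnitalRing A] [Module ℂ A] [IsScalarTower ℂ A A] [SMulCommClass ℂ A A]
variable {R : Type*} [NonUnitalRing R] [Module ℂ R] [IsScalarTower ℂ R R] [SMulCommClass ℂ R R]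
variable {H H' : WeakMultiplierHopfAlgebra A} (M : H.ModuleAlgebra R)

theorem separatingRight_act (h : H.IsCoopposite H') : M.act.SeparatingRight :=
  M.unital.separatingRight M.mul_act h.exists_forall_mul_eq_self

theorem eq_of_act_eq (h : H.IsCoopposite H') {r s : R} (hrs : ∀ b, M.act b r = M.act b s) :
    r = s :=
  sub_eq_zero.1 <| M.separatingRight_act h _ fun b => by rw [map_sub, hrs, sub_self]

/-- The action `(b ⊗ c) ▷ (r ⊗ a) = (b ▷ r) ⊗ ca` of `A ⊗ A` on `R ⊗ A`, whose extension to
multipliers defines `actE`. -/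
noncomputable abbrev act₂ : A ⊗[ℂ] A →ₗ[ℂ] R ⊗[ℂ] A →ₗ[ℂ] R ⊗[ℂ] A :=
  TensorProduct.map₂ M.act (LinearMap.mul ℂ A)

theorem mul_act₂ (x y : A ⊗[ℂ] A) (t : R ⊗[ℂ] A) : M.act₂ (x * y) t = M.act₂ x (M.act₂ y t) :=
  map₂_mul M.mul_act mul_assoc x y t

theorem unital_act₂ : IsUnitalAction M.act₂ :=
  M.unital.tensor (act' := LinearMap.mul ℂ A) H.idempotent

theorem separatingRight_act₂ (h : H.IsCoopposite H') : M.act₂.SeparatingRight :=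
  separatingRight_map₂ (M.separatingRight_act h) H.nondegenerate.2

theorem act₂_tmul (z : A ⊗[ℂ] A) (s : R) (b : A) :
    M.act₂ z (s ⊗ₜ b) = (M.act.flip s).rTensor A ((mulRight ℂ b).lTensor A z) := by
  rw [map₂_apply_tmul, ← map_eq_rTensor_lTensor]
  rfl

theorem act₂_actE (z : A ⊗[ℂ] A) (t : R ⊗[ℂ] A) :
    M.act₂ z (M.actE t) = M.act₂ (right H.E z) t :=
  M.unital_act₂.act_extendedAction M.mul_act₂
    (fun b a => (right_mul_eq_mul_left H.E b a).symm) z t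

theorem eq_of_act₂_eq (h : H.IsCoopposite H') {t u : R ⊗[ℂ] A}
    (htu : ∀ z, M.act₂ z t = M.act₂ z u) : t = u :=
  sub_eq_zero.1 <| M.separatingRight_act₂ h _ fun b => by rw [map_sub, htu, sub_self]

/-- The action of `E` on `R ⊗ A`, as a linear map. -/
noncomputable def actEₗ (h : H.IsCoopposite H') : R ⊗[ℂ] A →ₗ[ℂ] R ⊗[ℂ] A where
  toFun := M.actE
  map_add' t u := M.eq_of_act₂_eq h fun z => by simp only [map_add, act₂_actE]
  map_smul' c t := M.eq_of_act₂_eq h fun z => by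
    simp only [map_smul, act₂_actE, RingHom.id_apply]

theorem actEₗ_apply (h : H.IsCoopposite H') (t : R ⊗[ℂ] A) : M.actEₗ h t = M.actE t :=
  rfl

theorem actE_act_tmul (h : H.IsCoopposite H') (x y : A) (s : R) :
    M.actE (M.act x s ⊗ₜ y) = (M.act.flip s).rTensor A (left H.E (x ⊗ₜ y)) := by
  refine LinearMap.congr_fun (H.ext_mul (f := M.actEₗ h ∘ₗ TensorProduct.mk ℂ R A (M.act x s))
    (g := (M.act.flip s).rTensor A ∘ₗ left H.E ∘ₗ TensorProduct.mk ℂ A A x) fun y b => ?_) y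
  have h_act := M.unital_act₂.extendedAction_act (M.separatingRight_act₂ h) M.mul_act₂
    (fun b a => (right_mul_eq_mul_left H.E b a).symm) (x ⊗ₜ y) (s ⊗ₜ b)
  rw [act₂_tmul, act₂_tmul, ← left_lTensor_mulRight H.nondegenerate H.nondegenerate] at h_act
  exact h_act

theorem actE_rTensor (h : H.IsCoopposite H') (s : R) (z : A ⊗[ℂ] A) :
    M.actE ((M.act.flip s).rTensor A z) = (M.act.flip s).rTensor A (left H.E z) :=
  apply_eq_of_tmul (M.actEₗ h ∘ₗ (M.act.flip s).rTensor A) ((M.act.flip s).rTensor A ∘ₗ left H.E)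
    (fun x y => M.actE_act_tmul h x y s) z

theorem act_targetAct (h : H.IsCoopposite H') (b c : A) (r : R) :
    M.act b (M.targetAct r c) = M.act (sliceRight H.ε (H.comulMul₂ c b)) r :=
  M.unital.act_extendedAction (n := fun b => sliceRight H.ε (H.comulMul₂ c b)) M.mul_act
    (fun b a => h.mul_sourceMap'_eq_mul b c a) b r

theorem targetAct_act (h : H.IsCoopposite H') (c x : A) (s : R) :
    M.targetAct (M.act x s) c = M.act (H.sourceMap' c x) s :=
  M.unital.extendedAction_act (n := fun b => sliceRight H.ε (H.comulMul₂ c b))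
    (M.separatingRight_act h) M.mul_act (fun b a => h.mul_sourceMap'_eq_mul b c a) x s

/-- The right action of `ε_t(A)` on `R`, as the bilinear map `(r, c) ↦ r · ε_t(c)`. -/
noncomputable def targetActₗ (h : H.IsCoopposite H') : R →ₗ[ℂ] A →ₗ[ℂ] R :=
  LinearMap.mk₂ ℂ M.targetAct
    (fun r s c => M.eq_of_act_eq h fun b => by simp only [map_add, M.act_targetAct h])
    (fun k r c => M.eq_of_act_eq h fun b => by simp only [map_smul, M.act_targetAct h])
    (fun r c d => M.eq_of_act_eq h fun b => by
      simp only [map_add, M.act_targetAct h, comulMul₂_apply, TensorProduct.tmul_add,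
        LinearMap.add_apply])
    (fun k r c => M.eq_of_act_eq h fun b => by
      simp only [map_smul, M.act_targetAct h, comulMul₂_apply, TensorProduct.tmul_smul,
        LinearMap.smul_apply])

theorem actE_tmul_mul (h : H.IsCoopposite H') (r : R) (w y : A) :
    M.actE (r ⊗ₜ (w * y)) = (M.targetActₗ h r).rTensor A (H.comulMul₂ y w) := by
  refine LinearMap.congr_fun (M.unital.ext
    (f := M.actEₗ h ∘ₗ (TensorProduct.mk ℂ R A).flip (w * y))
    (g := (LinearMap.rTensorHom A ∘ₗ M.targetActₗ h).flip (H.comulMul₂ y w)) fun x s => ?_) r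
  have h_source : M.targetActₗ h (M.act x s) = M.act.flip s ∘ₗ H.sourceMapₗ'.flip x :=
    LinearMap.ext fun c => M.targetAct_act h c x s
  have h_act := M.actE_act_tmul h x (w * y) s
  rw [left_E_tmul_mul, ← LinearMap.rTensor_comp_apply, ← h_source] at h_act
  exact h_act

theorem tmul_lift_sub_rTensor_mem_balancing (h : H.IsCoopposite H') (r : R) (z : A ⊗[ℂ] A) :
    r ⊗ₜ TensorProduct.lift H.targetMapₗ z - (M.targetActₗ h r).rTensor A z ∈ M.balancing := by
  refine (Submodule.Quotient.mk_eq_zero _).1 <| apply_eq_of_tmul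
    (M.balancing.mkQ ∘ₗ (TensorProduct.mk ℂ R A r ∘ₗ TensorProduct.lift H.targetMapₗ -
      (M.targetActₗ h r).rTensor A)) 0 (fun c a => ?_) z
  refine (Submodule.Quotient.mk_eq_zero _).2 ?_
  rw [← neg_mem_iff, LinearMap.sub_apply, neg_sub]
  exact Submodule.subset_span ⟨r, c, a, rfl⟩

/-- In the quotient by the balancing subspace, `E ▷ (r ⊗ wy) = ∑ r · ε_t(w₍₁₎) ⊗ w₍₂₎y` becomes
`∑ r ⊗ ε_t(w₍₁₎)w₍₂₎y = r ⊗ wy`. -/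
theorem sub_actE_mem_balancing (h : H.IsCoopposite H') (t : R ⊗[ℂ] A) :
    t - M.actE t ∈ M.balancing := by
  let F := M.balancing.mkQ ∘ₗ (LinearMap.id - M.actEₗ h)
  refine (Submodule.Quotient.mk_eq_zero _).1 <| apply_eq_of_tmul F 0 (fun r a => ?_) t
  refine LinearMap.congr_fun (H.ext_mul (f := F ∘ₗ TensorProduct.mk ℂ R A r) (g := 0)
    fun w y => (Submodule.Quotient.mk_eq_zero _).2 ?_) a
  have h_mem := M.tmul_lift_sub_rTensor_mem_balancing h r (H.comulMul₂ y w)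
  rw [lift_targetMapₗ_comulMul₂, ← actE_tmul_mul] at h_mem
  exact h_mem

theorem actE_targetAct_tmul (h : H.IsCoopposite H') (r : R) (c a : A) :
    M.actE (M.targetAct r c ⊗ₜ a) = M.actE (r ⊗ₜ H.targetMap c a) :=
  LinearMap.congr_fun (M.unital.ext
    (f := M.actEₗ h ∘ₗ (TensorProduct.mk ℂ R A).flip a ∘ₗ (M.targetActₗ h).flip c)
    (g := M.actEₗ h ∘ₗ (TensorProduct.mk ℂ R A).flip (H.targetMap c a)) fun x s => by
      change M.actE (M.targetAct (M.act x s) c ⊗ₜ a) = M.actE (M.act x s ⊗ₜ H.targetMap c a)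
      rw [M.targetAct_act h, M.actE_act_tmul h, h.left_E_sourceMap'_tmul, M.actE_act_tmul h]) r

theorem ker_actEₗ (h : H.IsCoopposite H') : LinearMap.ker (M.actEₗ h) = M.balancing := by
  refine le_antisymm (fun t ht => ?_) (Submodule.span_le.2 ?_)
  · have h_mem := M.sub_actE_mem_balancing h t
    rwa [← M.actEₗ_apply h, LinearMap.mem_ker.1 ht, sub_zero] at h_mem
  · rintro _ ⟨r, c, a, rfl⟩
    exact LinearMap.mem_ker.2 <| (map_sub _ _ _).trans <|
      sub_eq_zero.2 <| M.actE_targetAct_tmul h r c a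

theorem range_actEₗ (h : H.IsCoopposite H') : LinearMap.range (M.actEₗ h) = M.smash :=
  (Submodule.span_eq (LinearMap.range (M.actEₗ h))).symm

end ModuleAlgebra

end WeakMultiplierHopfAlgebra

namespace WeakMultiplierHopfAlgebra

open MultiplierAlgebra

variable {A : Type*} [NonUnitalRing A] [Module ℂ A] [IsScalarTower ℂ A A] [SMulCommClass ℂ A A]

section Pentagon

variable (H : WeakMultiplierHopfAlgebra A)

/-- The map `p ⊗ q ↦ ∑ a₍₁₎ ⊗ a₍₂₎p ⊗ a₍₃₎q`. -/
noncomputable def comul₃Mul (a : A) : A ⊗[ℂ] A →ₗ[ℂ] (A ⊗[ℂ] A) ⊗[ℂ] A :=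
  TensorProduct.lift ((LinearMap.rTensorHom A ∘ₗ (TensorProduct.curry H.T₁).flip).compl₂
    (H.T₁ ∘ₗ TensorProduct.mk ℂ A A a))

theorem comul₃Mul_tmul (a p q : A) :
    H.comul₃Mul a (p ⊗ₜ q) = (H.comulMul₂ p).rTensor A (H.comulMul₂ q a) :=
  rfl

theorem rTensor_mulLeft_assoc_comul₃Mul (d a : A) (w : A ⊗[ℂ] A) :
    (mulLeft ℂ d).rTensor (A ⊗[ℂ] A) (TensorProduct.assoc ℂ A A A (H.comul₃Mul a w)) =
      (H.comulMul w).lTensor A (H.mulComul₁ d a) := by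
  refine apply_eq_of_tmul ((mulLeft ℂ d).rTensor (A ⊗[ℂ] A) ∘ₗ
    (TensorProduct.assoc ℂ A A A).toLinearMap ∘ₗ H.comul₃Mul a)
    ((LinearMap.lTensorHom A ∘ₗ H.comulMul).flip (H.mulComul₁ d a)) (fun p q => ?_) w
  change (mulLeft ℂ d).rTensor (A ⊗[ℂ] A)
      (TensorProduct.assoc ℂ A A A (H.comul₃Mul a (p ⊗ₜ q))) =
    (H.comulMul (p ⊗ₜ q)).lTensor A (H.mulComul₁ d a)
  have h_comul : (mulLeft ℂ d).rTensor A ∘ₗ H.comulMul₂ p =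
      (mulRight ℂ p).lTensor A ∘ₗ H.mulComul₁ d :=
    LinearMap.ext fun a => H.rTensor_mulLeft_T₁ d a p
  rw [comul₃Mul_tmul, rTensor_assoc, ← LinearMap.rTensor_comp_apply, h_comul,
    LinearMap.rTensor_comp_apply, ← lTensor_rTensor_assoc, H.isColinear_mulComul₁ d,
    ← LinearMap.lTensor_comp_apply, comulMul_tmul]

/-- The pentagon equation for `T₁`: both sides are `∑ a₍₁₎ ⊗ a₍₂₎b₍₁₎ ⊗ a₍₃₎b₍₂₎c`. -/
theorem assoc_comul₃Mul_comulMul₂ (a b c : A) :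
    TensorProduct.assoc ℂ A A A (H.comul₃Mul a (H.comulMul₂ c b)) =
      (H.comulMul₂ c).lTensor A (H.comulMul₂ b a) := by
  refine H.nondegenerate.eq_of_rTensor_mulLeft fun d => ?_
  have h_comul : H.comulMul (H.comulMul₂ c b) = H.comulMul₂ c ∘ₗ mulRight ℂ b :=
    LinearMap.ext fun y => (H.T₁_mul_tmul y b c).symm
  rw [rTensor_mulLeft_assoc_comul₃Mul, h_comul, LinearMap.lTensor_comp_apply,
    rTensor_lTensor_comm, comulMul₂_apply, rTensor_mulLeft_T₁]
  rfl

end Pentagon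

namespace ModuleAlgebra

variable {R : Type*} [NonUnitalRing R] [Module ℂ R] [IsScalarTower ℂ R R] [SMulCommClass ℂ R R]
variable {H H' : WeakMultiplierHopfAlgebra A} (M : H.ModuleAlgebra R)

/-- The map `p ⊗ q ↦ (p ▷ x)(q ▷ y)`. -/
noncomputable def mulAct (x y : R) : A ⊗[ℂ] A →ₗ[ℂ] R :=
  LinearMap.mul' ℂ R ∘ₗ TensorProduct.map (M.act.flip x) (M.act.flip y)

theorem mulAct_tmul (x y : R) (p q : A) : M.mulAct x y (p ⊗ₜ q) = M.act p x * M.act q y :=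
  rfl

theorem mulAct_eq_mul'_map₂ (x y : R) (z : A ⊗[ℂ] A) :
    M.mulAct x y z = LinearMap.mul' ℂ R (TensorProduct.map₂ M.act M.act z (x ⊗ₜ y)) :=
  congrArg (LinearMap.mul' ℂ R) (map₂_apply_tmul M.act M.act z x y).symm

theorem mulAct_rTensor (x y : R) (p : A) (z : A ⊗[ℂ] A) :
    M.mulAct x y ((mulRight ℂ p).rTensor A z) = M.mulAct (M.act p x) y z :=
  apply_eq_of_tmul (M.mulAct x y ∘ₗ (mulRight ℂ p).rTensor A) (M.mulAct (M.act p x) y)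
    (fun a b => congrArg (· * M.act b y) (M.mul_act a p x)) z

theorem mulAct_lTensor (x y : R) (q : A) (z : A ⊗[ℂ] A) :
    M.mulAct x y ((mulRight ℂ q).lTensor A z) = M.mulAct x (M.act q y) z :=
  apply_eq_of_tmul (M.mulAct x y ∘ₗ (mulRight ℂ q).lTensor A) (M.mulAct x (M.act q y))
    (fun a b => congrArg (M.act a x * ·) (M.mul_act b q y)) z

theorem act_mulAct (h : H.IsCoopposite H') (a : A) (x y : R) (z : A ⊗[ℂ] A) :
    M.act a (M.mulAct x y z) = M.mulAct x y (left (H.Δ a) z) := by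
  refine apply_eq_of_tmul (M.act a ∘ₗ M.mulAct x y) (M.mulAct x y ∘ₗ left (H.Δ a))
    (fun p q => ?_) z
  have h_sep := M.separatingRight_act h
  have h_act := (M.unital.tensor M.unital).extendedAction_act (separatingRight_map₂ h_sep h_sep)
    (map₂_mul M.mul_act M.mul_act) (fun b c => (right_mul_eq_mul_left (H.Δ a) b c).symm)
    (p ⊗ₜ q) (x ⊗ₜ y)
  rw [LinearMap.comp_apply, LinearMap.comp_apply, mulAct_tmul, mulAct_eq_mul'_map₂, ← h_act]
  exact M.act_mul a (M.act p x) (M.act q y)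

theorem act_mul_act (h : H.IsCoopposite H') (a q : A) (x y : R) :
    M.act a (x * M.act q y) = M.mulAct x y (H.comulMul₂ q a) := by
  rw [mulAct_eq_mul'_map₂]
  refine LinearMap.congr_fun (M.unital.ext (f := M.act a ∘ₗ mulRight ℂ (M.act q y))
    (g := LinearMap.mul' ℂ R ∘ₗ TensorProduct.map₂ M.act M.act (H.comulMul₂ q a) ∘ₗ
      (TensorProduct.mk ℂ R R).flip y) fun p x => ?_) x
  have h_act := M.act_mulAct h a x y (p ⊗ₜ q)
  rw [H.left_Δ_tmul, mulAct_rTensor, mulAct_eq_mul'_map₂ M (M.act p x)] at h_act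
  exact h_act

theorem act_act_mul (h : H.IsCoopposite H') (a p : A) (x y : R) :
    M.act a (M.act p x * y) = M.mulAct x y (H'.copComulMul₁ p a) := by
  rw [mulAct_eq_mul'_map₂]
  refine LinearMap.congr_fun (M.unital.ext (f := M.act a ∘ₗ mulLeft ℂ (M.act p x))
    (g := LinearMap.mul' ℂ R ∘ₗ TensorProduct.map₂ M.act M.act (H'.copComulMul₁ p a) ∘ₗ
      TensorProduct.mk ℂ R R x) fun q y => ?_) y
  have h_act := M.act_mulAct h a x y (p ⊗ₜ q)
  rw [h.left_Δ_tmul, mulAct_lTensor, mulAct_eq_mul'_map₂ M x (M.act q y)] at h_act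
  exact h_act

theorem mulAct_left_E (h : H.IsCoopposite H') (x y : R) (z : A ⊗[ℂ] A) :
    M.mulAct x y (left H.E z) = M.mulAct x y z :=
  M.eq_of_act_eq h fun a => by rw [M.act_mulAct h, M.act_mulAct h, left_Δ_left_E]

/-- The map `s ⊗ b ↦ Δ(a) ▷ (s ⊗ b)`. -/
noncomputable def comulAct (a : A) : R ⊗[ℂ] A →ₗ[ℂ] R ⊗[ℂ] A :=
  TensorProduct.lift ((LinearMap.rTensorHom A ∘ₗ M.act.flip).compl₂
    (H.T₁ ∘ₗ TensorProduct.mk ℂ A A a))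

theorem comulAct_tmul (a b : A) (s : R) :
    M.comulAct a (s ⊗ₜ b) = (M.act.flip s).rTensor A (H.comulMul₂ b a) :=
  rfl

theorem comulAct_rTensor (a : A) (s : R) (z : A ⊗[ℂ] A) :
    M.comulAct a ((M.act.flip s).rTensor A z) = (M.act.flip s).rTensor A (left (H.Δ a) z) := by
  refine apply_eq_of_tmul (M.comulAct a ∘ₗ (M.act.flip s).rTensor A)
    ((M.act.flip s).rTensor A ∘ₗ left (H.Δ a)) (fun x y => ?_) z
  have h_mul : M.act.flip (M.act x s) = M.act.flip s ∘ₗ mulRight ℂ x :=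
    LinearMap.ext fun p => (M.mul_act p x s).symm
  rw [LinearMap.comp_apply, LinearMap.rTensor_tmul, LinearMap.flip_apply, comulAct_tmul, h_mul,
    LinearMap.rTensor_comp_apply, comulMul₂_apply, ← left_Δ_tmul]
  rfl

theorem comulAct_actE (h : H.IsCoopposite H') (a : A) (t : R ⊗[ℂ] A) :
    M.comulAct a (M.actE t) = M.comulAct a t := by
  refine apply_eq_of_tmul (M.comulAct a ∘ₗ M.actEₗ h) (M.comulAct a) (fun s b => ?_) t
  refine LinearMap.congr_fun (M.unital.ext
    (f := M.comulAct a ∘ₗ M.actEₗ h ∘ₗ (TensorProduct.mk ℂ R A).flip b)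
    (g := M.comulAct a ∘ₗ (TensorProduct.mk ℂ R A).flip b) fun q s => ?_) s
  have h_comul := M.comulAct_rTensor a s (left H.E (q ⊗ₜ b))
  rw [left_Δ_left_E, ← comulAct_rTensor, ← M.actE_rTensor h] at h_comul
  exact h_comul

theorem sharpMul_tmul_left (r : R) (a : A) (t : R ⊗[ℂ] A) :
    M.sharpMul (r ⊗ₜ a) t = (mulLeft ℂ r).rTensor A (M.comulAct a t) :=
  apply_eq_of_tmul (M.sharpMul (r ⊗ₜ a)) ((mulLeft ℂ r).rTensor A ∘ₗ M.comulAct a)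
    (fun s b => by rw [sharpMul_tmul, LinearMap.rTensor_comp_apply]; rfl) t

/-- The action `(r ⊗ p) · z = r(p ▷ z)` of `R # A` on `R`. -/
noncomputable def sharpAct : R ⊗[ℂ] A →ₗ[ℂ] R →ₗ[ℂ] R :=
  TensorProduct.lift ((LinearMap.llcomp ℂ R R R).compl₁₂ (LinearMap.mul ℂ R) M.act)

/-- `t(z ⊗ y) = ∑ r(a₍₁₎ ▷ z) ⊗ a₍₂₎y` for `t = r ⊗ a`. -/
theorem sharpMul_tmul_right (t : R ⊗[ℂ] A) (z : R) (y : A) :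
    M.sharpMul t (z ⊗ₜ y) = (M.sharpAct.flip z).rTensor A
      ((TensorProduct.assoc ℂ R A A).symm ((H.comulMul₂ y).lTensor R t)) := by
  refine apply_eq_of_tmul (M.sharpMul.flip (z ⊗ₜ y)) ((M.sharpAct.flip z).rTensor A ∘ₗ
    (TensorProduct.assoc ℂ R A A).symm.toLinearMap ∘ₗ (H.comulMul₂ y).lTensor R)
    (fun r a => ?_) t
  rw [LinearMap.flip_apply, sharpMul_tmul]
  exact apply_eq_of_tmul ((mulLeft ℂ r ∘ₗ M.act.flip z).rTensor A)
    ((M.sharpAct.flip z).rTensor A ∘ₗ (TensorProduct.assoc ℂ R A A).symm.toLinearMap ∘ₗ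
      TensorProduct.mk ℂ R (A ⊗[ℂ] A) r) (fun _ _ => rfl) _

theorem sharpMul_rTensor (f : A →ₗ[ℂ] R) (s : R) (b : A) (z : A ⊗[ℂ] A) :
    M.sharpMul (f.rTensor A z) (s ⊗ₜ b) = (M.sharpAct.flip s ∘ₗ f.rTensor A).rTensor A
      ((TensorProduct.assoc ℂ A A A).symm ((H.comulMul₂ b).lTensor A z)) := by
  rw [sharpMul_tmul_right, LinearMap.rTensor_comp_apply, rTensor_assoc_symm,
    rTensor_lTensor_comm]

theorem sharpAct_comp_rTensor_mulLeft_act (r s t : R) :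
    M.sharpAct.flip t ∘ₗ (mulLeft ℂ r ∘ₗ M.act.flip s).rTensor A =
      mulLeft ℂ r ∘ₗ M.mulAct s t :=
  TensorProduct.ext' fun x y => mul_assoc r (M.act x s) (M.act y t)

theorem sharpMul_actE_right (h : H.IsCoopposite H') (t u : R ⊗[ℂ] A) :
    M.sharpMul t (M.actE u) = M.sharpMul t u :=
  apply_eq_of_tmul (M.sharpMul.flip (M.actE u)) (M.sharpMul.flip u) (fun r a => by
    rw [LinearMap.flip_apply, LinearMap.flip_apply, sharpMul_tmul_left, sharpMul_tmul_left,
      M.comulAct_actE h]) t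

/-- `E` is absorbed because `∑ (E₍₁₎p₍₁₎ ▷ r)(E₍₂₎p₍₂₎ ▷ s) = ∑ (p₍₁₎ ▷ r)(p₍₂₎ ▷ s)`. -/
theorem sharpMul_actE_left (h : H.IsCoopposite H') (t u : R ⊗[ℂ] A) :
    M.sharpMul (M.actE t) u = M.sharpMul t u := by
  refine LinearMap.congr_fun (apply_eq_of_tmul (M.sharpMul ∘ₗ M.actEₗ h) M.sharpMul
    (fun r a => LinearMap.congr_fun (M.unital.ext
      (f := M.sharpMul ∘ₗ M.actEₗ h ∘ₗ (TensorProduct.mk ℂ R A).flip a)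
      (g := M.sharpMul ∘ₗ (TensorProduct.mk ℂ R A).flip a) fun p r => ?_) r) t) u
  refine TensorProduct.ext' fun s b => ?_
  change M.sharpMul (M.actE (M.act p r ⊗ₜ a)) (s ⊗ₜ b) = M.sharpMul (M.act p r ⊗ₜ a) (s ⊗ₜ b)
  have h_sharpAct : M.sharpAct.flip s ∘ₗ (M.act.flip r).rTensor A = M.mulAct r s :=
    TensorProduct.ext' fun _ _ => rfl
  have h_absorb : M.mulAct r s ∘ₗ left H.E ∘ₗ TensorProduct.mk ℂ A A p =
      mulLeft ℂ (M.act p r) ∘ₗ M.act.flip s :=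
    LinearMap.ext fun q => M.mulAct_left_E h r s (p ⊗ₜ q)
  have h_E := H.isColinear_left_E p a b
  rw [LinearMap.comp_apply, TensorProduct.mk_apply] at h_E
  rw [M.actE_act_tmul h, sharpMul_rTensor, h_sharpAct, ← h_E, LinearEquiv.symm_apply_apply,
    ← LinearMap.rTensor_comp_apply, h_absorb, sharpMul_tmul, comulMul₂_apply]

theorem targetAct_mul (h : H.IsCoopposite H') (r z : R) (c : A) :
    M.targetAct (r * z) c = r * M.targetAct z c := by
  refine LinearMap.congr_fun (M.unital.ext (f := (M.targetActₗ h).flip c ∘ₗ mulRight ℂ z)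
    (g := mulRight ℂ (M.targetAct z c)) fun p r => M.eq_of_act_eq h fun b => ?_) r
  have h_act := M.act_targetAct h b c (M.act p r * z)
  rw [M.act_act_mul h, (h.isColinear_copComulMul₁ p).apply_sliceRight] at h_act
  refine h_act.trans ?_
  rw [LinearMap.mulRight_apply, M.act_act_mul h]
  exact apply_eq_of_tmul (M.mulAct r z ∘ₗ (sliceRight H.ε ∘ₗ H.comulMul₂ c).lTensor A)
    (M.mulAct r (M.targetAct z c))
    (fun g k => congrArg (M.act g r * ·) (M.act_targetAct h k c z).symm) _

theorem actE_rTensor_mulLeft (h : H.IsCoopposite H') (r : R) (t : R ⊗[ℂ] A) :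
    M.actE ((mulLeft ℂ r).rTensor A t) = (mulLeft ℂ r).rTensor A (M.actE t) := by
  refine apply_eq_of_tmul (M.actEₗ h ∘ₗ (mulLeft ℂ r).rTensor A)
    ((mulLeft ℂ r).rTensor A ∘ₗ M.actEₗ h) (fun z a => LinearMap.congr_fun (H.ext_mul
      (f := (M.actEₗ h ∘ₗ (mulLeft ℂ r).rTensor A) ∘ₗ TensorProduct.mk ℂ R A z)
      (g := ((mulLeft ℂ r).rTensor A ∘ₗ M.actEₗ h) ∘ₗ TensorProduct.mk ℂ R A z)
      fun w y => ?_) a) t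
  have h_mul : M.targetActₗ h (r * z) = mulLeft ℂ r ∘ₗ M.targetActₗ h z :=
    LinearMap.ext fun c => M.targetAct_mul h r z c
  change M.actE ((r * z) ⊗ₜ (w * y)) = (mulLeft ℂ r).rTensor A (M.actE (z ⊗ₜ (w * y)))
  rw [M.actE_tmul_mul h, M.actE_tmul_mul h, h_mul, LinearMap.rTensor_comp_apply]

theorem actE_sharpMul (h : H.IsCoopposite H') (t u : R ⊗[ℂ] A) :
    M.actE (M.sharpMul t u) = M.sharpMul t u := by
  refine LinearMap.congr_fun (apply_eq_of_tmul (M.sharpMul.compr₂ (M.actEₗ h)) M.sharpMul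
    (fun r a => TensorProduct.ext' fun s b => ?_) t) u
  rw [LinearMap.compr₂_apply, actEₗ_apply, sharpMul_tmul_left, M.actE_rTensor_mulLeft h,
    comulAct_tmul, M.actE_rTensor h, comulMul₂_apply, left_E_T₁]

/-- `(r ⊗ a)(s(x ▷ t) ⊗ y) = ∑ r(a₍₁₎ ▷ s)(a₍₂₎x ▷ t) ⊗ a₍₃₎y`. -/
theorem sharpMul_tmul_rTensor (h : H.IsCoopposite H') (r s t : R) (a : A) (w : A ⊗[ℂ] A) :
    M.sharpMul (r ⊗ₜ a) ((mulLeft ℂ s ∘ₗ M.act.flip t).rTensor A w) =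
      (mulLeft ℂ r ∘ₗ M.mulAct s t).rTensor A (H.comul₃Mul a w) := by
  refine apply_eq_of_tmul (M.sharpMul (r ⊗ₜ a) ∘ₗ (mulLeft ℂ s ∘ₗ M.act.flip t).rTensor A)
    ((mulLeft ℂ r ∘ₗ M.mulAct s t).rTensor A ∘ₗ H.comul₃Mul a) (fun p q => ?_) w
  have h_act : M.act.flip (s * M.act p t) = M.mulAct s t ∘ₗ H.comulMul₂ p :=
    LinearMap.ext fun x => M.act_mul_act h x p s t
  rw [LinearMap.comp_apply, LinearMap.comp_apply, LinearMap.rTensor_tmul, sharpMul_tmul,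
    comul₃Mul_tmul, ← LinearMap.rTensor_comp_apply, LinearMap.comp_assoc, ← h_act]
  rfl

theorem sharpMul_assoc (h : H.IsCoopposite H') (x y z : R ⊗[ℂ] A) :
    M.sharpMul (M.sharpMul x y) z = M.sharpMul x (M.sharpMul y z) := by
  refine LinearMap.congr_fun (LinearMap.congr_fun (apply_eq_of_tmul
    (LinearMap.llcomp ℂ _ _ _ M.sharpMul ∘ₗ M.sharpMul)
    ((LinearMap.llcomp ℂ _ _ _).flip M.sharpMul ∘ₗ LinearMap.llcomp ℂ _ _ _ ∘ₗ M.sharpMul)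
    (fun r a => TensorProduct.ext' fun s b => TensorProduct.ext' fun t c => ?_) x) y) z
  change M.sharpMul (M.sharpMul (r ⊗ₜ a) (s ⊗ₜ b)) (t ⊗ₜ c) =
    M.sharpMul (r ⊗ₜ a) (M.sharpMul (s ⊗ₜ b) (t ⊗ₜ c))
  rw [M.sharpMul_tmul r s, M.sharpMul_tmul s t, sharpMul_rTensor,
    sharpAct_comp_rTensor_mulLeft_act, M.sharpMul_tmul_rTensor h, ← comulMul₂_apply,
    ← comulMul₂_apply, ← H.assoc_comul₃Mul_comulMul₂, LinearEquiv.symm_apply_apply]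

end ModuleAlgebra

/-- The map `a ↦ ∑ a₍₁₎ ⊗ S(a₍₂₎)b ⊗ a₍₃₎y`. -/
noncomputable def antipodeComul (H : WeakMultiplierHopfAlgebra A) (b y : A) :
    A →ₗ[ℂ] A ⊗[ℂ] (A ⊗[ℂ] A) :=
  (TensorProduct.assoc ℂ A A A).toLinearMap ∘ₗ
    (H.R₁ ∘ₗ (TensorProduct.mk ℂ A A).flip b).rTensor A ∘ₗ H.comulMul₂ y

theorem IsCoopposite.rTensor_mulRight_antipodeComul {H H' : WeakMultiplierHopfAlgebra A}
    (h : H.IsCoopposite H') (b y d : A) :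
    (mulRight ℂ d).rTensor (A ⊗[ℂ] A) ∘ₗ H.antipodeComul b y =
      ((H.antipode.flip b).rTensor A ∘ₗ H.comulMul₂ y).lTensor A ∘ₗ H'.copComulMul₁ d := by
  have h_R₁ : (mulRight ℂ d).rTensor A ∘ₗ H.R₁ ∘ₗ (TensorProduct.mk ℂ A A).flip b =
      (H.antipode.flip b).lTensor A ∘ₗ H'.copComulMul₁ d :=
    LinearMap.ext fun c => h.rTensor_mulRight_R₁ c b d
  ext a
  change (mulRight ℂ d).rTensor (A ⊗[ℂ] A) (TensorProduct.assoc ℂ A A A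
    ((H.R₁ ∘ₗ (TensorProduct.mk ℂ A A).flip b).rTensor A (H.comulMul₂ y a))) = _
  rw [rTensor_assoc, ← LinearMap.rTensor_comp_apply, h_R₁, LinearMap.rTensor_comp_apply,
    ← lTensor_rTensor_assoc, h.isColinear_copComulMul₁, LinearMap.comp_apply,
    LinearMap.lTensor_comp_apply]

namespace ModuleAlgebra

variable {R : Type*} [NonUnitalRing R] [Module ℂ R] [IsScalarTower ℂ R R] [SMulCommClass ℂ R R]
variable {H H' : WeakMultiplierHopfAlgebra A} (M : H.ModuleAlgebra R)

theorem act₂_T₂_tmul (d a : A) (t : R ⊗[ℂ] A) :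
    M.act₂ (H.T₂ (d ⊗ₜ a)) t = (M.act d).rTensor A (M.comulAct a t) := by
  refine apply_eq_of_tmul (M.act₂ (H.T₂ (d ⊗ₜ a))) ((M.act d).rTensor A ∘ₗ M.comulAct a)
    (fun s b => ?_) t
  have h_act : M.act.flip s ∘ₗ mulLeft ℂ d = M.act d ∘ₗ M.act.flip s :=
    LinearMap.ext fun p => M.mul_act d p s
  rw [act₂_tmul, ← rTensor_mulLeft_T₁, ← LinearMap.rTensor_comp_apply, h_act,
    LinearMap.rTensor_comp_apply]
  rfl

theorem actE_eq_zero_of_sharpMul_left (h : H.IsCoopposite H') (hR : NonDegenerateProduct R)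
    {t : R ⊗[ℂ] A} (ht : ∀ u, M.sharpMul u t = 0) : M.actE t = 0 := by
  have h_comulAct : ∀ a, M.comulAct a t = 0 := fun a => hR.eq_of_rTensor_mulLeft fun r => by
    rw [← sharpMul_tmul_left, ht, map_zero]
  have h_T₂ : ∀ w, M.act₂ (H.T₂ w) t = 0 :=
    apply_eq_of_tmul (M.act₂.flip t ∘ₗ H.T₂) 0 fun d a =>
      (M.act₂_T₂_tmul d a t).trans (by rw [h_comulAct, map_zero, LinearMap.zero_apply])
  refine M.eq_of_act₂_eq h fun z => ?_
  obtain ⟨w, hw⟩ : right H.E z ∈ LinearMap.range H.T₂ := H.range_T₂ ▸ ⟨z, rfl⟩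
  rw [act₂_actE, ← hw, h_T₂, map_zero]

theorem targetAct_mul_act (h : H.IsCoopposite H') (r s : R) (c a : A) :
    M.targetAct r c * M.act a s = r * M.act (H.targetMap c a) s := by
  refine LinearMap.congr_fun (M.unital.ext
    (f := mulRight ℂ (M.act a s) ∘ₗ (M.targetActₗ h).flip c)
    (g := mulRight ℂ (M.act (H.targetMap c a) s)) fun p r => ?_) r
  have h_E := M.mulAct_left_E h r s (H.sourceMap' c p ⊗ₜ a)
  rw [h.left_E_sourceMap'_tmul, M.mulAct_left_E h, mulAct_tmul, mulAct_tmul,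
    ← M.targetAct_act h] at h_E
  exact h_E.symm

theorem actE_lTensor_mulRight (h : H.IsCoopposite H') (y : A) (t : R ⊗[ℂ] A) :
    M.actE ((mulRight ℂ y).lTensor R t) = (mulRight ℂ y).lTensor R (M.actE t) := by
  let F := M.actEₗ h ∘ₗ (mulRight ℂ y).lTensor R
  let G := (mulRight ℂ y).lTensor R ∘ₗ M.actEₗ h
  refine apply_eq_of_tmul F G (fun r a => LinearMap.congr_fun (M.unital.ext
    (f := F ∘ₗ (TensorProduct.mk ℂ R A).flip a) (g := G ∘ₗ (TensorProduct.mk ℂ R A).flip a)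
    fun x s => ?_) r) t
  change M.actE (M.act x s ⊗ₜ (a * y)) = (mulRight ℂ y).lTensor R (M.actE (M.act x s ⊗ₜ a))
  rw [M.actE_act_tmul h, M.actE_act_tmul h, ← rTensor_lTensor_comm,
    ← left_lTensor_mulRight H.nondegenerate H.nondegenerate]
  rfl

theorem sharpAct_flip_act (d : A) (z : R) :
    M.sharpAct.flip (M.act d z) = M.sharpAct.flip z ∘ₗ (mulRight ℂ d).lTensor R :=
  TensorProduct.ext' fun r p => congrArg (r * ·) (M.mul_act p d z).symm

/-- The map `f ⊗ v ⊗ q ↦ f(v ▷ s) ⊗ q`. -/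
noncomputable def evalAct (s : R) : (R →ₗ[ℂ] R) ⊗[ℂ] (A ⊗[ℂ] A) →ₗ[ℂ] R ⊗[ℂ] A :=
  TensorProduct.lift (LinearMap.rTensorHom A ∘ₗ LinearMap.lcomp ℂ R (M.act.flip s))

theorem evalAct_sharpAct_tmul_assoc (r s : R) (w : (A ⊗[ℂ] A) ⊗[ℂ] A) :
    M.evalAct s (M.sharpAct.rTensor (A ⊗[ℂ] A)
      ((TensorProduct.assoc ℂ R A (A ⊗[ℂ] A)).symm (r ⊗ₜ TensorProduct.assoc ℂ A A A w))) =
      (mulLeft ℂ r ∘ₗ M.act.flip s ∘ₗ LinearMap.mul' ℂ A).rTensor A w :=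
  apply_eq_of_tmul₃ (M.evalAct s ∘ₗ M.sharpAct.rTensor (A ⊗[ℂ] A) ∘ₗ
      (TensorProduct.assoc ℂ R A (A ⊗[ℂ] A)).symm.toLinearMap ∘ₗ
      TensorProduct.mk ℂ R (A ⊗[ℂ] (A ⊗[ℂ] A)) r ∘ₗ (TensorProduct.assoc ℂ A A A).toLinearMap)
    ((mulLeft ℂ r ∘ₗ M.act.flip s ∘ₗ LinearMap.mul' ℂ A).rTensor A)
    (fun u v q => congrArg (fun x => (r * x) ⊗ₜ[ℂ] q) (M.mul_act u v s).symm) w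

/-- `∑ r(a₍₁₎S(a₍₂₎)b ▷ s) ⊗ a₍₃₎y = ∑ r(ε_t(a₍₁₎)b ▷ s) ⊗ a₍₂₎y`, and this is
`(E ▷ (r ⊗ a))((b ▷ s) ⊗ y)` in `R ⊗ A`. -/
theorem evalAct_sharpAct_antipodeComul (h : H.IsCoopposite H') (s : R) (b y : A) (t : R ⊗[ℂ] A) :
    M.evalAct s (M.sharpAct.rTensor (A ⊗[ℂ] A) ((TensorProduct.assoc ℂ R A (A ⊗[ℂ] A)).symm
      ((H.antipodeComul b y).lTensor R t))) =
      (mulRight ℂ (M.act b s)).rTensor A ((mulRight ℂ y).lTensor R (M.actE t)) := by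
  rw [← M.actE_lTensor_mulRight h]
  refine apply_eq_of_tmul (M.evalAct s ∘ₗ M.sharpAct.rTensor (A ⊗[ℂ] A) ∘ₗ
      (TensorProduct.assoc ℂ R A (A ⊗[ℂ] A)).symm.toLinearMap ∘ₗ (H.antipodeComul b y).lTensor R)
    ((mulRight ℂ (M.act b s)).rTensor A ∘ₗ M.actEₗ h ∘ₗ (mulRight ℂ y).lTensor R)
    (fun r a => ?_) t
  have h_target : (mulLeft ℂ r ∘ₗ M.act.flip s ∘ₗ LinearMap.mul' ℂ A) ∘ₗ
      H.R₁ ∘ₗ (TensorProduct.mk ℂ A A).flip b =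
        mulRight ℂ (M.act b s) ∘ₗ M.targetActₗ h r := by
    ext p
    refine Eq.trans ?_ (M.targetAct_mul_act h r s p b).symm
    exact congrArg (fun x => r * M.act x s) (H.mul'_R₁ (p ⊗ₜ b))
  refine (M.evalAct_sharpAct_tmul_assoc r s _).trans ?_
  change _ = (mulRight ℂ (M.act b s)).rTensor A (M.actE (r ⊗ₜ (a * y)))
  rw [LinearMap.comp_apply, ← LinearMap.rTensor_comp_apply, h_target, M.actE_tmul_mul h,
    LinearMap.rTensor_comp_apply]

section RightAnnihilator

variable {t : R ⊗[ℂ] A} (ht : ∀ u, M.sharpMul t u = 0)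

include ht

theorem rTensor_sharpAct_copComulMul₁_eq_zero (h : H.IsCoopposite H') (d : A) (z : R) :
    (M.sharpAct.flip z).rTensor A
      ((TensorProduct.assoc ℂ R A A).symm ((H'.copComulMul₁ d).lTensor R t)) = 0 := by
  refine H.nondegenerate.eq_of_lTensor_mulRight fun y => ?_
  have h_comul : (mulRight ℂ y).lTensor A ∘ₗ H'.copComulMul₁ d =
      (mulRight ℂ d).rTensor A ∘ₗ H.comulMul₂ y :=
    LinearMap.ext fun a => (h.rTensor_mulRight_comulMul₂ a d y).symm
  rw [map_zero, ← rTensor_lTensor_comm, lTensor_assoc_symm, ← LinearMap.lTensor_comp_apply,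
    h_comul, LinearMap.lTensor_comp_apply, ← rTensor_lTensor_assoc_symm,
    ← LinearMap.rTensor_comp_apply, ← sharpAct_flip_act, ← sharpMul_tmul_right, ht]

theorem rTensor_sharpAct_antipodeComul_eq_zero (h : H.IsCoopposite H') (b y : A) :
    M.sharpAct.rTensor (A ⊗[ℂ] A) ((TensorProduct.assoc ℂ R A (A ⊗[ℂ] A)).symm
      ((H.antipodeComul b y).lTensor R t)) = 0 := by
  let w := (TensorProduct.assoc ℂ R A (A ⊗[ℂ] A)).symm ((H.antipodeComul b y).lTensor R t)
  refine rTensor_eq_zero_of_flip _ fun z => LinearMap.congr_fun (M.unital.ext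
    (f := (LinearMap.rTensorHom (A ⊗[ℂ] A) ∘ₗ M.sharpAct.flip).flip w) (g := 0) fun d z => ?_) z
  change (M.sharpAct.flip (M.act d z)).rTensor (A ⊗[ℂ] A) w = 0
  rw [sharpAct_flip_act, LinearMap.rTensor_comp_apply, rTensor_lTensor_assoc_symm,
    ← LinearMap.lTensor_comp_apply, h.rTensor_mulRight_antipodeComul,
    LinearMap.lTensor_comp_apply, ← lTensor_assoc_symm, rTensor_lTensor_comm,
    M.rTensor_sharpAct_copComulMul₁_eq_zero ht h, map_zero]

theorem actE_eq_zero_of_sharpMul_right (h : H.IsCoopposite H') (hR : NonDegenerateProduct R) :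
    M.actE t = 0 := by
  refine H.nondegenerate.eq_of_lTensor_mulRight fun y => hR.eq_of_rTensor_mulRight fun s => ?_
  rw [map_zero, map_zero]
  refine LinearMap.congr_fun (M.unital.ext (f := (LinearMap.rTensorHom A ∘ₗ
    (LinearMap.mul ℂ R).flip).flip ((mulRight ℂ y).lTensor R (M.actE t))) (g := 0)
    fun b s => ?_) s
  have h_eval := M.evalAct_sharpAct_antipodeComul h s b y t
  rw [M.rTensor_sharpAct_antipodeComul_eq_zero ht h, map_zero] at h_eval
  exact h_eval.symm

end RightAnnihilator

theorem mem_balancing_iff (h : H.IsCoopposite H') {t : R ⊗[ℂ] A} :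
    t ∈ M.balancing ↔ M.actE t = 0 := by
  rw [← M.ker_actEₗ h, LinearMap.mem_ker, actEₗ_apply]

/-- The product on `R ⊗_t A` induced by the product of `R # A`. -/
noncomputable def balancedMul (h : H.IsCoopposite H') :
    M.TensorOverTarget →ₗ[ℂ] M.TensorOverTarget →ₗ[ℂ] M.TensorOverTarget :=
  LinearMap.liftQ₂ M.balancing M.balancing (M.sharpMul.compr₂ M.balancing.mkQ)
    (fun t ht => LinearMap.ext fun u => by
      rw [LinearMap.compr₂_apply, ← M.sharpMul_actE_left h, (M.mem_balancing_iff h).1 ht,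
        map_zero, LinearMap.zero_apply, map_zero, LinearMap.zero_apply])
    (fun t ht => LinearMap.ext fun u => by
      rw [LinearMap.flip_apply, LinearMap.compr₂_apply, ← M.sharpMul_actE_right h,
        (M.mem_balancing_iff h).1 ht, map_zero, map_zero, LinearMap.zero_apply])

theorem balancedMul_mkQ (h : H.IsCoopposite H') (t u : R ⊗[ℂ] A) :
    M.balancedMul h (M.balancing.mkQ t) (M.balancing.mkQ u) =
      M.balancing.mkQ (M.sharpMul t u) :=
  rfl

theorem balancedMul_mkQ_eq_zero_iff (h : H.IsCoopposite H') {t u : R ⊗[ℂ] A} :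
    M.balancedMul h (M.balancing.mkQ t) (M.balancing.mkQ u) = 0 ↔ M.sharpMul t u = 0 := by
  rw [balancedMul_mkQ, Submodule.mkQ_apply, Submodule.Quotient.mk_eq_zero,
    M.mem_balancing_iff h, M.actE_sharpMul h]

theorem balancedMul_assoc (h : H.IsCoopposite H') (x y z : M.TensorOverTarget) :
    M.balancedMul h (M.balancedMul h x y) z = M.balancedMul h x (M.balancedMul h y z) := by
  obtain ⟨x, rfl⟩ := M.balancing.mkQ_surjective x
  obtain ⟨y, rfl⟩ := M.balancing.mkQ_surjective y
  obtain ⟨z, rfl⟩ := M.balancing.mkQ_surjective z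
  simp only [balancedMul_mkQ, M.sharpMul_assoc h]

theorem eq_zero_of_balancedMul_right (h : H.IsCoopposite H') (hR : NonDegenerateProduct R)
    {x : M.TensorOverTarget} (hx : ∀ y, M.balancedMul h x y = 0) : x = 0 := by
  obtain ⟨t, rfl⟩ := M.balancing.mkQ_surjective x
  rw [Submodule.mkQ_apply, Submodule.Quotient.mk_eq_zero, M.mem_balancing_iff h]
  exact M.actE_eq_zero_of_sharpMul_right
    (fun _ => (M.balancedMul_mkQ_eq_zero_iff h).1 (hx _)) h hR

theorem eq_zero_of_balancedMul_left (h : H.IsCoopposite H') (hR : NonDegenerateProduct R)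
    {x : M.TensorOverTarget} (hx : ∀ y, M.balancedMul h y x = 0) : x = 0 := by
  obtain ⟨t, rfl⟩ := M.balancing.mkQ_surjective x
  rw [Submodule.mkQ_apply, Submodule.Quotient.mk_eq_zero, M.mem_balancing_iff h]
  exact M.actE_eq_zero_of_sharpMul_left h hR
    fun _ => (M.balancedMul_mkQ_eq_zero_iff h).1 (hx _)

/-- The isomorphism `R ⊗_t A ≃ R #_E A` induced by the action of `E` on `R ⊗ A`. -/
noncomputable def balancedEquivSmash (h : H.IsCoopposite H') :
    M.TensorOverTarget ≃ₗ[ℂ] M.smash :=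
  Submodule.quotEquivOfEq _ _ (M.ker_actEₗ h).symm ≪≫ₗ (M.actEₗ h).quotKerEquivRange ≪≫ₗ
    LinearEquiv.ofEq _ _ (M.range_actEₗ h)

theorem balancedEquivSmash_mkQ (h : H.IsCoopposite H') (t : R ⊗[ℂ] A) :
    (M.balancedEquivSmash h (M.balancing.mkQ t) : R ⊗[ℂ] A) = M.actE t :=
  rfl

theorem balancedEquivSmash_balancedMul (h : H.IsCoopposite H') (x y : M.TensorOverTarget) :
    (M.balancedEquivSmash h (M.balancedMul h x y) : R ⊗[ℂ] A) =
      M.sharpMul (M.balancedEquivSmash h x) (M.balancedEquivSmash h y) := by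
  obtain ⟨t, rfl⟩ := M.balancing.mkQ_surjective x
  obtain ⟨u, rfl⟩ := M.balancing.mkQ_surjective y
  rw [balancedMul_mkQ, balancedEquivSmash_mkQ, balancedEquivSmash_mkQ, balancedEquivSmash_mkQ,
    M.actE_sharpMul h, M.sharpMul_actE_left h, M.sharpMul_actE_right h]

end ModuleAlgebra

end WeakMultiplierHopfAlgebra

theorem mainTheorem6 {A R : Type*}
    [NonUnitalRing A] [Module ℂ A] [IsScalarTower ℂ A A] [SMulCommClass ℂ A A]
    [NonUnitalRing R] [Module ℂ R] [IsScalarTower ℂ R R] [SMulCommClass ℂ R R]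
    (H : WeakMultiplierHopfAlgebra A) (hH : H.IsRegular)
    (hR : NonDegenerateProduct R) (M : H.ModuleAlgebra R) :
    ∃ μ : M.TensorOverTarget →ₗ[ℂ] M.TensorOverTarget →ₗ[ℂ] M.TensorOverTarget,
      (∀ (r s : R) (a b : A),
        μ (M.balancing.mkQ (r ⊗ₜ a)) (M.balancing.mkQ (s ⊗ₜ b)) =
          M.balancing.mkQ (M.sharpMul (r ⊗ₜ a) (s ⊗ₜ b))) ∧
      (∀ x y z, μ (μ x y) z = μ x (μ y z)) ∧
      (∀ x, (∀ y, μ x y = 0) → x = 0) ∧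
      (∀ x, (∀ y, μ y x = 0) → x = 0) ∧
      ∃ f : M.TensorOverTarget ≃ₗ[ℂ] M.smash,
        (∀ (r : R) (a : A), (f (M.balancing.mkQ (r ⊗ₜ a)) : R ⊗[ℂ] A) = M.actE (r ⊗ₜ a)) ∧
        (∀ x y, (f (μ x y) : R ⊗[ℂ] A) = M.sharpMul (f x) (f y)) := by
  obtain ⟨-, -, H', h⟩ := hH
  exact ⟨M.balancedMul h, fun r s a b => M.balancedMul_mkQ h (r ⊗ₜ a) (s ⊗ₜ b),
    M.balancedMul_assoc h, fun _ => M.eq_zero_of_balancedMul_right h hR,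
    fun _ => M.eq_zero_of_balancedMul_left h hR, M.balancedEquivSmash h,
    fun r a => M.balancedEquivSmash_mkQ h (r ⊗ₜ a), M.balancedEquivSmash_balancedMul h⟩
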